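/- Let $T=\{x,y\}^*$ be the binary rooted tree, let $\mathrm{Aut}(T)$ act on $T$ from the right, and for $g,h\in\mathrm{Aut}(T)$ let $\langle\!\langle g,h\rangle\!\rangle\in\mathrm{Aut}(T)$ be the automorphism acting as $g$ on the subtree below $x$ and as $h$ on the subtree below $y$; for subgroups $H,K\le\mathrm{Aut}(T)$ write $H\times K=\{\langle\!\langle h,k\rangle\!\rangle : h\in H,\ k\in K\}\le\mathrm{Aut}(T)$. Let $a,b\in\mathrm{Aut}(T)$ be defined recursively by $$a=\langle\!\langle b,1\rangle\!\rangle\,(x,y),\qquad b=\langle\!\langle a,1\rangle\!\rangle,$$ where $(x,y)$ exchanges the two subtrees below the root, and let $G=\langle a,b\rangle$. Write $[u,v]=u^{-1}v^{-1}uv$ and $c=[a,b]$, $d=[c,a]$, $e=[d,a]$. Let $\gamma_1=G$, $\gamma_{n+1}=[\gamma_n,G]$ be the lower central series of $G$, and let $\Gamma_n$ $(n\ge 1)$ be its lower $2$-central series, defined by $\Gamma_1=G$ and $$\Gamma_{n+1}=[G,\Gamma_n]\,\bigl(\Gamma_{\lceil (n+1)/2\rceil}\bigr)^2\qquad(n\ge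 1),$$ where $H^2$ denotes the subgroup generated by the squares of the elements of $H$. Then: 1. $G''=\gamma_3\times\gamma_3$ and $\gamma_3=(\gamma_3\times\gamma_3)\,\langle d,e\rangle$. 2. $\gamma_1/\gamma_2\cong\mathbb Z^2$, $\gamma_2/\gamma_3\cong\mathbb Z$, $\gamma_3/\gamma_4\cong\mathbb Z/4$, and $\gamma_n/\gamma_{n+1}$ is finite for every $n\ge 3$. 3. For every $n\ge 1$ the group $\Gamma_n/\Gamma_{n+1}$ is a finite elementary abelian $2$-group, and $$\dim_{\mathbb F_2}\Gamma_n/\Gamma_{n+1}=\begin{cases} i+2 & \text{if } n=2^i \text{ for some } i\ge 0,\\ \max\{\,i+1 : i\ge 0,\ 2^i\text{ divides } n\,\} & \text{otherwise.}\end{cases}$$ -/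

import Mathlib

open scoped Pointwise

namespace Basilica

/-- Rooted automorphisms of the binary rooted tree, whose vertices are the finite words in the
letters `x = false` and `y = true`: the automorphisms of the prefix order. -/
abbrev Aut : Type :=
  RelIso (fun u v : List Bool => u <+: v) (fun u v : List Bool => u <+: v)

/-- The automorphism group of the tree acting on the right: `g * h` is `g` followed by `h`. -/
abbrev RAut : Type := Autᵐᵒᵖ

/-- The right action of an automorphism on a vertex, `v ^ g`. -/
def act (v : List Bool) (g : RAut) : List Bool := g.unop v

theorem act_mul (v : List Bool) (g h : RAut) : act v (g * h) = act (act v g) h := rfl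

theorem aut_nil (g : Aut) : g [] = [] := by
  have h : g [] <+: g (g.symm []) := g.map_rel_iff.2 List.nil_prefix
  rw [RelIso.apply_symm_apply] at h
  exact List.prefix_nil.1 h

theorem ext_act {g h : RAut} (w : ∀ v, act v g = act v h) : g = h :=
  MulOpposite.unop_injective (RelIso.ext w)

/-- The map underlying `⟨g, h⟩`. -/
def pairFun (g h : List Bool → List Bool) : List Bool → List Bool
  | [] => []
  | false :: w => false :: g w
  | true :: w => true :: h w

/-- `⟨g, h⟩`: the automorphism acting as `g` on the subtree below `x` and as `h` on the
subtree below `y`. -/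
def pair (g h : RAut) : RAut := MulOpposite.op
  { toFun := pairFun g.unop h.unop
    invFun := pairFun g.unop.symm h.unop.symm
    left_inv := by
      rintro (_ | ⟨_ | _, w⟩) <;> simp [pairFun]
    right_inv := by
      rintro (_ | ⟨_ | _, w⟩) <;> simp [pairFun]
    map_rel_iff' := by
      rintro (_ | ⟨_ | _, u⟩) (_ | ⟨_ | _, v⟩) <;>
        simp [pairFun, List.cons_prefix_cons]
      · exact g.unop.map_rel_iff
      · exact h.unop.map_rel_iff }

/-- The map underlying the transposition of the two top subtrees. -/
def swapFun : List Bool → List Bool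
  | [] => []
  | i :: w => (!i) :: w

/-- The transposition `(x, y)` of the two top subtrees. -/
def swap : RAut := MulOpposite.op
  { toFun := swapFun
    invFun := swapFun
    left_inv := by rintro (_ | ⟨_ | _, w⟩) <;> simp [swapFun]
    right_inv := by rintro (_ | ⟨_ | _, w⟩) <;> simp [swapFun]
    map_rel_iff' := by
      rintro (_ | ⟨_ | _, u⟩) (_ | ⟨_ | _, v⟩) <;>
        simp [swapFun, List.cons_prefix_cons] }

/-- The embedding `(g, h) ↦ ⟨g, h⟩`. -/
def pairHom : RAut × RAut →* RAut where
  toFun p := pair p.1 p.2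
  map_one' := ext_act (by rintro (_ | ⟨_ | _, w⟩) <;> rfl)
  map_mul' _ _ := ext_act (by rintro (_ | ⟨_ | _, w⟩) <;> rfl)

/-- `H × K`, acting on the tree by `⟨h, k⟩` with `h ∈ H` and `k ∈ K`. -/
def prodSubgroup (H K : Subgroup RAut) : Subgroup RAut := (H.prod K).map pairHom

/-- `genFun false` is the action of `a` and `genFun true` is the action of `b`. -/
def genFun : Bool → List Bool → List Bool
  | _, [] => []
  | false, false :: w => true :: genFun true w
  | false, true :: w => false :: w
  | true, false :: w => false :: genFun false w
  | true, true :: w => true :: w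

/-- The inverse maps of `genFun`. -/
def genInv : Bool → List Bool → List Bool
  | _, [] => []
  | false, true :: w => false :: genInv true w
  | false, false :: w => true :: w
  | true, false :: w => false :: genInv false w
  | true, true :: w => true :: w

theorem genInv_genFun (s : Bool) (w : List Bool) : genInv s (genFun s w) = w := by
  induction w generalizing s with
  | nil => cases s <;> rfl
  | cons i w ih => cases s <;> cases i <;> simp [genFun, genInv, ih]

theorem genFun_genInv (s : Bool) (w : List Bool) : genFun s (genInv s w) = w := by
  induction w generalizing s with
  | nil => cases s <;> rfl
  | cons i w ih => cases s <;> cases i <;> simp [genFun, genInv, ih]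

theorem genFun_prefix (s : Bool) (u v : List Bool) :
    genFun s u <+: genFun s v ↔ u <+: v := by
  induction u generalizing s v with
  | nil => cases s <;> simp [genFun]
  | cons i u ih =>
    rcases v with _ | ⟨j, v⟩
    · cases s <;> cases i <;> simp [genFun]
    · cases s <;> cases i <;> cases j <;> simp [genFun, List.cons_prefix_cons, ih]

/-- The automorphism with underlying map `genFun s`. -/
def gen (s : Bool) : RAut := MulOpposite.op
  { toFun := genFun s
    invFun := genInv s
    left_inv := genInv_genFun s
    right_inv := genFun_genInv s
    map_rel_iff' := genFun_prefix s _ _ }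

/-- The generator `a = ⟨b, 1⟩ (x, y)`. -/
def a : RAut := gen false

/-- The generator `b = ⟨a, 1⟩`. -/
def b : RAut := gen true

theorem a_eq : a = pair b 1 * swap :=
  ext_act (by rintro (_ | ⟨_ | _, w⟩) <;> rfl)

theorem b_eq : b = pair a 1 :=
  ext_act (by rintro (_ | ⟨_ | _, w⟩) <;> rfl)

/-- The group `G = ⟨a, b⟩`. -/
def G : Subgroup RAut := Subgroup.closure {a, b}

/-- The commutator `[u, v] = u⁻¹ v⁻¹ u v`. -/
def comm {Γ : Type*} [Group Γ] (u v : Γ) : Γ := u⁻¹ * v⁻¹ * u * v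

/-- `c = [a, b]`. -/
def c : RAut := comm a b

/-- `d = [c, a]`. -/
def d : RAut := comm c a

/-- `e = [d, a]`. -/
def e : RAut := comm d a

/-- The lower central series `γ₁ = Γ`, `γₙ₊₁ = [γₙ, Γ]`, indexed from `1`
(with `γ₀ = Γ` as a dummy value). -/
def gamma (Γ : Type*) [Group Γ] (n : ℕ) : Subgroup Γ :=
  (⊤ : Subgroup Γ).lowerCentralSeries (n - 1)

instance gamma_normal (Γ : Type*) [Group Γ] (n : ℕ) : (gamma Γ n).Normal :=
  inferInstanceAs ((⊤ : Subgroup Γ).lowerCentralSeries (n - 1)).Normal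

/-- The subgroup `H²` generated by the squares of the elements of `H`. -/
def squares {Γ : Type*} [Group Γ] (H : Subgroup Γ) : Subgroup Γ :=
  Subgroup.closure {g | ∃ h ∈ H, g = h ^ 2}

instance squares_normal {Γ : Type*} [Group Γ] (H : Subgroup Γ) [hH : H.Normal] :
    (squares H).Normal := by
  have h : Group.conjugatesOfSet {g | ∃ h ∈ H, g = h ^ 2} = {g | ∃ h ∈ H, g = h ^ 2} := by
    refine Set.Subset.antisymm ?_ Group.subset_conjugatesOfSet
    intro x hx
    obtain ⟨_, ⟨h, hh, rfl⟩, hc⟩ := Group.mem_conjugatesOfSet_iff.1 hx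
    obtain ⟨k, rfl⟩ := isConj_iff.1 hc
    exact ⟨k * h * k⁻¹, hH.conj_mem h hh k, conj_pow.symm⟩
  have h' : squares H = Subgroup.normalClosure {g | ∃ h ∈ H, g = h ^ 2} := by
    rw [squares, Subgroup.normalClosure, h]
  rw [h']
  exact Subgroup.normalClosure_normal

/-- The lower `2`-central series `Γ₁ = Γ`, `Γₙ₊₁ = [Γ, Γₙ] (Γ_⌈(n+1)/2⌉)²`, indexed from `1`
(with `Γ₀ = Γ` as a dummy value). -/
def twoCentral (Γ : Type*) [Group Γ] : ℕ → Subgroup Γ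
  | 0 => ⊤
  | 1 => ⊤
  | n + 2 => ⁅(⊤ : Subgroup Γ), twoCentral Γ (n + 1)⁆ ⊔ squares (twoCentral Γ ((n + 3) / 2))

instance twoCentral_normal (Γ : Type*) [Group Γ] (n : ℕ) : (twoCentral Γ n).Normal := by
  induction n using Nat.strong_induction_on with
  | _ n ih =>
    match n, ih with
    | 0, _ => rw [twoCentral]; infer_instance
    | 1, _ => rw [twoCentral]; infer_instance
    | n + 2, ih =>
      rw [twoCentral]
      have h₁ := ih (n + 1) (by omega)
      have h₂ := ih ((n + 3) / 2) (by omega)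
      infer_instance

/-- The factor group `H / (H ∩ K)` for a normal subgroup `K`; it is `H / K` when `K ≤ H`. -/
abbrev Factor {Γ : Type*} [Group Γ] (H K : Subgroup Γ) : Type _ := H ⧸ K.subgroupOf H

end Basilica

/-!
Every `⟨x, y⟩` with `x, y ∈ G'` lies in `G'`, and `G'' = γ₃ × γ₃`. Modulo `G''` the subgroup `γ₃`
is free abelian on `d` and `f = ⟨c, c⁻¹⟩`, with `e ≡ d⁻² f`; the generator `b` acts trivially and
`a` acts in such a way that `γ₃ / γ₄` is cyclic of order `4`. The later factors of the lower central
series are finite because commutation with `a` and `b` carries each of them onto the next.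

For the lower `2`-central series, suitable bounds from above and from below turn out to agree.
* Modulo squares, `γₙ` is generated by a single element, obtained for `n ≥ 5` from `d` or `f` by
  the operations `z ↦ ⟨z, 1⟩` and `z ↦ [z, a]`. Since `Γₙ / Γₙ₊₁` is generated by `γₙ` and, for
  even `n`, the squares of `Γ_{n/2}`, this bounds the order of every factor from above, hence also
  the index of `Γ_{2^i + 1}`.
* Let `H₀ = H₁ = γ₃` and `Hᵢ₊₁ = Hᵢ² (Hᵢ × Hᵢ)`. From `Hᵢ` one builds a normal subgroup that
  contains `Γ_{2^i + 1}` and whose index is at least the bound for the latter.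
-/

open scoped commutatorElement

namespace Basilica

section CommutatorsModulo

variable {Γ : Type*} [Group Γ]

theorem commutatorElement_mem_iff_commute (M : Subgroup Γ) [M.Normal] (g h : Γ) :
    ⁅g, h⁆ ∈ M ↔ Commute (g : Γ ⧸ M) (h : Γ ⧸ M) := by
  rw [← QuotientGroup.eq_one_iff, ← commutatorElement_eq_one_iff_commute]
  rfl

theorem comm_mem_iff_commute (M : Subgroup Γ) [M.Normal] (g h : Γ) :
    comm g h ∈ M ↔ Commute (g : Γ ⧸ M) (h : Γ ⧸ M) := by
  have hcomm : comm g h = ⁅g⁻¹, h⁻¹⁆ := by simp [comm, commutatorElement_def]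
  rw [hcomm, commutatorElement_mem_iff_commute]
  simp

theorem comm_mem_iff_commutatorElement_mem (M : Subgroup Γ) [M.Normal] (g h : Γ) :
    comm g h ∈ M ↔ ⁅g, h⁆ ∈ M := by
  rw [comm_mem_iff_commute, commutatorElement_mem_iff_commute]

theorem comm_mem_commutator (g h : Γ) : comm g h ∈ commutator Γ := by
  rw [comm_mem_iff_commutatorElement_mem, commutator_def]
  exact Subgroup.commutator_mem_commutator (Subgroup.mem_top g) (Subgroup.mem_top h)

theorem commutatorElement_mem_symm (M : Subgroup Γ) [M.Normal] {g h : Γ} (w : ⁅g, h⁆ ∈ M) :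
    ⁅h, g⁆ ∈ M := by
  rw [commutatorElement_mem_iff_commute] at w ⊢
  exact w.symm

theorem commute_mod_of_commutator_le {W M : Subgroup Γ} [M.Normal]
    (h : ⁅W, (⊤ : Subgroup Γ)⁆ ≤ M) {x : Γ} (hx : x ∈ W) (g : Γ) :
    Commute (x : Γ ⧸ M) (g : Γ ⧸ M) :=
  (commutatorElement_mem_iff_commute M x g).1
    (h (Subgroup.commutator_mem_commutator hx (Subgroup.mem_top g)))

theorem mk_inv_mul_mul_of_commutator_le {W M : Subgroup Γ} [M.Normal]
    (h : ⁅W, (⊤ : Subgroup Γ)⁆ ≤ M) {x : Γ} (hx : x ∈ W) (g : Γ) :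
    ((g⁻¹ * x * g : Γ) : Γ ⧸ M) = x := by
  rw [QuotientGroup.mk_mul, QuotientGroup.mk_mul, QuotientGroup.mk_inv, mul_assoc,
    (commute_mod_of_commutator_le h hx g).eq, inv_mul_cancel_left]

theorem comm_mem_of_mem_left {N : Subgroup Γ} [N.Normal] {x : Γ} (hx : x ∈ N) (g : Γ) :
    comm x g ∈ N :=
  (comm_mem_iff_commutatorElement_mem N x g).2
    (Subgroup.commutator_le_left N ⊤ (Subgroup.commutator_mem_commutator hx (Subgroup.mem_top g)))

theorem comm_eq_inv_mul_conj (g s : Γ) : comm g s = g⁻¹ * (s⁻¹ * g * s) := by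
  simp only [comm, mul_assoc]

theorem exists_zpow_mul_zpow_of_mem_closure_pair {u v z : Γ} (h : Commute u v)
    (hz : z ∈ Subgroup.closure {u, v}) : ∃ x y : ℤ, z = u ^ x * v ^ y := by
  let f : Multiplicative ℤ × Multiplicative ℤ →* Γ :=
    (zpowersHom Γ u).noncommCoprod (zpowersHom Γ v) fun m n => h.zpow_zpow m.toAdd n.toAdd
  have hle : Subgroup.closure {u, v} ≤ f.range := by
    rw [Subgroup.closure_le, Set.pair_subset_iff]
    constructor
    · refine ⟨(Multiplicative.ofAdd 1, 1), ?_⟩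
      change u ^ (1 : ℤ) * v ^ (0 : ℤ) = u
      simp
    · refine ⟨(1, Multiplicative.ofAdd 1), ?_⟩
      change u ^ (0 : ℤ) * v ^ (1 : ℤ) = v
      simp
  obtain ⟨⟨m, n⟩, rfl⟩ := hle hz
  exact ⟨m.toAdd, n.toAdd, rfl⟩

theorem zpow_mul_zpow_mul_sq {u v t : Γ} (huv : Commute u v) (htu : Commute t u)
    (htv : Commute t v) (ht : t ^ 2 = 1) (x y : ℤ) :
    (u ^ x * v ^ y * t) ^ 2 = (u ^ 2) ^ x * (v ^ 2) ^ y := by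
  rw [((htu.zpow_right x).mul_right (htv.zpow_right y)).symm.mul_pow, ht, mul_one,
    (huv.zpow_zpow x y).mul_pow]
  simp only [← zpow_natCast, ← zpow_mul, mul_comm]

theorem commutator_le_iff_map_eq_bot {H K M : Subgroup Γ} [M.Normal] :
    ⁅H, K⁆ ≤ M ↔ ⁅H.map (QuotientGroup.mk' M), K.map (QuotientGroup.mk' M)⁆ = ⊥ := by
  rw [← Subgroup.map_commutator, Subgroup.map_eq_bot_iff, QuotientGroup.ker_mk']

theorem commutator_closure_le {M : Subgroup Γ} [M.Normal] {s t : Set Γ}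
    (w : ∀ x ∈ s, ∀ y ∈ t, ⁅x, y⁆ ∈ M) : ⁅Subgroup.closure s, Subgroup.closure t⁆ ≤ M := by
  rw [commutator_le_iff_map_eq_bot, Subgroup.commutator_eq_bot_iff_le_centralizer,
    MonoidHom.map_closure, MonoidHom.map_closure, Subgroup.centralizer_closure,
    Subgroup.closure_le]
  rintro _ ⟨x, hx, rfl⟩
  rw [SetLike.mem_coe, Subgroup.mem_centralizer_iff]
  rintro _ ⟨y, hy, rfl⟩
  exact ((commutatorElement_mem_iff_commute M x y).1 (w x hx y hy)).symm

theorem commutator_closure_right_le {H M : Subgroup Γ} [M.Normal] {s : Set Γ}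
    (w : ∀ h ∈ H, ∀ k ∈ s, ⁅h, k⁆ ∈ M) : ⁅H, Subgroup.closure s⁆ ≤ M := by
  rw [← Subgroup.closure_eq H]
  exact commutator_closure_le w

theorem commutator_sup_right_le {H K L M : Subgroup Γ} [M.Normal] (h₁ : ⁅H, K⁆ ≤ M)
    (h₂ : ⁅H, L⁆ ≤ M) : ⁅H, K ⊔ L⁆ ≤ M := by
  rw [Subgroup.sup_eq_closure]
  apply commutator_closure_right_le
  rintro h hh k (hk | hk)
  · exact h₁ (Subgroup.commutator_mem_commutator hh hk)
  · exact h₂ (Subgroup.commutator_mem_commutator hh hk)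

theorem commutator_sup_left_le {H K L M : Subgroup Γ} [M.Normal] (h₁ : ⁅H, L⁆ ≤ M)
    (h₂ : ⁅K, L⁆ ≤ M) : ⁅H ⊔ K, L⁆ ≤ M := by
  rw [Subgroup.commutator_comm] at *
  exact commutator_sup_right_le h₁ h₂

theorem commutator_sup_mono_left {A D L P : Subgroup Γ} [A.Normal] [D.Normal] [P.Normal]
    (h : L ≤ A ⊔ D) : ⁅L, P⁆ ⊔ D ≤ ⁅A, P⁆ ⊔ D :=
  sup_le ((Subgroup.commutator_mono h le_rfl).trans (commutator_sup_left_le le_sup_left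
    ((Subgroup.commutator_le_left _ _).trans le_sup_right))) le_sup_right

theorem commutator_commutator_le_of_rotate {H K L M : Subgroup Γ} [M.Normal]
    (h₁ : ⁅⁅K, L⁆, H⁆ ≤ M) (h₂ : ⁅⁅L, H⁆, K⁆ ≤ M) : ⁅⁅H, K⁆, L⁆ ≤ M := by
  rw [commutator_le_iff_map_eq_bot, Subgroup.map_commutator] at *
  exact Subgroup.commutator_commutator_eq_bot_of_rotate h₁ h₂

end CommutatorsModulo

section Squares

variable {Γ : Type*} [Group Γ]

theorem sq_mem_squares {H : Subgroup Γ} {h : Γ} (hh : h ∈ H) : h ^ 2 ∈ squares H :=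
  Subgroup.subset_closure ⟨h, hh, rfl⟩

theorem squares_le {H M : Subgroup Γ} : squares H ≤ M ↔ ∀ h ∈ H, h ^ 2 ∈ M := by
  rw [squares, Subgroup.closure_le]
  constructor
  · exact fun w h hh => w ⟨h, hh, rfl⟩
  · rintro w _ ⟨h, hh, rfl⟩
    exact w h hh

theorem squares_mono {H K : Subgroup Γ} (h : H ≤ K) : squares H ≤ squares K :=
  squares_le.2 fun _ hx => sq_mem_squares (h hx)

theorem squares_le_self (H : Subgroup Γ) : squares H ≤ H :=
  squares_le.2 fun _ hx => pow_mem hx 2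

theorem commutatorElement_sq_left (y w : Γ) : ⁅y ^ 2, w⁆ = ⁅y, ⁅y, w⁆⁆ * ⁅y, w⁆ ^ 2 := by
  simp only [commutatorElement_def, pow_two]
  group

theorem commutatorElement_sq_right (w y : Γ) :
    ⁅w, y ^ 2⁆ = ⁅w, y⁆ ^ 2 * ⁅⁅w, y⁆⁻¹, y⁆ := by
  simp only [commutatorElement_def, pow_two]
  group

theorem commutator_squares_le {H K M : Subgroup Γ} [M.Normal]
    (w : ∀ h ∈ H, ∀ k ∈ K, ⁅h, k⁆ ^ 2 ∈ M ∧ ⁅h, ⁅h, k⁆⁆ ∈ M) : ⁅squares H, K⁆ ≤ M := by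
  rw [Subgroup.commutator_comm]
  apply commutator_closure_right_le
  rintro k hk _ ⟨h, hh, rfl⟩
  apply commutatorElement_mem_symm
  rw [commutatorElement_sq_left]
  exact mul_mem (w h hh k hk).2 (w h hh k hk).1

end Squares

section LowerCentral

variable {Γ : Type*} [Group Γ]

theorem gamma_one : gamma Γ 1 = ⊤ := rfl

theorem gamma_two : gamma Γ 2 = commutator Γ := rfl

theorem gamma_succ (n : ℕ) (hn : 1 ≤ n) : gamma Γ (n + 1) = ⁅gamma Γ n, ⊤⁆ := by
  obtain ⟨m, rfl⟩ := Nat.exists_eq_add_of_le' hn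
  rfl

theorem gamma_antitone : Antitone (gamma Γ) := fun _ _ h =>
  (⊤ : Subgroup Γ).lowerCentralSeries_antitone (Nat.sub_le_sub_right h 1)

theorem commutator_gamma_le (m n : ℕ) (hm : 1 ≤ m) (hn : 1 ≤ n) :
    ⁅gamma Γ m, gamma Γ n⁆ ≤ gamma Γ (m + n) := by
  induction n, hn using Nat.le_induction generalizing m with
  | base => rw [gamma_one, ← gamma_succ m hm]
  | succ n hn ih =>
    rw [Subgroup.commutator_comm, gamma_succ n hn]
    apply commutator_commutator_le_of_rotate
    · rw [Subgroup.commutator_comm ⊤, ← gamma_succ m hm]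
      exact (ih (m + 1) (by omega)).trans (gamma_antitone (by omega))
    · rw [← add_assoc, gamma_succ _ (by omega)]
      exact Subgroup.commutator_mono (ih m hm) le_rfl

end LowerCentral

section SqSeries

variable {Γ : Type*} [Group Γ] (N : Subgroup Γ)

/-- The series `R₁ = N`, `Rₙ₊₁ = [Γ, Rₙ] (R_⌈(n+1)/2⌉)²`, with `R₀ = N` as a dummy value: the lower
`2`-central series for `N = Γ`, and a lower bound for its shift by one for `N = Γ'`. -/
def sqSeries : ℕ → Subgroup Γ
  | 0 => N
  | 1 => N
  | n + 2 => ⁅(⊤ : Subgroup Γ), sqSeries (n + 1)⁆ ⊔ squares (sqSeries ((n + 3) / 2))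

instance sqSeries_normal [N.Normal] (n : ℕ) : (sqSeries N n).Normal := by
  induction n using Nat.strong_induction_on with
  | _ n ih =>
    match n, ih with
    | 0, _ => rw [sqSeries]; infer_instance
    | 1, _ => rw [sqSeries]; infer_instance
    | n + 2, ih =>
      rw [sqSeries]
      have h₁ := ih (n + 1) (by omega)
      have h₂ := ih ((n + 3) / 2) (by omega)
      infer_instance

theorem sqSeries_one : sqSeries N 1 = N := by rw [sqSeries]

theorem sqSeries_succ (n : ℕ) (hn : 1 ≤ n) :
    sqSeries N (n + 1) = ⁅(⊤ : Subgroup Γ), sqSeries N n⁆ ⊔ squares (sqSeries N ((n + 2) / 2)) := by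
  obtain ⟨m, rfl⟩ := Nat.exists_eq_add_of_le' hn
  rw [sqSeries]

theorem sqSeries_antitone [N.Normal] : Antitone (sqSeries N) := by
  apply antitone_nat_of_succ_le
  intro n
  induction n using Nat.strong_induction_on with
  | _ n ih =>
    rcases Nat.eq_zero_or_pos n with rfl | hn
    · rw [sqSeries, sqSeries]
    rw [sqSeries_succ N n hn]
    refine sup_le (Subgroup.commutator_le_right _ _) ?_
    rcases Nat.lt_or_ge n 2 with h | h
    · obtain rfl : n = 1 := by omega
      exact squares_le_self _
    · obtain ⟨m, rfl⟩ := Nat.exists_eq_add_of_le' hn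
      rw [sqSeries_succ N m (by omega)]
      refine le_sup_of_le_right (squares_mono ?_)
      rcases Nat.even_or_odd m with ⟨k, rfl⟩ | ⟨k, rfl⟩
      · rw [show (k + k + 1 + 2) / 2 = k + 1 by omega, show (k + k + 2) / 2 = k + 1 by omega]
      · rw [show (2 * k + 1 + 1 + 2) / 2 = k + 1 + 1 by omega,
          show (2 * k + 1 + 2) / 2 = k + 1 by omega]
        exact ih (k + 1) (by omega)

theorem commutator_sqSeries_le (n : ℕ) (hn : 1 ≤ n) :
    ⁅sqSeries N n, (⊤ : Subgroup Γ)⁆ ≤ sqSeries N (n + 1) := by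
  rw [sqSeries_succ N n hn, Subgroup.commutator_comm]
  exact le_sup_left

theorem squares_sqSeries_le (n : ℕ) (hn : 1 ≤ n) :
    squares (sqSeries N n) ≤ sqSeries N (2 * n) := by
  obtain ⟨m, rfl⟩ := Nat.exists_eq_add_of_le' hn
  have h := sqSeries_succ N (2 * m + 1) (by omega)
  rw [show (2 * m + 1 + 2) / 2 = m + 1 by omega] at h
  rw [show 2 * (m + 1) = (2 * m + 1) + 1 by ring, h]
  exact le_sup_right

theorem sq_mem_sqSeries [N.Normal] {m n : ℕ} (hn : 1 ≤ n) (h : m ≤ 2 * n) {x : Γ}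
    (hx : x ∈ sqSeries N n) :
    x ^ 2 ∈ sqSeries N m :=
  sqSeries_antitone N h (squares_sqSeries_le N n hn (sq_mem_squares hx))

theorem commutatorElement_mem_sqSeries {n : ℕ} (hn : 1 ≤ n) {x : Γ} (hx : x ∈ sqSeries N n)
    (g : Γ) : ⁅x, g⁆ ∈ sqSeries N (n + 1) :=
  commutator_sqSeries_le N n hn (Subgroup.commutator_mem_commutator hx (Subgroup.mem_top g))

theorem sqSeries_le_of {F : ℕ → Subgroup Γ} (h₁ : N ≤ F 1)
    (hc : ∀ n, 1 ≤ n → ⁅F n, (⊤ : Subgroup Γ)⁆ ≤ F (n + 1))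
    (hs : ∀ m n, 1 ≤ n → m ≤ 2 * n → squares (F n) ≤ F m) (n : ℕ) (hn : 1 ≤ n) :
    sqSeries N n ≤ F n := by
  induction n using Nat.strong_induction_on with
  | _ n ih =>
    rcases Nat.lt_or_ge n 2 with h | h
    · obtain rfl : n = 1 := by omega
      rwa [sqSeries_one]
    obtain ⟨m, rfl⟩ := Nat.exists_eq_add_of_le' hn
    rw [sqSeries_succ N m (by omega), Subgroup.commutator_comm]
    refine sup_le ?_ ?_
    · exact (Subgroup.commutator_mono (ih m (by omega) (by omega)) le_rfl).trans (hc m (by omega))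
    · exact (squares_mono (ih _ (by omega) (by omega))).trans (hs _ _ (by omega) (by omega))

theorem gamma_le_sqSeries (n : ℕ) (hn : 1 ≤ n) :
    gamma Γ (n + 1) ≤ sqSeries (commutator Γ) n := by
  induction n, hn using Nat.le_induction with
  | base => rw [sqSeries_one, gamma_two]
  | succ n hn ih =>
    rw [gamma_succ _ (by omega)]
    exact (Subgroup.commutator_mono ih le_rfl).trans (commutator_sqSeries_le _ n hn)

end SqSeries

section TwoCentral

variable {Γ : Type*} [Group Γ]

theorem twoCentral_eq_sqSeries (n : ℕ) : twoCentral Γ n = sqSeries ⊤ n := by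
  induction n using Nat.strong_induction_on with
  | _ n ih =>
    match n, ih with
    | 0, _ => rw [twoCentral, sqSeries]
    | 1, _ => rw [twoCentral, sqSeries]
    | n + 2, ih => rw [twoCentral, sqSeries, ih (n + 1) (by omega), ih ((n + 3) / 2) (by omega)]

theorem twoCentral_one : twoCentral Γ 1 = ⊤ := by rw [twoCentral]

theorem twoCentral_succ (n : ℕ) (hn : 1 ≤ n) :
    twoCentral Γ (n + 1) =
      ⁅twoCentral Γ n, (⊤ : Subgroup Γ)⁆ ⊔ squares (twoCentral Γ ((n + 2) / 2)) := by
  simp only [twoCentral_eq_sqSeries, sqSeries_succ _ n hn, Subgroup.commutator_comm]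

theorem commutator_twoCentral_top_le (n : ℕ) (hn : 1 ≤ n) :
    ⁅twoCentral Γ n, (⊤ : Subgroup Γ)⁆ ≤ twoCentral Γ (n + 1) := by
  rw [twoCentral_succ n hn]
  exact le_sup_left

theorem twoCentral_antitone : Antitone (twoCentral Γ) := fun m n h => by
  simp only [twoCentral_eq_sqSeries, sqSeries_antitone ⊤ h]

theorem sq_mem_twoCentral {m n : ℕ} (hn : 1 ≤ n) (h : m ≤ 2 * n) {x : Γ}
    (hx : x ∈ twoCentral Γ n) : x ^ 2 ∈ twoCentral Γ m := by
  rw [twoCentral_eq_sqSeries] at *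
  exact sq_mem_sqSeries ⊤ hn h hx

theorem sqSeries_commutator_le_twoCentral (n : ℕ) (hn : 1 ≤ n) :
    sqSeries (commutator Γ) n ≤ twoCentral Γ (n + 1) := by
  refine sqSeries_le_of (F := fun n => twoCentral Γ (n + 1)) _ ?_ ?_ ?_ n hn
  · simpa only [commutator_def, twoCentral_one] using commutator_twoCentral_top_le (Γ := Γ) 1 le_rfl
  · exact fun n _ => commutator_twoCentral_top_le (n + 1) (by omega)
  · exact fun m n _ _ => squares_le.2 fun x hx => sq_mem_twoCentral (by omega) (by omega) hx

theorem gamma_le_twoCentral (n : ℕ) (hn : 1 ≤ n) : gamma Γ n ≤ twoCentral Γ n := by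
  induction n, hn using Nat.le_induction with
  | base => rw [twoCentral_one]; exact le_top
  | succ n hn ih =>
    rw [gamma_succ _ (by omega)]
    exact (Subgroup.commutator_mono ih le_rfl).trans (commutator_twoCentral_top_le n hn)

theorem commutator_twoCentral_le (m n : ℕ) (hm : 1 ≤ m) (hn : 1 ≤ n) :
    ⁅twoCentral Γ m, twoCentral Γ n⁆ ≤ twoCentral Γ (m + n) := by
  induction m using Nat.strong_induction_on generalizing n with
  | _ m ih =>
    rcases Nat.lt_or_ge m 2 with h | h
    · obtain rfl : m = 1 := by omega
      rw [add_comm, twoCentral_one, Subgroup.commutator_comm]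
      exact commutator_twoCentral_top_le n hn
    obtain ⟨m, rfl⟩ := Nat.exists_eq_add_of_le' hm
    rw [twoCentral_succ m (by omega)]
    apply commutator_sup_left_le
    · apply commutator_commutator_le_of_rotate
      · rw [Subgroup.commutator_comm ⊤, Subgroup.commutator_comm, add_right_comm, add_assoc]
        exact (Subgroup.commutator_mono le_rfl (commutator_twoCentral_top_le n hn)).trans
          (ih m (by omega) (n + 1) (by omega) (by omega))
      · rw [Subgroup.commutator_comm (twoCentral Γ n), add_right_comm]
        exact (Subgroup.commutator_mono (ih m (by omega) n (by omega) hn) le_rfl).trans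
          (commutator_twoCentral_top_le (m + n) (by omega))
    · apply commutator_squares_le
      intro y hy w hw
      have hyw := ih ((m + 2) / 2) (by omega) n (by omega) hn
        (Subgroup.commutator_mem_commutator hy hw)
      exact ⟨sq_mem_twoCentral (by omega) (by omega) hyw,
        twoCentral_antitone (by omega) (ih ((m + 2) / 2) (by omega) _ (by omega) (by omega)
          (Subgroup.commutator_mem_commutator hy hyw))⟩

/-- The product `γₙ Γₙ₊₁` of terms of the two central series; it contains `[Γₖ, Γₗ]` for
`k + l = n`, so that `Γₙ` is generated by squares modulo it. -/
def mixed (Γ : Type*) [Group Γ] (n : ℕ) : Subgroup Γ := gamma Γ n ⊔ twoCentral Γ (n + 1)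

instance mixed_normal (n : ℕ) : (mixed Γ n).Normal := by
  rw [mixed]
  infer_instance

theorem mixed_one : mixed Γ 1 = ⊤ := by rw [mixed, gamma_one, top_sup_eq]

theorem mixed_le (n : ℕ) (hn : 1 ≤ n) : mixed Γ n ≤ twoCentral Γ n :=
  sup_le (gamma_le_twoCentral n hn) (twoCentral_antitone (by omega))

theorem le_mixed {m n : ℕ} (h : n + 1 ≤ m) : twoCentral Γ m ≤ mixed Γ n :=
  le_sup_of_le_right (twoCentral_antitone h)

theorem mixed_antitone {m n : ℕ} (hm : 1 ≤ m) (h : m ≤ n) : mixed Γ n ≤ mixed Γ m := by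
  rcases h.eq_or_lt with rfl | h
  · exact le_rfl
  · exact (mixed_le n (by omega)).trans (le_mixed h)

theorem commutator_mixed_le (m n : ℕ) (hm : 1 ≤ m) (hn : 1 ≤ n) :
    ⁅mixed Γ m, mixed Γ n⁆ ≤ mixed Γ (m + n) := by
  apply commutator_sup_left_le
  · apply commutator_sup_right_le
    · exact (commutator_gamma_le m n hm hn).trans le_sup_left
    · exact ((Subgroup.commutator_mono (gamma_le_twoCentral m hm) le_rfl).trans
        (commutator_twoCentral_le m (n + 1) hm (by omega))).trans (le_mixed (by omega))
  · exact ((Subgroup.commutator_mono le_rfl (mixed_le n hn)).trans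
        (commutator_twoCentral_le (m + 1) n (by omega) hn)).trans (le_mixed (by omega))

theorem commutator_squares_twoCentral_le_mixed {W : Subgroup Γ} {j k n : ℕ} (hk : 1 ≤ k)
    (hn : 1 ≤ n) (hkj : n ≤ k + j) (hkk : n + 1 ≤ 2 * k)
    (hj : ⁅mixed Γ k, twoCentral Γ j⁆ ≤ mixed Γ (k + j))
    (hW : ⁅twoCentral Γ j, W⁆ ≤ mixed Γ k) :
    ⁅squares (twoCentral Γ j), W⁆ ≤ mixed Γ n := by
  apply commutator_squares_le
  intro y hy w hw
  have hyw : ⁅y, w⁆ ∈ mixed Γ k := hW (Subgroup.commutator_mem_commutator hy hw)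
  exact ⟨le_mixed le_rfl (sq_mem_twoCentral hk hkk (mixed_le k hk hyw)),
    mixed_antitone hn hkj (commutatorElement_mem_symm _
      (hj (Subgroup.commutator_mem_commutator hyw hy)))⟩

theorem commutator_mixed_twoCentral_le (h k : ℕ) (hh : 1 ≤ h) (hk : 1 ≤ k) :
    ⁅mixed Γ k, twoCentral Γ h⁆ ≤ mixed Γ (k + h) := by
  induction h using Nat.strong_induction_on generalizing k with
  | _ h ih =>
    rcases Nat.lt_or_ge h 2 with h2 | h2
    · obtain rfl : h = 1 := by omega
      rw [twoCentral_one, ← mixed_one]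
      exact commutator_mixed_le k 1 hk le_rfl
    obtain ⟨h, rfl⟩ := Nat.exists_eq_add_of_le' hh
    rw [twoCentral_succ h (by omega)]
    have ih_half := ih ((h + 2) / 2) (by omega)
    apply commutator_sup_right_le
    · have hbracket : ⁅twoCentral Γ h, ⊤⁆ ≤ mixed Γ (1 + h) := by
        rw [Subgroup.commutator_comm, ← mixed_one]
        exact ih h (by omega) 1 (by omega) le_rfl
      rw [add_comm h]
      exact (Subgroup.commutator_mono le_rfl hbracket).trans
        (commutator_mixed_le k _ hk (by omega))
    · rw [Subgroup.commutator_comm]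
      refine commutator_squares_twoCentral_le_mixed (k := k + (h + 2) / 2) (by omega) (by omega)
        (by omega) (by omega) (ih_half _ (by omega) (by omega)) ?_
      rw [Subgroup.commutator_comm]
      exact ih_half k (by omega) hk

theorem commutator_twoCentral_top_le_mixed (n : ℕ) (hn : 1 ≤ n) :
    ⁅twoCentral Γ n, (⊤ : Subgroup Γ)⁆ ≤ mixed Γ (n + 1) := by
  rw [Subgroup.commutator_comm, ← mixed_one, add_comm]
  exact commutator_mixed_twoCentral_le n 1 hn le_rfl

theorem twoCentral_le_mixed_sup_squares (n : ℕ) (hn : 1 ≤ n) :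
    twoCentral Γ n ≤ mixed Γ n ⊔ squares (twoCentral Γ ((n + 1) / 2)) := by
  rcases Nat.lt_or_ge n 2 with h | h
  · obtain rfl : n = 1 := by omega
    rw [mixed_one, top_sup_eq]
    exact le_top
  obtain ⟨m, rfl⟩ := Nat.exists_eq_add_of_le' hn
  rw [twoCentral_succ m (by omega)]
  exact sup_le_sup_right (commutator_twoCentral_top_le_mixed m (by omega)) _

theorem commutator_twoCentral_le_mixed (m n : ℕ) (hm : 1 ≤ m) (hn : 1 ≤ n) :
    ⁅twoCentral Γ m, twoCentral Γ n⁆ ≤ mixed Γ (m + n) := by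
  induction m using Nat.strong_induction_on with
  | _ m ih =>
    rcases Nat.lt_or_ge m 2 with h | h
    · obtain rfl : m = 1 := by omega
      rw [twoCentral_one, ← mixed_one]
      exact commutator_mixed_twoCentral_le n 1 hn le_rfl
    refine (Subgroup.commutator_mono (twoCentral_le_mixed_sup_squares m hm) le_rfl).trans ?_
    apply commutator_sup_left_le
    · exact commutator_mixed_twoCentral_le n m hn hm
    · exact commutator_squares_twoCentral_le_mixed (k := (m + 1) / 2 + n) (by omega) (by omega)
        (by omega) (by omega) (commutator_mixed_twoCentral_le _ _ (by omega) (by omega))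
        (ih _ (by omega) (by omega))

end TwoCentral

section Pairs

theorem pair_mul (g h g' h' : RAut) : pair g h * pair g' h' = pair (g * g') (h * h') :=
  (pairHom.map_mul (g, h) (g', h')).symm

theorem pair_one : pair 1 1 = 1 := pairHom.map_one

theorem pair_inv (g h : RAut) : (pair g h)⁻¹ = pair g⁻¹ h⁻¹ :=
  (pairHom.map_inv (g, h)).symm

theorem act_pair_false (g h : RAut) (w : List Bool) :
    act (false :: w) (pair g h) = false :: act w g := rfl

theorem act_pair_true (g h : RAut) (w : List Bool) :
    act (true :: w) (pair g h) = true :: act w h := rfl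

theorem pair_inj {g h g' h' : RAut} : pair g h = pair g' h' ↔ g = g' ∧ h = h' := by
  refine ⟨fun w => ⟨ext_act fun v => ?_, ext_act fun v => ?_⟩, ?_⟩
  · simpa only [act_pair_false, List.cons.injEq, true_and] using congrArg (act (false :: v)) w
  · simpa only [act_pair_true, List.cons.injEq, true_and] using congrArg (act (true :: v)) w
  · rintro ⟨rfl, rfl⟩
    rfl

theorem swap_mul_swap : swap * swap = 1 :=
  ext_act (by rintro (_ | ⟨_ | _, w⟩) <;> rfl)

theorem swap_mul_pair (g h : RAut) : swap * pair g h = pair h g * swap :=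
  ext_act (by rintro (_ | ⟨_ | _, w⟩) <;> rfl)

theorem conj_a_pair (g h : RAut) : a⁻¹ * pair g h * a = pair h (b⁻¹ * g * b) := by
  rw [mul_assoc, inv_mul_eq_iff_eq_mul, a_eq, ← mul_assoc, pair_mul, mul_assoc (pair b 1),
    swap_mul_pair, ← mul_assoc, pair_mul]
  simp [mul_assoc]

end Pairs

section Generators

/-- The generator `a` as an element of `G`. -/
def G.a : G := ⟨Basilica.a, Subgroup.subset_closure (by simp)⟩

/-- The generator `b` as an element of `G`. -/
def G.b : G := ⟨Basilica.b, Subgroup.subset_closure (by simp)⟩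

/-- The commutator `c = [a, b]` as an element of `G`. -/
def G.c : G := comm G.a G.b

/-- The commutator `d = [c, a]` as an element of `G`. -/
def G.d : G := comm G.c G.a

/-- The commutator `e = [d, a]` as an element of `G`. -/
def G.e : G := comm G.d G.a

theorem coe_d : (G.d : RAut) = d := rfl

theorem coe_e : (G.e : RAut) = e := rfl

theorem closure_a_b : Subgroup.closure {G.a, G.b} = ⊤ := by
  have h : (Subgroup.closure {G.a, G.b}).map G.subtype = (⊤ : Subgroup G).map G.subtype := by
    rw [MonoidHom.map_closure, ← MonoidHom.range_eq_map, Subgroup.range_subtype,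
      Set.image_pair]
    rfl
  exact Subgroup.map_injective G.subtype_injective h

end Generators

/-- `IsPair g x y` says that `g = ⟨x, y⟩`. It is a relation and not an embedding of `G × G`, because
`⟨x, y⟩` need not lie in `G` when `x` and `y` do. -/
def IsPair (g x y : G) : Prop := (g : RAut) = pair x y

namespace IsPair

variable {g h x y x' y' : G}

theorem one : IsPair 1 1 1 := pair_one.symm

theorem mul (w : IsPair g x y) (w' : IsPair h x' y') : IsPair (g * h) (x * x') (y * y') := by
  rw [IsPair] at *
  push_cast
  rw [w, w', pair_mul]

theorem inv (w : IsPair g x y) : IsPair g⁻¹ x⁻¹ y⁻¹ := by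
  rw [IsPair] at *
  push_cast
  rw [w, pair_inv]

theorem pow (w : IsPair g x y) (n : ℕ) : IsPair (g ^ n) (x ^ n) (y ^ n) := by
  induction n with
  | zero => simpa using one
  | succ n ih => simpa only [pow_succ] using ih.mul w

theorem zpow (w : IsPair g x y) (n : ℤ) : IsPair (g ^ n) (x ^ n) (y ^ n) := by
  cases n with
  | ofNat n => simpa using w.pow n
  | negSucc n => simpa only [zpow_negSucc] using (w.pow (n + 1)).inv

theorem commutatorElement (w : IsPair g x y) (w' : IsPair h x' y') :
    IsPair ⁅g, h⁆ ⁅x, x'⁆ ⁅y, y'⁆ :=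
  ((w.mul w').mul w.inv).mul w'.inv

protected theorem comm (w : IsPair g x y) (w' : IsPair h x' y') :
    IsPair (comm g h) (comm x x') (comm y y') :=
  ((w.inv.mul w'.inv).mul w).mul w'

theorem inj (w : IsPair g x y) (w' : IsPair g x' y') : x = x' ∧ y = y' := by
  have h := pair_inj.1 (w.symm.trans w')
  exact ⟨Subtype.ext h.1, Subtype.ext h.2⟩

theorem eq (w : IsPair g x y) (w' : IsPair h x y) : g = h :=
  Subtype.ext (w.trans w'.symm)

theorem inv_a_mul_mul_a (w : IsPair g x y) : IsPair (G.a⁻¹ * g * G.a) y (G.b⁻¹ * x * G.b) := by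
  rw [IsPair] at *
  push_cast
  rw [w]
  exact conj_a_pair _ _

protected theorem b : IsPair G.b G.a 1 := b_eq

theorem a_sq : IsPair (G.a ^ 2) G.b G.b := by
  have h : (G.a : RAut) = Basilica.a := rfl
  rw [IsPair]
  push_cast
  rw [h, pow_two, a_eq, mul_assoc, ← mul_assoc swap, swap_mul_pair, mul_assoc, swap_mul_swap,
    mul_one, pair_mul]
  simp [G.b]

theorem inv_b_mul_mul_b (w : IsPair g x y) : IsPair (G.b⁻¹ * g * G.b) (G.a⁻¹ * x * G.a) y := by
  simpa using (IsPair.b.inv.mul w).mul IsPair.b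

theorem b_mul_mul_inv_b (w : IsPair g x y) : IsPair (G.b * g * G.b⁻¹) (G.a * x * G.a⁻¹) y := by
  simpa using (IsPair.b.mul w).mul IsPair.b.inv

theorem a_mul_mul_inv_a (w : IsPair g x y) : IsPair (G.a * g * G.a⁻¹) (G.b * y * G.b⁻¹) x := by
  have h := ((a_sq.mul w).mul a_sq.inv).inv_a_mul_mul_a
  rw [show G.a⁻¹ * (G.a ^ 2 * g * (G.a ^ 2)⁻¹) * G.a = G.a * g * G.a⁻¹ by group,
    show G.b⁻¹ * (G.b * x * G.b⁻¹) * G.b = x by group] at h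
  exact h

theorem not_isPair_a : ¬ IsPair G.a x y := by
  intro w
  have h := congrArg (act [false]) w
  rw [act_pair_false] at h
  exact absurd (List.cons.inj h).1 (by simp)

protected theorem c : IsPair G.c G.a (G.a * G.c)⁻¹ := by
  have h := (IsPair.b.inv.inv_a_mul_mul_a).mul IsPair.b
  rw [show G.a⁻¹ * G.b⁻¹ * G.a * G.b = G.c from rfl] at h
  convert h using 1
  · simp
  · simp [G.c, Basilica.comm, mul_assoc]

protected theorem d : IsPair G.d (G.a⁻¹ * (G.a * G.c)⁻¹) ((G.a * G.c) * (G.a * G.c)) := by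
  have h := IsPair.c.inv.mul IsPair.c.inv_a_mul_mul_a
  rw [show G.c⁻¹ * (G.a⁻¹ * G.c * G.a) = G.d by simp [G.d, Basilica.comm, mul_assoc]] at h
  convert h using 1
  simp [G.c, Basilica.comm, mul_assoc]

theorem c_sq_mul_d : IsPair (G.c * G.c * G.d) (G.a * G.c⁻¹ * G.a⁻¹) 1 := by
  have h := (IsPair.c.mul IsPair.c).mul IsPair.d
  convert h using 1 <;> group

theorem comm_a (w : IsPair g x y) :
    IsPair (Basilica.comm g G.a) (x⁻¹ * y) (y⁻¹ * (G.b⁻¹ * x * G.b)) := by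
  rw [comm_eq_inv_mul_conj]
  exact w.inv.mul w.inv_a_mul_mul_a

theorem comm_b (w : IsPair g x y) : IsPair (Basilica.comm g G.b) (Basilica.comm x G.a) 1 := by
  simpa [Basilica.comm] using w.comm IsPair.b

end IsPair

section NormalSubgroups

theorem commute_c_b : Commute G.c G.b := by
  have hcb := IsPair.c.mul IsPair.b
  have hbc := IsPair.b.mul IsPair.c
  simp only [mul_one, one_mul] at hcb hbc
  exact hcb.eq hbc

theorem normal_of_conj {N : Subgroup G} (ha : ∀ x ∈ N, G.a⁻¹ * x * G.a ∈ N)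
    (ha' : ∀ x ∈ N, G.a * x * G.a⁻¹ ∈ N) (hb : ∀ x ∈ N, G.b⁻¹ * x * G.b ∈ N)
    (hb' : ∀ x ∈ N, G.b * x * G.b⁻¹ ∈ N) : N.Normal := by
  rw [← Subgroup.normalizer_eq_top_iff, eq_top_iff, ← closure_a_b, Subgroup.closure_le]
  rintro _ (rfl | rfl)
  · refine Subgroup.mem_normalizer_iff.2 fun h => ⟨ha' h, fun w => ?_⟩
    simpa [mul_assoc] using ha _ w
  · refine Subgroup.mem_normalizer_iff.2 fun h => ⟨hb' h, fun w => ?_⟩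
    simpa [mul_assoc] using hb _ w

theorem commutator_top_le {X M : Subgroup G} [M.Normal] (ha : ∀ g ∈ X, ⁅g, G.a⁆ ∈ M)
    (hb : ∀ g ∈ X, ⁅g, G.b⁆ ∈ M) : ⁅X, (⊤ : Subgroup G)⁆ ≤ M := by
  rw [← closure_a_b]
  apply commutator_closure_right_le
  rintro h hh _ (rfl | rfl)
  · exact ha h hh
  · exact hb h hh

theorem commutator_le_of_c_mem {M : Subgroup G} [M.Normal] (hc : G.c ∈ M) : commutator G ≤ M := by
  have hab : ⁅G.a, G.b⁆ ∈ M := (comm_mem_iff_commutatorElement_mem M _ _).1 hc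
  rw [commutator_def, ← closure_a_b]
  apply commutator_closure_le
  rintro _ (rfl | rfl) _ (rfl | rfl)
  · simp
  · exact hab
  · exact commutatorElement_mem_symm M hab
  · simp

theorem c_mem_commutator : G.c ∈ commutator G := comm_mem_commutator G.a G.b

theorem commutatorElement_c_mem_of_d_mem {M : Subgroup G} [M.Normal] (hd : G.d ∈ M) (g : G) :
    ⁅G.c, g⁆ ∈ M := by
  have h : ⁅Subgroup.zpowers G.c, (⊤ : Subgroup G)⁆ ≤ M := by
    rw [Subgroup.zpowers_eq_closure, ← closure_a_b]
    apply commutator_closure_le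
    rintro _ rfl _ (rfl | rfl)
    · exact (comm_mem_iff_commutatorElement_mem M _ _).1 hd
    · rw [commute_c_b.commutator_eq]
      exact one_mem M
  exact h (Subgroup.commutator_mem_commutator (Subgroup.mem_zpowers G.c) (Subgroup.mem_top g))

theorem gamma_three_le {M : Subgroup G} [M.Normal] (hd : G.d ∈ M) : gamma G 3 ≤ M := by
  have hcentral : commutator G ≤ (Subgroup.center (G ⧸ M)).comap (QuotientGroup.mk' M) := by
    apply commutator_le_of_c_mem
    rw [Subgroup.mem_comap, Subgroup.mem_center_iff]
    intro q
    obtain ⟨g, rfl⟩ := QuotientGroup.mk_surjective q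
    exact ((commutatorElement_mem_iff_commute M _ _).1
      (commutatorElement_c_mem_of_d_mem hd g)).symm
  rw [gamma_succ 2 (by norm_num), gamma_two, Subgroup.commutator_le]
  intro x hx y _
  rw [commutatorElement_mem_iff_commute]
  exact (Subgroup.mem_center_iff.1 (hcentral hx) y).symm

end NormalSubgroups

attribute [irreducible] G.a G.b G.c G.d G.e

section LeftFactor

/-- The elements `x` with `⟨x, 1⟩ ∈ N`. -/
def leftFactor (N : Subgroup G) : Subgroup G where
  carrier := {x | ∃ g ∈ N, IsPair g x 1}
  one_mem' := ⟨1, one_mem N, IsPair.one⟩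
  mul_mem' := by
    rintro x y ⟨g, hg, w⟩ ⟨h, hh, w'⟩
    exact ⟨g * h, mul_mem hg hh, by simpa using w.mul w'⟩
  inv_mem' := by
    rintro x ⟨g, hg, w⟩
    exact ⟨g⁻¹, inv_mem hg, by simpa using w.inv⟩

theorem leftFactor_mono {N M : Subgroup G} (h : N ≤ M) : leftFactor N ≤ leftFactor M :=
  fun _ ⟨g, hg, w⟩ => ⟨g, h hg, w⟩

theorem mem_of_mem_leftFactor {N : Subgroup G} {g x : G} (w : IsPair g x 1)
    (h : x ∈ leftFactor N) : g ∈ N := by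
  obtain ⟨g', hg', w'⟩ := h
  rwa [w.eq w']

instance leftFactor_normal (N : Subgroup G) [hN : N.Normal] : (leftFactor N).Normal := by
  apply normal_of_conj
  · rintro x ⟨g, hg, w⟩
    exact ⟨G.b⁻¹ * g * G.b, by simpa using hN.conj_mem g hg G.b⁻¹, w.inv_b_mul_mul_b⟩
  · rintro x ⟨g, hg, w⟩
    exact ⟨G.b * g * G.b⁻¹, hN.conj_mem g hg G.b, w.b_mul_mul_inv_b⟩
  · rintro x ⟨g, hg, w⟩
    refine ⟨(G.a ^ 2)⁻¹ * g * G.a ^ 2, by simpa using hN.conj_mem g hg (G.a ^ 2)⁻¹, ?_⟩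
    simpa using (IsPair.a_sq.inv.mul w).mul IsPair.a_sq
  · rintro x ⟨g, hg, w⟩
    refine ⟨G.a ^ 2 * g * (G.a ^ 2)⁻¹, hN.conj_mem g hg _, ?_⟩
    simpa using (IsPair.a_sq.mul w).mul IsPair.a_sq.inv

theorem commutator_le_leftFactor : commutator G ≤ leftFactor (commutator G) := by
  apply commutator_le_of_c_mem
  refine ⟨comm G.b (G.a ^ 2), comm_mem_commutator _ _, ?_⟩
  have h := IsPair.b.comm IsPair.a_sq
  rwa [show comm (1 : G) G.b = 1 by simp [comm], show comm G.a G.b = G.c by rw [G.c]] at h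

theorem exists_isPair_one_right {N : Subgroup G} [hN : N.Normal] {x : G}
    (hx : x ∈ leftFactor N) : ∃ g ∈ N, IsPair g 1 x := by
  obtain ⟨g, hg, w⟩ := (leftFactor_normal N).conj_mem x hx G.b
  refine ⟨G.a⁻¹ * g * G.a, by simpa using hN.conj_mem g hg G.a⁻¹, ?_⟩
  simpa [mul_assoc] using w.inv_a_mul_mul_a

theorem exists_isPair_of_mem_leftFactor {N : Subgroup G} [N.Normal] {x y : G}
    (hx : x ∈ leftFactor N) (hy : y ∈ leftFactor N) : ∃ g ∈ N, IsPair g x y := by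
  obtain ⟨g, hg, w⟩ := hx
  obtain ⟨h, hh, w'⟩ := exists_isPair_one_right hy
  exact ⟨g * h, mul_mem hg hh, by simpa using w.mul w'⟩

theorem exists_isPair {x y : G} (hx : x ∈ commutator G) (hy : y ∈ commutator G) :
    ∃ g ∈ commutator G, IsPair g x y :=
  exists_isPair_of_mem_leftFactor (commutator_le_leftFactor hx) (commutator_le_leftFactor hy)

end LeftFactor

section ProdSelf

/-- The subgroup `G ∩ (H × H)` of the elements `⟨x, y⟩` of `G` with `x, y ∈ H`. -/
def prodSelf (H : Subgroup G) : Subgroup G where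
  carrier := {g | ∃ x ∈ H, ∃ y ∈ H, IsPair g x y}
  one_mem' := ⟨1, one_mem H, 1, one_mem H, IsPair.one⟩
  mul_mem' := by
    rintro _ _ ⟨x, hx, y, hy, w⟩ ⟨x', hx', y', hy', w'⟩
    exact ⟨_, mul_mem hx hx', _, mul_mem hy hy', w.mul w'⟩
  inv_mem' := by
    rintro _ ⟨x, hx, y, hy, w⟩
    exact ⟨_, inv_mem hx, _, inv_mem hy, w.inv⟩

theorem mem_prodSelf_iff {H : Subgroup G} {g x y : G} (w : IsPair g x y) :
    g ∈ prodSelf H ↔ x ∈ H ∧ y ∈ H := by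
  constructor
  · rintro ⟨x', hx, y', hy, w'⟩
    obtain ⟨rfl, rfl⟩ := w.inj w'
    exact ⟨hx, hy⟩
  · rintro ⟨hx, hy⟩
    exact ⟨x, hx, y, hy, w⟩

theorem prodSelf_mono {H K : Subgroup G} (h : H ≤ K) : prodSelf H ≤ prodSelf K :=
  fun _ ⟨x, hx, y, hy, w⟩ => ⟨x, h hx, y, h hy, w⟩

instance prodSelf_normal (H : Subgroup G) [hH : H.Normal] : (prodSelf H).Normal := by
  apply normal_of_conj
  · rintro _ ⟨x, hx, y, hy, w⟩
    exact ⟨_, hy, _, hH.conj_mem' x hx _, w.inv_a_mul_mul_a⟩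
  · rintro _ ⟨x, hx, y, hy, w⟩
    exact ⟨_, hH.conj_mem y hy _, _, hx, w.a_mul_mul_inv_a⟩
  · rintro _ ⟨x, hx, y, hy, w⟩
    exact ⟨_, hH.conj_mem' x hx _, _, hy, w.inv_b_mul_mul_b⟩
  · rintro _ ⟨x, hx, y, hy, w⟩
    exact ⟨_, hH.conj_mem x hx _, _, hy, w.b_mul_mul_inv_b⟩

theorem prodSelf_le {H N : Subgroup G} [N.Normal] (h : H ≤ leftFactor N) : prodSelf H ≤ N := by
  rintro g ⟨x, hx, y, hy, w⟩
  obtain ⟨g', hg', w'⟩ := exists_isPair_of_mem_leftFactor (h hx) (h hy)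
  rwa [w.eq w']

end ProdSelf

section Abelianization

/-- The abelianization of `G`. -/
abbrev Ab : Type := G ⧸ commutator G

instance : CommGroup Ab := inferInstanceAs (CommGroup (Abelianization G))

theorem ab_eq_one_iff {g : G} : (g : Ab) = 1 ↔ g ∈ commutator G := QuotientGroup.eq_one_iff g

theorem ab_c : (G.c : Ab) = 1 := ab_eq_one_iff.2 c_mem_commutator

theorem ab_mul_mul_inv (x y : G) : ((x * y * x⁻¹ : G) : Ab) = y := by
  simp

theorem ab_inv_mul_mul (x y : G) : ((x⁻¹ * y * x : G) : Ab) = y := by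
  simp

theorem exists_ab_eq (g : G) : ∃ m n : ℤ, (g : Ab) = (G.a : Ab) ^ m * (G.b : Ab) ^ n := by
  have hg : g ∈ Subgroup.closure {G.a, G.b} := by rw [closure_a_b]; exact Subgroup.mem_top g
  have hab := Subgroup.mem_map_of_mem (QuotientGroup.mk' (commutator G)) hg
  rw [MonoidHom.map_closure, Set.image_pair, Subgroup.mem_closure_pair] at hab
  obtain ⟨m, n, h⟩ := hab
  exact ⟨m, n, h.symm⟩

/-- The elements `⟨p, q⟩` of `G` with `p ≡ a ^ k` and `q ≡ a ^ (-k)` modulo `G'` for some `k`. -/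
def antidiagonalPairs : Subgroup G where
  carrier := {g | ∃ (k : ℤ) (p q : G), IsPair g p q ∧ (p : Ab) = (G.a : Ab) ^ k ∧
    (q : Ab) = (G.a : Ab) ^ (-k)}
  one_mem' := ⟨0, 1, 1, IsPair.one, by simp, by simp⟩
  mul_mem' := by
    rintro _ _ ⟨k, p, q, w, hp, hq⟩ ⟨k', p', q', w', hp', hq'⟩
    refine ⟨k + k', _, _, w.mul w', ?_, ?_⟩
    · rw [QuotientGroup.mk_mul, hp, hp', zpow_add]
    · rw [QuotientGroup.mk_mul, hq, hq', neg_add, zpow_add]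
  inv_mem' := by
    rintro _ ⟨k, p, q, w, hp, hq⟩
    refine ⟨-k, _, _, w.inv, ?_, ?_⟩
    · rw [QuotientGroup.mk_inv, hp, zpow_neg]
    · rw [QuotientGroup.mk_inv, hq, zpow_neg (G.a : Ab) (-k)]

instance antidiagonalPairs_normal : antidiagonalPairs.Normal := by
  apply normal_of_conj
  · rintro _ ⟨k, p, q, w, hp, hq⟩
    exact ⟨-k, _, _, w.inv_a_mul_mul_a, hq, by rw [ab_inv_mul_mul, hp, neg_neg]⟩
  · rintro _ ⟨k, p, q, w, hp, hq⟩
    exact ⟨-k, _, _, w.a_mul_mul_inv_a, by rw [ab_mul_mul_inv, hq], by rw [hp, neg_neg]⟩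
  · rintro _ ⟨k, p, q, w, hp, hq⟩
    exact ⟨k, _, _, w.inv_b_mul_mul_b, by rw [ab_inv_mul_mul, hp], hq⟩
  · rintro _ ⟨k, p, q, w, hp, hq⟩
    exact ⟨k, _, _, w.b_mul_mul_inv_b, by rw [ab_mul_mul_inv, hp], hq⟩

theorem commutator_le_antidiagonalPairs : commutator G ≤ antidiagonalPairs := by
  apply commutator_le_of_c_mem
  refine ⟨1, _, _, IsPair.c, by simp, ?_⟩
  rw [QuotientGroup.mk_inv, QuotientGroup.mk_mul, ab_c, mul_one, zpow_neg_one]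

theorem eq_zero_of_forall_two_pow_dvd {m : ℤ} (h : ∀ t : ℕ, (2 : ℤ) ^ t ∣ m) : m = 0 := by
  refine Int.eq_zero_of_dvd_of_natAbs_lt_natAbs (h m.natAbs) ?_
  rw [Int.natAbs_pow]
  exact Nat.lt_two_pow_self

theorem even_of_isPair_a_zpow_mul {m n : ℤ} {x y : G} (w : IsPair (G.a ^ m * G.b ^ n) x y) :
    Even m := by
  rcases Int.even_or_odd' m with ⟨m', rfl | rfl⟩
  · exact even_two_mul m'
  have ha : G.a ^ (2 * m' + 1) * G.b ^ n * G.b ^ (-n) * (G.a ^ 2) ^ (-m') = G.a := by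
    rw [← zpow_natCast, ← zpow_mul]
    push_cast
    group
  have w' := (w.mul (IsPair.b.zpow (-n))).mul (IsPair.a_sq.zpow (-m'))
  rw [ha] at w'
  exact absurd w' IsPair.not_isPair_a

theorem ab_descent {m n : ℤ} (h : (G.a : Ab) ^ m * (G.b : Ab) ^ n = 1) :
    ∃ k m' : ℤ, m = 2 * m' ∧ (G.a : Ab) ^ (n - k) * (G.b : Ab) ^ m' = 1 ∧
      (G.a : Ab) ^ k * (G.b : Ab) ^ m' = 1 := by
  have hg : G.a ^ m * G.b ^ n ∈ commutator G := ab_eq_one_iff.1 (by simpa using h)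
  obtain ⟨k, p, q, w, hp, hq⟩ := commutator_le_antidiagonalPairs hg
  obtain ⟨m', rfl⟩ := (even_of_isPair_a_zpow_mul w).two_dvd
  refine ⟨k, m', rfl, ?_⟩
  have w' := (IsPair.a_sq.zpow m').mul (IsPair.b.zpow n)
  rw [← zpow_natCast, ← zpow_mul] at w'
  obtain ⟨rfl, rfl⟩ := w.inj w'
  simp only [QuotientGroup.mk_mul, QuotientGroup.mk_zpow, one_zpow, mul_one, zpow_neg] at hp hq
  constructor
  · rw [zpow_sub, ← hp, hq, ← hp]
    group
  · rw [hq, mul_inv_cancel]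

theorem two_pow_dvd_of_ab_eq_one (t : ℕ) {m n : ℤ} (h : (G.a : Ab) ^ m * (G.b : Ab) ^ n = 1) :
    (2 : ℤ) ^ t ∣ m ∧ (2 : ℤ) ^ t ∣ n := by
  induction t generalizing m n with
  | zero => simp
  | succ t ih =>
    have hleft {m n : ℤ} (h : (G.a : Ab) ^ m * (G.b : Ab) ^ n = 1) : (2 : ℤ) ^ (t + 1) ∣ m := by
      obtain ⟨k, m', rfl, -, h'⟩ := ab_descent h
      rw [pow_succ']
      exact mul_dvd_mul_left 2 (ih h').2
    obtain ⟨k, m', -, hx, hy⟩ := ab_descent h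
    refine ⟨hleft h, ?_⟩
    simpa using dvd_add (hleft hx) (hleft hy)

theorem eq_zero_of_ab_eq_one {m n : ℤ} (h : (G.a : Ab) ^ m * (G.b : Ab) ^ n = 1) :
    m = 0 ∧ n = 0 :=
  ⟨eq_zero_of_forall_two_pow_dvd fun t => (two_pow_dvd_of_ab_eq_one t h).1,
    eq_zero_of_forall_two_pow_dvd fun t => (two_pow_dvd_of_ab_eq_one t h).2⟩

end Abelianization

section SecondDerived

/-- The largest quotient `G / γ₃` of `G` of nilpotency class at most `2`. -/
abbrev Nil2 : Type := G ⧸ gamma G 3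

theorem commute_mod_gamma_three {x : G} (hx : x ∈ commutator G) (g : G) :
    Commute (x : Nil2) (g : Nil2) := by
  rw [← commutatorElement_mem_iff_commute, gamma_succ 2 (by norm_num)]
  exact Subgroup.commutator_mem_commutator hx (Subgroup.mem_top g)

theorem exists_eq_a_zpow_mul {p : G} {k : ℤ} (hp : (p : Ab) = (G.a : Ab) ^ k) :
    ∃ x ∈ commutator G, p = G.a ^ k * x := by
  rw [eq_comm, ← QuotientGroup.mk_zpow, QuotientGroup.eq] at hp
  exact ⟨_, hp, (mul_inv_cancel_left _ _).symm⟩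

theorem commutatorElement_mem_gamma_three {p q : G} {k l : ℤ} (hp : (p : Ab) = (G.a : Ab) ^ k)
    (hq : (q : Ab) = (G.a : Ab) ^ l) : ⁅p, q⁆ ∈ gamma G 3 := by
  obtain ⟨x, hx, rfl⟩ := exists_eq_a_zpow_mul hp
  obtain ⟨y, hy, rfl⟩ := exists_eq_a_zpow_mul hq
  rw [commutatorElement_mem_iff_commute]
  push_cast [QuotientGroup.mk_mul]
  refine Commute.mul_left (Commute.mul_right ?_ ?_) (commute_mod_gamma_three hx _)
  · simp only [QuotientGroup.mk_zpow]
    exact Commute.zpow_zpow_self (G.a : Nil2) k l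
  · exact (commute_mod_gamma_three hy _).symm

theorem d_mem_gamma_three : G.d ∈ gamma G 3 := by
  rw [G.d, comm_mem_iff_commutatorElement_mem, gamma_succ 2 (by norm_num)]
  exact Subgroup.commutator_mem_commutator c_mem_commutator (Subgroup.mem_top G.a)

theorem gamma_three_le_commutator : gamma G 3 ≤ commutator G := by
  rw [← gamma_two]
  exact gamma_antitone (by norm_num)

theorem commutator_commutator_eq_prodSelf :
    ⁅commutator G, commutator G⁆ = prodSelf (gamma G 3) := by
  apply le_antisymm
  · rw [Subgroup.commutator_le]
    intro x hx y hy
    obtain ⟨k, p, q, w, hp, hq⟩ := commutator_le_antidiagonalPairs hx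
    obtain ⟨k', p', q', w', hp', hq'⟩ := commutator_le_antidiagonalPairs hy
    exact ⟨_, commutatorElement_mem_gamma_three hp hp', _,
      commutatorElement_mem_gamma_three hq hq', w.commutatorElement w'⟩
  · apply prodSelf_le
    apply gamma_three_le
    obtain ⟨u, hu, w⟩ := commutator_le_leftFactor c_mem_commutator
    refine ⟨comm u G.c, ?_, ?_⟩
    · rw [comm_mem_iff_commutatorElement_mem]
      exact Subgroup.commutator_mem_commutator hu c_mem_commutator
    · simpa [comm, G.d] using w.comm IsPair.c

end SecondDerived

section MetabelianQuotient

/-- The largest metabelian quotient `G / G''` of `G`, with `G''` written as `γ₃ × γ₃`. -/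
abbrev Metab : Type := G ⧸ prodSelf (gamma G 3)

theorem commute_mod_prodSelf {x y : G} (hx : x ∈ commutator G) (hy : y ∈ commutator G) :
    Commute (x : Metab) (y : Metab) := by
  rw [← commutatorElement_mem_iff_commute, ← commutator_commutator_eq_prodSelf]
  exact Subgroup.commutator_mem_commutator hx hy

theorem commute_b_mod_prodSelf {x : G} (hx : x ∈ commutator G) :
    Commute (x : Metab) (G.b : Metab) := by
  rw [← commutatorElement_mem_iff_commute]
  obtain ⟨k, p, q, w, hp, -⟩ := commutator_le_antidiagonalPairs hx
  have ha : (G.a : Ab) = (G.a : Ab) ^ (1 : ℤ) := (zpow_one _).symm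
  refine ⟨_, commutatorElement_mem_gamma_three hp ha, 1, one_mem _, ?_⟩
  simpa using w.commutatorElement IsPair.b

/-- The element `⟨c, 1⟩`. -/
def G.cLeft : G := (G.b⁻¹ * (G.c * G.c * G.d) * G.b)⁻¹

/-- The element `⟨1, c⟩`. -/
def G.cRight : G := G.a⁻¹ * G.cLeft * G.a

/-- The element `⟨c, c⁻¹⟩`. -/
def G.f : G := G.cLeft * G.cRight⁻¹

attribute [irreducible] G.cLeft G.cRight G.f

theorem inv_b_mul_c_mul_b : G.b⁻¹ * G.c * G.b = G.c := by
  rw [mul_assoc, commute_c_b.eq, inv_mul_cancel_left]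

protected theorem IsPair.cLeft : IsPair G.cLeft G.c 1 := by
  have h := IsPair.c_sq_mul_d.inv_b_mul_mul_b.inv
  rw [show (G.a⁻¹ * (G.a * G.c⁻¹ * G.a⁻¹) * G.a)⁻¹ = G.c by group, inv_one] at h
  rwa [G.cLeft]

protected theorem IsPair.cRight : IsPair G.cRight 1 G.c := by
  have h := IsPair.cLeft.inv_a_mul_mul_a
  rw [inv_b_mul_c_mul_b] at h
  rwa [G.cRight]

protected theorem IsPair.f : IsPair G.f G.c G.c⁻¹ := by
  have h := IsPair.cLeft.mul IsPair.cRight.inv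
  rw [inv_one, mul_one, one_mul] at h
  rwa [G.f]

theorem d_mem_commutator : G.d ∈ commutator G := gamma_three_le_commutator d_mem_gamma_three

theorem e_mem_gamma_four : G.e ∈ gamma G 4 := by
  rw [G.e, comm_mem_iff_commutatorElement_mem, gamma_succ 3 (by norm_num)]
  exact Subgroup.commutator_mem_commutator d_mem_gamma_three (Subgroup.mem_top _)

theorem cLeft_mem_commutator : G.cLeft ∈ commutator G :=
  mem_of_mem_leftFactor IsPair.cLeft (commutator_le_leftFactor c_mem_commutator)

theorem cRight_mem_commutator : G.cRight ∈ commutator G := by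
  have h := (inferInstance : (commutator G).Normal).conj_mem _ cLeft_mem_commutator G.a⁻¹
  rw [inv_inv] at h
  rwa [G.cRight]

theorem f_mem_commutator : G.f ∈ commutator G := by
  rw [G.f]
  exact mul_mem cLeft_mem_commutator (inv_mem cRight_mem_commutator)

theorem inv_a_mul_f_mul_a : G.a⁻¹ * G.f * G.a = G.f⁻¹ := by
  have h := IsPair.f.inv_a_mul_mul_a
  rw [inv_b_mul_c_mul_b] at h
  exact h.eq (by simpa using IsPair.f.inv)

theorem inv_a_mul_c_mul_a : G.a⁻¹ * G.c * G.a = G.c * G.d := by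
  simp [G.d, comm, mul_assoc]

theorem inv_a_mul_d_mul_a : G.a⁻¹ * G.d * G.a = G.d * G.e := by
  simp [G.e, comm, mul_assoc]

theorem mk_cLeft : (G.cLeft : Metab) = ((G.c * G.c * G.d : G) : Metab)⁻¹ := by
  have hmem : G.c * G.c * G.d ∈ commutator G :=
    mul_mem (mul_mem c_mem_commutator c_mem_commutator) d_mem_commutator
  have h := (commute_b_mod_prodSelf hmem).eq
  rw [G.cLeft]
  simp only [QuotientGroup.mk_inv, QuotientGroup.mk_mul] at h ⊢
  rw [mul_assoc (G.b : Metab)⁻¹, h, inv_mul_cancel_left]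

theorem mk_cRight :
    (G.cRight : Metab) = ((G.c * G.d * (G.c * G.d) * (G.d * G.e) : G) : Metab)⁻¹ := by
  rw [G.cRight, ← inv_a_mul_c_mul_a, ← inv_a_mul_d_mul_a]
  simp only [QuotientGroup.mk_inv, QuotientGroup.mk_mul, mk_cLeft]
  group

theorem mk_f : (G.f : Metab) = (G.d : Metab) * (G.d : Metab) * (G.e : Metab) := by
  have hcd := (commute_mod_prodSelf c_mem_commutator d_mem_commutator).eq
  rw [G.f, QuotientGroup.mk_mul, QuotientGroup.mk_inv, mk_cLeft, mk_cRight, inv_inv,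
    inv_mul_eq_iff_eq_mul]
  simp only [QuotientGroup.mk_mul, mul_assoc]
  congr 1
  rw [← mul_assoc (G.d : Metab) (G.c : Metab), ← hcd, mul_assoc]

theorem commute_d_f : Commute (G.d : Metab) (G.f : Metab) :=
  commute_mod_prodSelf d_mem_commutator f_mem_commutator

theorem mk_e : (G.e : Metab) = (G.d : Metab) ^ (-2 : ℤ) * (G.f : Metab) := by
  rw [mk_f]
  group

end MetabelianQuotient

/-- `Coord g x y` says that `g` is `d ^ x f ^ y` modulo the second derived subgroup. -/
def Coord (g : G) (x y : ℤ) : Prop := (g : Metab) = (G.d : Metab) ^ x * (G.f : Metab) ^ y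

namespace Coord

variable {g h : G} {x y x' y' : ℤ}

theorem of_mem (hg : g ∈ prodSelf (gamma G 3)) : Coord g 0 0 := by
  simpa [Coord] using hg

theorem mem_prodSelf (w : Coord g 0 0) : g ∈ prodSelf (gamma G 3) :=
  (QuotientGroup.eq_one_iff g).1 (by simpa [Coord] using w)

theorem mul (w : Coord g x y) (w' : Coord h x' y') : Coord (g * h) (x + x') (y + y') := by
  rw [Coord] at *
  rw [QuotientGroup.mk_mul, w, w', zpow_add, zpow_add,
    (commute_d_f.zpow_zpow x' y).symm.mul_mul_mul_comm]

theorem inv (w : Coord g x y) : Coord g⁻¹ (-x) (-y) := by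
  rw [Coord] at *
  rw [QuotientGroup.mk_inv, w, mul_inv_rev, zpow_neg, zpow_neg,
    ((commute_d_f.zpow_zpow x y).inv_inv).eq]

protected theorem d : Coord G.d 1 0 := by simp [Coord]

protected theorem f : Coord G.f 0 1 := by simp [Coord]

theorem zpow (w : Coord g x y) (n : ℤ) : Coord (g ^ n) (n * x) (n * y) := by
  rw [Coord] at *
  rw [QuotientGroup.mk_zpow, w, (commute_d_f.zpow_zpow x y).mul_zpow, ← zpow_mul, ← zpow_mul,
    mul_comm x, mul_comm y]

theorem zpow_mul_zpow (x y : ℤ) : Coord (G.d ^ x * G.f ^ y) x y := by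
  simpa using (Coord.d.zpow x).mul (Coord.f.zpow y)

theorem exists_eq_mul (w : Coord g x y) :
    ∃ t ∈ prodSelf (gamma G 3), g = G.d ^ x * G.f ^ y * t := by
  refine ⟨(G.d ^ x * G.f ^ y)⁻¹ * g, ?_, by group⟩
  rw [← QuotientGroup.eq]
  exact (zpow_mul_zpow x y).trans w.symm

protected theorem e : Coord G.e (-2) 1 := by
  rw [Coord, mk_e, zpow_one]

theorem of_conj (s : G) (hd : Coord (s⁻¹ * G.d * s) x y) (hf : Coord (s⁻¹ * G.f * s) x' y')
    {m n : ℤ} (w : Coord g m n) : Coord (s⁻¹ * g * s) (m * x + n * x') (m * y + n * y') := by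
  obtain ⟨t, ht, rfl⟩ := w.exists_eq_mul
  have hts : Coord (s⁻¹ * t * s) 0 0 :=
    of_mem (by simpa using (prodSelf_normal (gamma G 3)).conj_mem t ht s⁻¹)
  have hprod := ((hd.zpow m).mul (hf.zpow n)).mul hts
  rw [add_zero, add_zero] at hprod
  have conj_zpow_eq (z : G) (k : ℤ) : (s⁻¹ * z * s) ^ k = s⁻¹ * z ^ k * s := by
    simpa using conj_zpow (a := s⁻¹) (b := z) (i := k)
  rw [conj_zpow_eq, conj_zpow_eq] at hprod
  convert hprod using 1
  group

theorem inv_a_mul_mul_a (w : Coord g x y) : Coord (G.a⁻¹ * g * G.a) (-x) (x - y) := by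
  have hd : Coord (G.a⁻¹ * G.d * G.a) (-1) 1 := by
    rw [inv_a_mul_d_mul_a]
    simpa using Coord.d.mul Coord.e
  have hf : Coord (G.a⁻¹ * G.f * G.a) 0 (-1) := by
    rw [inv_a_mul_f_mul_a]
    simpa using Coord.f.inv
  convert of_conj G.a hd hf w using 1 <;> ring

theorem a_mul_mul_inv_a (w : Coord g x y) : Coord (G.a * g * G.a⁻¹) (-x) (-x - y) := by
  have hpre : Coord (G.d ^ (-x) * G.f ^ (-x - y)) (-x) (-x - y) := zpow_mul_zpow _ _
  obtain ⟨t, ht, hg⟩ : ∃ t ∈ prodSelf (gamma G 3),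
      g = G.a⁻¹ * (G.d ^ (-x) * G.f ^ (-x - y)) * G.a * t := by
    refine ⟨(G.a⁻¹ * (G.d ^ (-x) * G.f ^ (-x - y)) * G.a)⁻¹ * g, ?_, by group⟩
    rw [← QuotientGroup.eq, w]
    simpa [Coord] using hpre.inv_a_mul_mul_a
  have h := hpre.mul (of_mem ((prodSelf_normal (gamma G 3)).conj_mem t ht G.a))
  rw [add_zero, add_zero] at h
  rw [hg]
  convert h using 1
  group

theorem mem_commutator (w : Coord g x y) : g ∈ commutator G := by
  obtain ⟨t, ht, rfl⟩ := w.exists_eq_mul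
  refine mul_mem (mul_mem (zpow_mem d_mem_commutator _) (zpow_mem f_mem_commutator _)) ?_
  rw [← commutator_commutator_eq_prodSelf] at ht
  exact Subgroup.commutator_le_left _ _ ht

theorem of_commute {s : G} (w : Coord g x y) (h : Commute (g : Metab) (s : Metab)) :
    Coord (s⁻¹ * g * s) x y := by
  rw [Coord] at *
  rw [QuotientGroup.mk_mul, QuotientGroup.mk_mul, QuotientGroup.mk_inv, mul_assoc, h.eq,
    inv_mul_cancel_left, w]

theorem inv_b_mul_mul_b (w : Coord g x y) : Coord (G.b⁻¹ * g * G.b) x y :=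
  w.of_commute (commute_b_mod_prodSelf w.mem_commutator)

theorem b_mul_mul_inv_b (w : Coord g x y) : Coord (G.b * g * G.b⁻¹) x y := by
  simpa using w.of_commute (s := G.b⁻¹) (by
    simpa using (commute_b_mod_prodSelf w.mem_commutator).inv_right)

theorem comm_a (w : Coord g x y) : Coord (comm g G.a) (-(2 * x)) (x - 2 * y) := by
  rw [comm_eq_inv_mul_conj]
  convert w.inv.mul w.inv_a_mul_mul_a using 1 <;> ring

theorem comm_a_sq (w : Coord g x y) : Coord (comm g (G.a ^ 2)) 0 (-(2 * x)) := by
  rw [comm_eq_inv_mul_conj]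
  convert w.inv.mul w.inv_a_mul_mul_a.inv_a_mul_mul_a using 1
  · simp [pow_two, mul_assoc]
  · ring
  · ring

theorem comm_of_commute {s : G} (w : Coord g x y) (h : Commute (g : Metab) (s : Metab)) :
    Coord (comm g s) 0 0 := by
  rw [comm_eq_inv_mul_conj]
  simpa using w.inv.mul (w.of_commute h)

theorem comm_b (w : Coord g x y) : Coord (comm g G.b) 0 0 :=
  w.comm_of_commute (commute_b_mod_prodSelf w.mem_commutator)

end Coord

/-- The preimage `⟨d, f⟩ G''` of the subgroup of `G / G''` generated by `d` and `f`. -/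
def coordSubgroup : Subgroup G where
  carrier := {g | ∃ x y, Coord g x y}
  one_mem' := ⟨0, 0, Coord.of_mem (one_mem _)⟩
  mul_mem' := by
    rintro _ _ ⟨x, y, w⟩ ⟨x', y', w'⟩
    exact ⟨_, _, w.mul w'⟩
  inv_mem' := by
    rintro _ ⟨x, y, w⟩
    exact ⟨_, _, w.inv⟩

instance coordSubgroup_normal : coordSubgroup.Normal := by
  apply normal_of_conj
  · rintro _ ⟨x, y, w⟩
    exact ⟨_, _, w.inv_a_mul_mul_a⟩
  · rintro _ ⟨x, y, w⟩
    exact ⟨_, _, w.a_mul_mul_inv_a⟩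
  · rintro _ ⟨x, y, w⟩
    exact ⟨_, _, w.inv_b_mul_mul_b⟩
  · rintro _ ⟨x, y, w⟩
    exact ⟨_, _, w.b_mul_mul_inv_b⟩

theorem exists_coord {g : G} (hg : g ∈ gamma G 3) : ∃ x y, Coord g x y :=
  gamma_three_le (M := coordSubgroup) ⟨1, 0, Coord.d⟩ hg

section CoordUnique

theorem prodSelf_gamma_three_le : prodSelf (gamma G 3) ≤ gamma G 3 := by
  rw [← commutator_commutator_eq_prodSelf, gamma_succ 2 (by norm_num), gamma_two]
  exact Subgroup.commutator_mono le_rfl le_top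

theorem prodSelf_gamma_three_le_gamma_four : prodSelf (gamma G 3) ≤ gamma G 4 := by
  rw [← commutator_commutator_eq_prodSelf, ← gamma_two]
  exact commutator_gamma_le 2 2 (by norm_num) (by norm_num)

theorem f_mem_gamma_three : G.f ∈ gamma G 3 := by
  have hdde : G.d * G.d * G.e ∈ gamma G 3 :=
    mul_mem (mul_mem d_mem_gamma_three d_mem_gamma_three)
      (gamma_antitone (by norm_num) e_mem_gamma_four)
  have hmk : ((G.d * G.d * G.e : G) : Metab) = (G.f : Metab) := mk_f.symm
  simpa only [mul_inv_cancel_left] using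
    mul_mem hdde (prodSelf_gamma_three_le (QuotientGroup.eq.1 hmk))

theorem IsPair.d_zpow_mul_f_zpow (x y : ℤ) :
    IsPair (G.d ^ x * G.f ^ y) ((G.a⁻¹ * (G.a * G.c)⁻¹) ^ x * G.c ^ y)
      (((G.a * G.c) * (G.a * G.c)) ^ x * G.c⁻¹ ^ y) :=
  (IsPair.d.zpow x).mul (IsPair.f.zpow y)

theorem mk_left_d_zpow_mul_f_zpow (x y : ℤ) :
    (((G.a⁻¹ * (G.a * G.c)⁻¹) ^ x * G.c ^ y : G) : Nil2) =
      (G.a : Nil2) ^ (-2 * x) * (G.c : Nil2) ^ (y - x) := by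
  have hca := commute_mod_gamma_three c_mem_commutator G.a
  have hbase : (G.a : Nil2)⁻¹ * ((G.a : Nil2) * G.c)⁻¹ =
      (G.a : Nil2) ^ (-2 : ℤ) * (G.c : Nil2)⁻¹ := by
    rw [mul_inv_rev, hca.inv_inv.eq]
    group
  simp only [QuotientGroup.mk_mul, QuotientGroup.mk_zpow, QuotientGroup.mk_inv]
  rw [hbase, (hca.symm.zpow_left _).inv_right.mul_zpow, ← zpow_mul, inv_zpow', mul_assoc,
    ← zpow_add, neg_add_eq_sub]

theorem mk_right_d_zpow_mul_f_zpow (x y : ℤ) :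
    ((((G.a * G.c) * (G.a * G.c)) ^ x * G.c⁻¹ ^ y : G) : Nil2) =
      (G.a : Nil2) ^ (2 * x) * (G.c : Nil2) ^ (2 * x - y) := by
  have hca := commute_mod_gamma_three c_mem_commutator G.a
  simp only [QuotientGroup.mk_mul, QuotientGroup.mk_zpow, QuotientGroup.mk_inv]
  rw [← pow_two, hca.symm.mul_pow, (hca.symm.pow_pow _ _).mul_zpow, inv_zpow', mul_assoc,
    ← zpow_natCast, ← zpow_natCast, ← zpow_mul, ← zpow_mul, ← zpow_add]
  rfl

theorem eq_zero_of_ab_a_zpow_eq_one {m : ℤ} (h : (G.a : Ab) ^ m = 1) : m = 0 :=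
  (eq_zero_of_ab_eq_one (m := m) (n := 0) (by simpa using h)).1

theorem a_exponent_eq {m n k : ℤ} {g : G} (h : (g : Nil2) = (G.a : Nil2) ^ m * (G.c : Nil2) ^ n)
    (hg : (g : Ab) = (G.a : Ab) ^ k) : k = m := by
  replace h : (g : Nil2) = ((G.a ^ m * G.c ^ n : G) : Nil2) := h
  have hab : (g : Ab) = ((G.a ^ m * G.c ^ n : G) : Ab) :=
    QuotientGroup.eq.2 (gamma_three_le_commutator (QuotientGroup.eq.1 h))
  rw [QuotientGroup.mk_mul, QuotientGroup.mk_zpow, QuotientGroup.mk_zpow, ab_c, one_zpow,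
    mul_one, hg, ← mul_inv_eq_one, ← zpow_neg, ← zpow_add] at hab
  exact add_neg_eq_zero.1 (eq_zero_of_ab_a_zpow_eq_one hab)

theorem exists_c_zpow_mem_gamma_three {k : ℤ} (h : G.c ^ k ∈ gamma G 3) :
    ∃ x : ℤ, k = -2 * x ∧ G.c ^ x ∈ gamma G 3 := by
  obtain ⟨x, y, w⟩ := exists_coord h
  obtain ⟨t, ⟨p, hp, q, hq, wt⟩, ht⟩ := w.exists_eq_mul
  have wprod := (IsPair.d_zpow_mul_f_zpow x y).mul wt
  rw [← ht] at wprod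
  obtain ⟨hleft, hright⟩ := (IsPair.c.zpow k).inj wprod
  have hca := commute_mod_gamma_three c_mem_commutator G.a
  replace hleft : ((G.a ^ k : G) : Nil2) = (G.a : Nil2) ^ (-2 * x) * (G.c : Nil2) ^ (y - x) := by
    rw [hleft, QuotientGroup.mk_mul, (QuotientGroup.eq_one_iff p).2 hp, mul_one,
      mk_left_d_zpow_mul_f_zpow]
  replace hright : (((G.a * G.c)⁻¹ ^ k : G) : Nil2) =
      (G.a : Nil2) ^ (2 * x) * (G.c : Nil2) ^ (2 * x - y) := by
    rw [hright, QuotientGroup.mk_mul, (QuotientGroup.eq_one_iff q).2 hq, mul_one,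
      mk_right_d_zpow_mul_f_zpow]
  obtain rfl : k = -2 * x := a_exponent_eq hleft (by rw [QuotientGroup.mk_zpow])
  simp only [QuotientGroup.mk_mul, QuotientGroup.mk_zpow, QuotientGroup.mk_inv] at hleft hright
  rw [left_eq_mul] at hleft
  rw [inv_zpow', hca.symm.mul_zpow, show -(-2 * x) = 2 * x by ring, mul_left_cancel_iff,
    zpow_sub, left_eq_mul, inv_eq_one] at hright
  rw [zpow_sub, hright, one_mul, inv_eq_one] at hleft
  exact ⟨x, rfl, (QuotientGroup.eq_one_iff _).1 hleft⟩

theorem eq_zero_of_c_zpow_mem_gamma_three {k : ℤ} (h : G.c ^ k ∈ gamma G 3) : k = 0 := by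
  refine eq_zero_of_forall_two_pow_dvd fun t => ?_
  induction t generalizing k with
  | zero => simp
  | succ t ih =>
    obtain ⟨x, rfl, hx⟩ := exists_c_zpow_mem_gamma_three h
    rw [neg_mul, dvd_neg, pow_succ']
    exact mul_dvd_mul_left 2 (ih hx)

theorem Coord.eq_zero_of_one {x y : ℤ} (h : Coord 1 x y) : x = 0 ∧ y = 0 := by
  have hprod : G.d ^ x * G.f ^ y ∈ prodSelf (gamma G 3) :=
    (QuotientGroup.eq_one_iff _).1 (Eq.symm h)
  have hleft := mk_left_d_zpow_mul_f_zpow x y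
  rw [(QuotientGroup.eq_one_iff _).2 ((mem_prodSelf_iff (IsPair.d_zpow_mul_f_zpow x y)).1 hprod).1]
    at hleft
  have hx : (0 : ℤ) = -2 * x :=
    a_exponent_eq (g := 1) (n := y - x) (by rwa [QuotientGroup.mk_one]) (by simp)
  obtain rfl : x = 0 := by omega
  refine ⟨rfl, eq_zero_of_c_zpow_mem_gamma_three ?_⟩
  rw [← QuotientGroup.eq_one_iff, hleft]
  simp

theorem Coord.unique {g : G} {x y x' y' : ℤ} (w : Coord g x y) (w' : Coord g x' y') :
    x = x' ∧ y = y' := by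
  have h := w.mul w'.inv
  rw [mul_inv_cancel] at h
  obtain ⟨hx, hy⟩ := h.eq_zero_of_one
  exact ⟨add_neg_eq_zero.1 hx, add_neg_eq_zero.1 hy⟩

end CoordUnique

/-- The series `H₀ = H₁ = γ₃`, `Hᵢ₊₁ = Hᵢ² (Hᵢ × Hᵢ)`. It makes the term of index `2 ^ i + 1` of
the lower `2`-central series explicit: `Hᵢ` is the intersection of that term with `γ₃`. -/
def dyadicCore : ℕ → Subgroup G
  | 0 => gamma G 3
  | 1 => gamma G 3
  | n + 2 => squares (dyadicCore (n + 1)) ⊔ prodSelf (dyadicCore (n + 1))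

theorem dyadicCore_zero : dyadicCore 0 = gamma G 3 := by rw [dyadicCore]

theorem dyadicCore_one : dyadicCore 1 = gamma G 3 := by rw [dyadicCore]

theorem dyadicCore_add_two (n : ℕ) :
    dyadicCore (n + 2) = squares (dyadicCore (n + 1)) ⊔ prodSelf (dyadicCore (n + 1)) := by
  rw [dyadicCore]

instance dyadicCore_normal (n : ℕ) : (dyadicCore n).Normal := by
  induction n using Nat.strong_induction_on with
  | _ n ih =>
    match n, ih with
    | 0, _ => rw [dyadicCore_zero]; infer_instance
    | 1, _ => rw [dyadicCore_one]; infer_instance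
    | n + 2, ih =>
      rw [dyadicCore_add_two]
      have h := ih (n + 1) (by omega)
      infer_instance

theorem dyadicCore_succ_le (n : ℕ) : dyadicCore (n + 1) ≤ dyadicCore n := by
  induction n with
  | zero => rw [dyadicCore_zero, dyadicCore_one]
  | succ n ih =>
    rw [dyadicCore_add_two]
    refine sup_le (squares_le_self _) ((prodSelf_mono ih).trans ?_)
    cases n with
    | zero => rw [dyadicCore_zero, dyadicCore_one]; exact prodSelf_gamma_three_le
    | succ n => rw [dyadicCore_add_two]; exact le_sup_right

theorem dyadicCore_antitone : Antitone dyadicCore := antitone_nat_of_succ_le dyadicCore_succ_le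

theorem dyadicCore_le_gamma_three (n : ℕ) : dyadicCore n ≤ gamma G 3 :=
  dyadicCore_zero ▸ dyadicCore_antitone n.zero_le

theorem prodSelf_dyadicCore_le (n : ℕ) : prodSelf (dyadicCore n) ≤ dyadicCore (n + 1) := by
  cases n with
  | zero => rw [dyadicCore_zero, dyadicCore_one]; exact prodSelf_gamma_three_le
  | succ n => rw [dyadicCore_add_two]; exact le_sup_right

theorem sq_mem_dyadicCore {n : ℕ} {x : G} (hx : x ∈ dyadicCore n) : x ^ 2 ∈ dyadicCore (n + 1) := by
  cases n with
  | zero =>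
    rw [dyadicCore_one, ← dyadicCore_zero]
    exact pow_mem hx 2
  | succ n =>
    rw [dyadicCore_add_two]
    exact Subgroup.mem_sup_left (sq_mem_squares hx)

theorem pow_mem_dyadicCore {x : G} (hx : x ∈ gamma G 3) (n : ℕ) :
    x ^ 2 ^ n ∈ dyadicCore (n + 1) := by
  induction n with
  | zero => rwa [dyadicCore_one, pow_zero, pow_one]
  | succ n ih =>
    rw [pow_succ, pow_mul]
    exact sq_mem_dyadicCore ih

/-- The subgroup of `G` fixing the two vertices of the first level of the tree. -/
def levelStabilizer : Subgroup G := Subgroup.closure {G.a ^ 2, G.b} ⊔ commutator G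

instance levelStabilizer_normal : levelStabilizer.Normal :=
  Subgroup.Normal.of_commutator_le _ le_sup_right

theorem a_sq_mem_levelStabilizer : G.a ^ 2 ∈ levelStabilizer :=
  Subgroup.mem_sup_left (Subgroup.subset_closure (by simp))

theorem mem_levelStabilizer_of_mem_commutator {x : G} (hx : x ∈ commutator G) :
    x ∈ levelStabilizer :=
  Subgroup.mem_sup_right hx

theorem commutator_levelStabilizer_le {X M : Subgroup G} [M.Normal]
    (ha : ∀ g ∈ X, ⁅g, G.a ^ 2⁆ ∈ M) (hb : ∀ g ∈ X, ⁅g, G.b⁆ ∈ M)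
    (hcomm : ∀ g ∈ X, ∀ x ∈ commutator G, ⁅g, x⁆ ∈ M) :
    ⁅X, levelStabilizer⁆ ≤ M := by
  apply commutator_sup_right_le
  · apply commutator_closure_right_le
    rintro h hh _ (rfl | rfl)
    · exact ha h hh
    · exact hb h hh
  · rw [Subgroup.commutator_le]
    exact hcomm

section Layer

variable (P : Subgroup G)

/-- The subgroups between `Hᵢ` and `Hᵢ₊₁` obtained from `Hᵢ` by repeated commutation with `P`; they
measure how far a commutator lies below `Hᵢ`. -/
def layer (i : ℕ) : ℕ → Subgroup G
  | 0 => dyadicCore i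
  | j + 1 => ⁅layer i j, P⁆ ⊔ dyadicCore (i + 1)

theorem layer_zero (i : ℕ) : layer P i 0 = dyadicCore i := rfl

theorem layer_succ (i j : ℕ) : layer P i (j + 1) = ⁅layer P i j, P⁆ ⊔ dyadicCore (i + 1) := rfl

theorem dyadicCore_le_layer (i j : ℕ) : dyadicCore (i + 1) ≤ layer P i j := by
  cases j with
  | zero => exact dyadicCore_succ_le i
  | succ j => exact le_sup_right

variable [P.Normal]

instance layer_normal (i j : ℕ) : (layer P i j).Normal := by
  induction j with
  | zero => rw [layer_zero]; infer_instance
  | succ j ih => rw [layer_succ]; infer_instance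

theorem layer_antitone (i : ℕ) : Antitone (layer P i) := by
  apply antitone_nat_of_succ_le
  intro j
  rw [layer_succ]
  exact sup_le (Subgroup.commutator_le_left _ _) (dyadicCore_le_layer P i j)

theorem layer_le (i j : ℕ) : layer P i j ≤ dyadicCore i := layer_antitone P i j.zero_le

variable {P}

theorem sq_mem_of_mem_layer {i j : ℕ} {w : G} (hw : w ∈ layer P i j) : w ^ 2 ∈ dyadicCore (i + 1) :=
  sq_mem_dyadicCore (layer_le P i j hw)

variable (P) in
/-- Commutation with `y` moves every layer of level `i` down by at least `t` steps. -/
def Raises (i : ℕ) (y : G) (t : ℕ) : Prop :=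
  ∀ j, ∀ w ∈ layer P i j, ⁅w, y⁆ ∈ layer P i (j + t)

theorem Raises.sq {i t : ℕ} {y : G} (h : Raises P i y t) : Raises P i (y ^ 2) (t * 2) := by
  intro j w hw
  have hwy := h j w hw
  rw [commutatorElement_sq_right]
  refine mul_mem (dyadicCore_le_layer P _ _ (sq_mem_of_mem_layer hwy)) ?_
  rw [mul_two, ← add_assoc]
  exact h _ _ (inv_mem hwy)

theorem raises_pow (i : ℕ) {y : G} (hy : y ∈ P) (s : ℕ) : Raises P i (y ^ 2 ^ s) (2 ^ s) := by
  induction s with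
  | zero =>
    intro j w hw
    rw [pow_zero, pow_one]
    exact Subgroup.mem_sup_left (Subgroup.commutator_mem_commutator hw hy)
  | succ s ih =>
    rw [pow_succ, pow_mul]
    exact ih.sq

theorem commutatorElement_sq_sq_mem {i s t : ℕ} {x y : G} (hx : Raises P i x s)
    (hy : Raises P i y t) (hl : layer P i (s + t) ≤ dyadicCore (i + 1))
    (hxy : ⁅x, y⁆ ∈ dyadicCore i) :
    ⁅x ^ 2, y ^ 2⁆ ∈ dyadicCore (i + 1) := by
  have hsq : ⁅x ^ 2, y⁆ ∈ layer P i s := by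
    rw [commutatorElement_sq_left]
    refine mul_mem (commutatorElement_mem_symm _ ?_)
      (dyadicCore_le_layer P _ _ (sq_mem_dyadicCore hxy))
    simpa using hx 0 _ hxy
  rw [commutatorElement_sq_right]
  exact mul_mem (sq_mem_of_mem_layer hsq) (hl (hy _ _ (inv_mem hsq)))

end Layer

section DoubleCommutator

variable {W W₁ : Subgroup G} [W₁.Normal]

theorem commutator_prodSelf_levelStabilizer_le (h : ⁅W, (⊤ : Subgroup G)⁆ ≤ W₁) :
    ⁅prodSelf W, levelStabilizer⁆ ≤ prodSelf W₁ := by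
  have mem_of_isPair : ∀ g ∈ prodSelf W, ∀ s p q : G, IsPair s p q → ⁅g, s⁆ ∈ prodSelf W₁ := by
    rintro g ⟨x, hx, y, hy, w⟩ s p q ws
    exact ⟨_, h (Subgroup.commutator_mem_commutator hx (Subgroup.mem_top _)), _,
      h (Subgroup.commutator_mem_commutator hy (Subgroup.mem_top _)), w.commutatorElement ws⟩
  apply commutator_levelStabilizer_le
  · exact fun g hg => mem_of_isPair g hg _ _ _ IsPair.a_sq
  · exact fun g hg => mem_of_isPair g hg _ _ _ IsPair.b
  · intro g hg x hx
    obtain ⟨k, p, q, w, -⟩ := commutator_le_antidiagonalPairs hx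
    exact mem_of_isPair g hg _ _ _ w

variable (W W₁) in
/-- The elements `⟨x, y⟩` of `W × W` with `x` and `y` congruent modulo `W₁`. -/
def diagonalPairs : Subgroup G where
  carrier := {g | ∃ x ∈ W, ∃ y ∈ W, IsPair g x y ∧ (x : G ⧸ W₁) = y}
  one_mem' := ⟨1, one_mem _, 1, one_mem _, IsPair.one, rfl⟩
  mul_mem' := by
    rintro _ _ ⟨x, hx, y, hy, w, hxy⟩ ⟨x', hx', y', hy', w', hxy'⟩
    refine ⟨_, mul_mem hx hx', _, mul_mem hy hy', w.mul w', ?_⟩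
    rw [QuotientGroup.mk_mul, QuotientGroup.mk_mul, hxy, hxy']
  inv_mem' := by
    rintro _ ⟨x, hx, y, hy, w, hxy⟩
    refine ⟨_, inv_mem hx, _, inv_mem hy, w.inv, ?_⟩
    rw [QuotientGroup.mk_inv, QuotientGroup.mk_inv, hxy]

theorem diagonalPairs_normal [hW : W.Normal] (h : ⁅W, (⊤ : Subgroup G)⁆ ≤ W₁) :
    (diagonalPairs W W₁).Normal := by
  have conj_mem (x : G) (hx : x ∈ W) (g : G) : g⁻¹ * x * g ∈ W := by
    simpa using hW.conj_mem x hx g⁻¹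
  have mk_conj (x : G) (hx : x ∈ W) (g : G) : ((g * x * g⁻¹ : G) : G ⧸ W₁) = x := by
    simpa using mk_inv_mul_mul_of_commutator_le h hx g⁻¹
  apply normal_of_conj
  · rintro _ ⟨x, hx, y, hy, w, hxy⟩
    exact ⟨_, hy, _, conj_mem x hx _, w.inv_a_mul_mul_a,
      by rw [mk_inv_mul_mul_of_commutator_le h hx, hxy]⟩
  · rintro _ ⟨x, hx, y, hy, w, hxy⟩
    exact ⟨_, hW.conj_mem y hy _, _, hx, w.a_mul_mul_inv_a, by rw [mk_conj y hy, hxy]⟩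
  · rintro _ ⟨x, hx, y, hy, w, hxy⟩
    exact ⟨_, conj_mem x hx _, _, hy, w.inv_b_mul_mul_b,
      by rw [mk_inv_mul_mul_of_commutator_le h hx, hxy]⟩
  · rintro _ ⟨x, hx, y, hy, w, hxy⟩
    exact ⟨_, hW.conj_mem x hx _, _, hy, w.b_mul_mul_inv_b, by rw [mk_conj x hx, hxy]⟩

theorem commutator_prodSelf_top_le_diagonalPairs [hW : W.Normal]
    (h : ⁅W, (⊤ : Subgroup G)⁆ ≤ W₁) (hsq : squares W ≤ W₁) :
    ⁅prodSelf W, (⊤ : Subgroup G)⁆ ≤ diagonalPairs W W₁ := by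
  have mk_inv_eq (x : G) (hx : x ∈ W) : (x : G ⧸ W₁)⁻¹ = x := by
    have hx2 := (QuotientGroup.eq_one_iff (x ^ 2)).2 (hsq (sq_mem_squares hx))
    rw [pow_two] at hx2
    exact inv_eq_of_mul_eq_one_left hx2
  have := diagonalPairs_normal h
  apply commutator_top_le
  · rintro g ⟨x, hx, y, hy, w⟩
    rw [← comm_mem_iff_commutatorElement_mem]
    refine ⟨_, mul_mem (inv_mem hx) hy, _, mul_mem (inv_mem hy) ?_, w.comm_a, ?_⟩
    · simpa using hW.conj_mem x hx G.b⁻¹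
    · rw [QuotientGroup.mk_mul, QuotientGroup.mk_mul, mk_inv_mul_mul_of_commutator_le h hx,
        QuotientGroup.mk_inv, QuotientGroup.mk_inv, mk_inv_eq x hx, mk_inv_eq y hy,
        (commute_mod_of_commutator_le h hx y).eq]
  · rintro g ⟨x, hx, y, -, w⟩
    rw [← comm_mem_iff_commutatorElement_mem]
    refine ⟨_, comm_mem_of_mem_left hx G.a, _, one_mem _, w.comm_b, ?_⟩
    rw [QuotientGroup.mk_one, QuotientGroup.eq_one_iff, comm_mem_iff_commutatorElement_mem]
    exact h (Subgroup.commutator_mem_commutator hx (Subgroup.mem_top _))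

theorem commutator_diagonalPairs_top_le (h : ⁅W, (⊤ : Subgroup G)⁆ ≤ W₁) :
    ⁅diagonalPairs W W₁, (⊤ : Subgroup G)⁆ ≤ prodSelf W₁ := by
  apply commutator_top_le
  · rintro g ⟨x, hx, y, -, w, hxy⟩
    rw [← comm_mem_iff_commutatorElement_mem]
    refine ⟨_, QuotientGroup.eq.1 hxy, _, QuotientGroup.eq.1 ?_, w.comm_a⟩
    rw [mk_inv_mul_mul_of_commutator_le h hx, hxy]
  · rintro g ⟨x, hx, y, -, w, -⟩
    rw [← comm_mem_iff_commutatorElement_mem]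
    refine ⟨_, (comm_mem_iff_commutatorElement_mem W₁ _ _).2 ?_, _, one_mem _, w.comm_b⟩
    exact h (Subgroup.commutator_mem_commutator hx (Subgroup.mem_top _))

theorem commutator_commutator_prodSelf_le [W.Normal] (h : ⁅W, (⊤ : Subgroup G)⁆ ≤ W₁)
    (hsq : squares W ≤ W₁) :
    ⁅⁅prodSelf W, (⊤ : Subgroup G)⁆, (⊤ : Subgroup G)⁆ ≤ prodSelf W₁ :=
  (Subgroup.commutator_mono (commutator_prodSelf_top_le_diagonalPairs h hsq) le_rfl).trans
    (commutator_diagonalPairs_top_le h)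

end DoubleCommutator

/-- Every element of `Hᵢ₊₁` is, modulo `Hᵢ × Hᵢ`, a product of powers of `d ^ 2 ^ i` and
`f ^ 2 ^ i`. -/
def HasNormalForm (i : ℕ) : Prop :=
  ∀ g ∈ dyadicCore (i + 1), ∃ x y : ℤ, ∃ t ∈ prodSelf (dyadicCore i),
    g = (G.d ^ 2 ^ i) ^ x * (G.f ^ 2 ^ i) ^ y * t

theorem Coord.normalForm {i : ℕ} (x y : ℤ) {t : G} (ht : t ∈ prodSelf (dyadicCore i)) :
    Coord ((G.d ^ 2 ^ i) ^ x * (G.f ^ 2 ^ i) ^ y * t) (2 ^ i * x) (2 ^ i * y) := by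
  have h := (Coord.zpow_mul_zpow (2 ^ i * x) (2 ^ i * y)).mul
    (Coord.of_mem (prodSelf_mono (dyadicCore_le_gamma_three i) ht))
  rw [add_zero, add_zero, zpow_mul, zpow_mul] at h
  exact_mod_cast h

namespace HasNormalForm

variable {i : ℕ}

theorem coord (hform : HasNormalForm i) {g : G} (hg : g ∈ dyadicCore (i + 1)) :
    ∃ x y : ℤ, Coord g (2 ^ i * x) (2 ^ i * y) := by
  obtain ⟨x, y, t, ht, rfl⟩ := hform g hg
  exact ⟨x, y, Coord.normalForm x y ht⟩

theorem mem_sup (hform : HasNormalForm i) {g : G} (hg : g ∈ dyadicCore (i + 1)) {x y : ℤ}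
    (w : Coord g (2 ^ (i + 1) * x) (2 ^ (i + 1) * y)) :
    g ∈ prodSelf (dyadicCore i) ⊔ dyadicCore (i + 2) := by
  have zpow_mem_of_eq (z : G) (hz : z ∈ gamma G 3) (m n : ℤ)
      (h : (2 : ℤ) ^ i * m = 2 ^ (i + 1) * n) : (z ^ 2 ^ i) ^ m ∈ dyadicCore (i + 2) := by
    obtain rfl : m = 2 * n := by
      rw [pow_succ, mul_assoc] at h
      exact mul_left_cancel₀ (by positivity) h
    rw [zpow_mul]
    exact zpow_mem (by exact_mod_cast sq_mem_dyadicCore (pow_mem_dyadicCore hz i)) n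
  obtain ⟨x', y', t, ht, rfl⟩ := hform g hg
  obtain ⟨hx, hy⟩ := (Coord.normalForm x' y' ht).unique w
  exact mul_mem (Subgroup.mem_sup_right (mul_mem
    (zpow_mem_of_eq _ d_mem_gamma_three _ _ hx) (zpow_mem_of_eq _ f_mem_gamma_three _ _ hy)))
    (Subgroup.mem_sup_left ht)

theorem commutator_levelStabilizer_le (hform : HasNormalForm i) :
    ⁅dyadicCore (i + 1), levelStabilizer⁆ ≤ prodSelf (dyadicCore i) ⊔ dyadicCore (i + 2) := by
  apply Basilica.commutator_levelStabilizer_le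
  · intro g hg
    obtain ⟨x, y, w⟩ := hform.coord hg
    rw [← comm_mem_iff_commutatorElement_mem]
    refine hform.mem_sup (comm_mem_of_mem_left hg _) (x := 0) (y := -x) ?_
    convert w.comm_a_sq using 1 <;> ring
  · intro g hg
    obtain ⟨x, y, w⟩ := hform.coord hg
    rw [← comm_mem_iff_commutatorElement_mem]
    exact hform.mem_sup (comm_mem_of_mem_left hg _) (x := 0) (y := 0) (by simpa using w.comm_b)
  · intro g hg s hs
    obtain ⟨x, y, w⟩ := hform.coord hg
    rw [← comm_mem_iff_commutatorElement_mem]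
    refine hform.mem_sup (comm_mem_of_mem_left hg _) (x := 0) (y := 0) ?_
    simpa using w.comm_of_commute (commute_mod_prodSelf w.mem_commutator hs)

end HasNormalForm

/-- The elements of `Hᵢ₊₁` whose `d`-coordinate is divisible by `2 ^ (i + 1)`, which is one factor
`2` more than in the whole of `Hᵢ₊₁`. -/
def evenCoords (i : ℕ) : Subgroup G where
  carrier := {g | g ∈ dyadicCore (i + 1) ∧ ∃ x y : ℤ, Coord g (2 ^ (i + 1) * x) y}
  one_mem' := ⟨one_mem _, 0, 0, by simpa using Coord.of_mem (one_mem _)⟩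
  mul_mem' := by
    rintro _ _ ⟨h, x, y, w⟩ ⟨h', x', y', w'⟩
    exact ⟨mul_mem h h', x + x', y + y', by rw [mul_add]; exact w.mul w'⟩
  inv_mem' := by
    rintro _ ⟨h, x, y, w⟩
    exact ⟨inv_mem h, -x, -y, by rw [mul_neg]; exact w.inv⟩

instance evenCoords_normal (i : ℕ) : (evenCoords i).Normal := by
  have hnormal := dyadicCore_normal (i + 1)
  have inv_conj_mem (g : G) (hg : g ∈ dyadicCore (i + 1)) (s : G) :
      s⁻¹ * g * s ∈ dyadicCore (i + 1) := by
    simpa using hnormal.conj_mem g hg s⁻¹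
  apply normal_of_conj
  · rintro g ⟨hg, x, y, w⟩
    exact ⟨inv_conj_mem g hg _, -x, _, by rw [mul_neg]; exact w.inv_a_mul_mul_a⟩
  · rintro g ⟨hg, x, y, w⟩
    exact ⟨hnormal.conj_mem g hg _, -x, _, by rw [mul_neg]; exact w.a_mul_mul_inv_a⟩
  · rintro g ⟨hg, x, y, w⟩
    exact ⟨inv_conj_mem g hg _, x, _, w.inv_b_mul_mul_b⟩
  · rintro g ⟨hg, x, y, w⟩
    exact ⟨hnormal.conj_mem g hg _, x, _, w.b_mul_mul_inv_b⟩

/-- `[Hᵢ, G, …, G] ≤ Hᵢ₊₁` with `2 ^ (i + 1) - 2` factors `G`. -/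
def TopLayersShort (i : ℕ) : Prop := ∀ j, 2 ^ (i + 1) ≤ j + 2 → layer ⊤ i j ≤ dyadicCore (i + 1)

/-- `[Hᵢ, S, …, S] ≤ Hᵢ₊₁` with `2 ^ i` factors equal to the level stabilizer `S`. -/
def StabilizerLayersShort (i : ℕ) : Prop := layer levelStabilizer i (2 ^ i) ≤ dyadicCore (i + 1)

/-- If two elements of the level stabilizer commute modulo `γ₃`, then their powers with exponent
`2 ^ i` commute modulo `Hᵢ₊₁`. -/
def PowersCommute (i : ℕ) : Prop :=
  ∀ x ∈ levelStabilizer, ∀ y ∈ levelStabilizer, ⁅x, y⁆ ∈ gamma G 3 →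
    ⁅x ^ 2 ^ i, y ^ 2 ^ i⁆ ∈ dyadicCore (i + 1)

namespace HasNormalForm

variable {i : ℕ}

theorem commutator_dyadicCore_le_evenCoords (hform : HasNormalForm i) :
    ⁅dyadicCore (i + 1), (⊤ : Subgroup G)⁆ ≤ evenCoords i := by
  apply commutator_top_le
  · intro g hg
    obtain ⟨x, y, w⟩ := hform.coord hg
    rw [← comm_mem_iff_commutatorElement_mem]
    refine ⟨comm_mem_of_mem_left hg _, -x, 2 ^ i * x - 2 * (2 ^ i * y), ?_⟩
    convert w.comm_a using 1
    ring
  · intro g hg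
    obtain ⟨x, y, w⟩ := hform.coord hg
    rw [← comm_mem_iff_commutatorElement_mem]
    exact ⟨comm_mem_of_mem_left hg _, 0, 0, by simpa using w.comm_b⟩

theorem commutator_evenCoords_le (hform : HasNormalForm i) :
    ⁅evenCoords i, (⊤ : Subgroup G)⁆ ≤ prodSelf (dyadicCore i) ⊔ dyadicCore (i + 2) := by
  apply commutator_top_le
  · rintro g ⟨hg, x, y, w⟩
    obtain ⟨x', y', w'⟩ := hform.coord hg
    obtain ⟨-, rfl⟩ := w.unique w'
    rw [← comm_mem_iff_commutatorElement_mem]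
    refine hform.mem_sup (comm_mem_of_mem_left hg _) (x := -(2 * x)) (y := x - y') ?_
    convert w.comm_a using 1 <;> ring
  · rintro g ⟨hg, x, y, w⟩
    rw [← comm_mem_iff_commutatorElement_mem]
    exact hform.mem_sup (comm_mem_of_mem_left hg _) (x := 0) (y := 0) (by simpa using w.comm_b)

theorem commutator_commutator_le (hform : HasNormalForm i) :
    ⁅⁅dyadicCore (i + 1), (⊤ : Subgroup G)⁆, (⊤ : Subgroup G)⁆ ≤
      prodSelf (dyadicCore i) ⊔ dyadicCore (i + 2) :=
  (Subgroup.commutator_mono hform.commutator_dyadicCore_le_evenCoords le_rfl).trans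
    hform.commutator_evenCoords_le

theorem layer_top_succ_le (hform : HasNormalForm i) (j : ℕ) :
    layer ⊤ (i + 1) (2 + 2 * j) ≤ prodSelf (layer ⊤ i j) ⊔ dyadicCore (i + 2) := by
  induction j with
  | zero =>
    refine (commutator_sup_mono_left le_rfl).trans (sup_le ?_ le_sup_right)
    exact hform.commutator_commutator_le
  | succ j ih =>
    have hcomm : ⁅layer ⊤ i j, (⊤ : Subgroup G)⁆ ≤ layer ⊤ i (j + 1) := le_sup_left
    have hsq : squares (layer ⊤ i j) ≤ layer ⊤ i (j + 1) :=
      squares_le.2 fun _ hx => dyadicCore_le_layer _ _ _ (sq_mem_of_mem_layer hx)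
    calc layer ⊤ (i + 1) (2 + 2 * (j + 1))
        = ⁅⁅layer ⊤ (i + 1) (2 + 2 * j), ⊤⁆ ⊔ dyadicCore (i + 2), ⊤⁆ ⊔ dyadicCore (i + 2) := rfl
      _ ≤ ⁅⁅prodSelf (layer ⊤ i j), ⊤⁆, ⊤⁆ ⊔ dyadicCore (i + 2) :=
        commutator_sup_mono_left (commutator_sup_mono_left ih)
      _ ≤ prodSelf (layer ⊤ i (j + 1)) ⊔ dyadicCore (i + 2) :=
        sup_le_sup_right (commutator_commutator_prodSelf_le hcomm hsq) _

theorem layer_levelStabilizer_succ_le (hform : HasNormalForm i) (j : ℕ) :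
    layer levelStabilizer (i + 1) (1 + j) ≤ prodSelf (layer ⊤ i j) ⊔ dyadicCore (i + 2) := by
  induction j with
  | zero => exact sup_le hform.commutator_levelStabilizer_le le_sup_right
  | succ j ih =>
    have hcomm : ⁅layer ⊤ i j, (⊤ : Subgroup G)⁆ ≤ layer ⊤ i (j + 1) := le_sup_left
    exact (commutator_sup_mono_left ih).trans
      (sup_le_sup_right (commutator_prodSelf_levelStabilizer_le hcomm) _)

theorem topLayersShort_succ (hform : HasNormalForm i) (hlen : TopLayersShort i) :
    TopLayersShort (i + 1) := by
  intro j hj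
  obtain ⟨k, hk⟩ : ∃ k, 2 ^ (i + 1) = k + 2 :=
    Nat.exists_eq_add_of_le' (by simpa using Nat.pow_le_pow_right two_pos (show 1 ≤ i + 1 by omega))
  rw [pow_succ] at hj
  calc layer ⊤ (i + 1) j ≤ layer ⊤ (i + 1) (2 + 2 * k) := layer_antitone ⊤ (i + 1) (by omega)
    _ ≤ prodSelf (layer ⊤ i k) ⊔ dyadicCore (i + 2) := hform.layer_top_succ_le k
    _ ≤ dyadicCore (i + 2) :=
      sup_le ((prodSelf_mono (hlen k hk.le)).trans (prodSelf_dyadicCore_le _)) le_rfl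

theorem stabilizerLayersShort_succ (hform : HasNormalForm i) (hlen : TopLayersShort i) :
    StabilizerLayersShort (i + 1) := by
  obtain ⟨k, hk⟩ : ∃ k, 2 ^ (i + 1) = k + 2 :=
    Nat.exists_eq_add_of_le' (by simpa using Nat.pow_le_pow_right two_pos (show 1 ≤ i + 1 by omega))
  calc layer levelStabilizer (i + 1) (2 ^ (i + 1)) ≤ layer levelStabilizer (i + 1) (1 + k) :=
        layer_antitone levelStabilizer (i + 1) (by omega)
    _ ≤ prodSelf (layer ⊤ i k) ⊔ dyadicCore (i + 2) := hform.layer_levelStabilizer_succ_le k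
    _ ≤ dyadicCore (i + 2) :=
      sup_le ((prodSelf_mono (hlen k hk.le)).trans (prodSelf_dyadicCore_le _)) le_rfl

end HasNormalForm

theorem PowersCommute.succ {i : ℕ} (hpow : PowersCommute i)
    (hlen : StabilizerLayersShort (i + 1)) : PowersCommute (i + 1) := by
  intro x hx y hy hxy
  rw [pow_succ, pow_mul, pow_mul]
  refine commutatorElement_sq_sq_mem (raises_pow (i + 1) hx i) (raises_pow (i + 1) hy i) ?_
    (hpow x hx y hy hxy)
  rw [← two_mul, ← pow_succ']
  exact hlen

theorem StabilizerLayersShort.commutatorElement_pow_mem {i : ℕ} (hlen : StabilizerLayersShort i)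
    {x s : G} (hx : x ∈ dyadicCore i) (hs : s ∈ levelStabilizer) :
    ⁅x, s ^ 2 ^ i⁆ ∈ dyadicCore (i + 1) :=
  hlen (by simpa using raises_pow i hs i 0 x hx)

theorem commutatorElement_mem_gamma_three_of_mem_right {s : G} (hs : s ∈ commutator G) (x : G) :
    ⁅x, s⁆ ∈ gamma G 3 :=
  (commutatorElement_mem_iff_commute _ _ _).2 (commute_mod_gamma_three hs x).symm

section NormalFormStep

variable {i : ℕ}

theorem d_left_mem_levelStabilizer : G.a⁻¹ * (G.a * G.c)⁻¹ ∈ levelStabilizer := by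
  have hc : G.a * G.c⁻¹ * G.a⁻¹ ∈ commutator G :=
    (inferInstance : (commutator G).Normal).conj_mem _ (inv_mem c_mem_commutator) _
  rw [show G.a⁻¹ * (G.a * G.c)⁻¹ = (G.a ^ 2)⁻¹ * (G.a * G.c⁻¹ * G.a⁻¹) by group]
  exact mul_mem (inv_mem a_sq_mem_levelStabilizer) (mem_levelStabilizer_of_mem_commutator hc)

theorem d_right_mem_levelStabilizer : (G.a * G.c) * (G.a * G.c) ∈ levelStabilizer := by
  have hc : G.a⁻¹ * G.c * G.a⁻¹⁻¹ * G.c ∈ commutator G :=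
    mul_mem ((inferInstance : (commutator G).Normal).conj_mem _ c_mem_commutator _)
      c_mem_commutator
  rw [show (G.a * G.c) * (G.a * G.c) = G.a ^ 2 * (G.a⁻¹ * G.c * G.a⁻¹⁻¹ * G.c) by group]
  exact mul_mem a_sq_mem_levelStabilizer (mem_levelStabilizer_of_mem_commutator hc)

theorem c_mem_levelStabilizer : G.c ∈ levelStabilizer :=
  mem_levelStabilizer_of_mem_commutator c_mem_commutator

theorem PowersCommute.commute_d_pow_f_pow (hpow : PowersCommute i) :
    Commute ((G.d ^ 2 ^ i : G) : G ⧸ prodSelf (dyadicCore (i + 1))) ((G.f ^ 2 ^ i : G) :) := by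
  rw [← commutatorElement_mem_iff_commute]
  exact ⟨_, hpow _ d_left_mem_levelStabilizer _ c_mem_levelStabilizer
      (commutatorElement_mem_gamma_three_of_mem_right c_mem_commutator _), _,
    hpow _ d_right_mem_levelStabilizer _ (inv_mem c_mem_levelStabilizer)
      (commutatorElement_mem_gamma_three_of_mem_right (inv_mem c_mem_commutator) _),
    (IsPair.d.pow (2 ^ i)).commutatorElement (IsPair.f.pow (2 ^ i))⟩

theorem StabilizerLayersShort.commute_pow_of_isPair (hlen : StabilizerLayersShort i) {g x y t : G}
    (w : IsPair g x y) (hx : x ∈ levelStabilizer) (hy : y ∈ levelStabilizer)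
    (ht : t ∈ prodSelf (dyadicCore i)) :
    Commute (t : G ⧸ prodSelf (dyadicCore (i + 1))) ((g ^ 2 ^ i : G) :) := by
  obtain ⟨p, hp, q, hq, wt⟩ := ht
  rw [← commutatorElement_mem_iff_commute]
  exact ⟨_, hlen.commutatorElement_pow_mem hp hx, _, hlen.commutatorElement_pow_mem hq hy,
    wt.commutatorElement (w.pow (2 ^ i))⟩

theorem sq_mem_prodSelf_dyadicCore {t : G} (ht : t ∈ prodSelf (dyadicCore i)) :
    t ^ 2 ∈ prodSelf (dyadicCore (i + 1)) := by
  obtain ⟨x, hx, y, hy, w⟩ := ht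
  exact ⟨_, sq_mem_dyadicCore hx, _, sq_mem_dyadicCore hy, w.pow 2⟩

theorem HasNormalForm.mk_sq_eq (hform : HasNormalForm i) (hlen : StabilizerLayersShort i)
    (hpow : PowersCommute i) {g : G} (hg : g ∈ dyadicCore (i + 1)) :
    ∃ x y : ℤ, ((g ^ 2 : G) : G ⧸ prodSelf (dyadicCore (i + 1))) =
      ((G.d ^ 2 ^ (i + 1) : G) : G ⧸ prodSelf (dyadicCore (i + 1))) ^ x *
        ((G.f ^ 2 ^ (i + 1) : G) : G ⧸ prodSelf (dyadicCore (i + 1))) ^ y := by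
  obtain ⟨x, y, t, ht, rfl⟩ := hform g hg
  have htd := hlen.commute_pow_of_isPair IsPair.d d_left_mem_levelStabilizer
    d_right_mem_levelStabilizer ht
  have htf := hlen.commute_pow_of_isPair IsPair.f c_mem_levelStabilizer
    (inv_mem c_mem_levelStabilizer) ht
  have ht2 : (t : G ⧸ prodSelf (dyadicCore (i + 1))) ^ 2 = 1 :=
    (QuotientGroup.eq_one_iff (t ^ 2)).2 (sq_mem_prodSelf_dyadicCore ht)
  refine ⟨x, y, ?_⟩
  rw [pow_succ 2 i, pow_mul, pow_mul]
  exact zpow_mul_zpow_mul_sq hpow.commute_d_pow_f_pow htd htf ht2 x y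

theorem HasNormalForm.succ (hform : HasNormalForm i) (hlen : StabilizerLayersShort i)
    (hpow : PowersCommute i) : HasNormalForm (i + 1) := by
  let N := prodSelf (dyadicCore (i + 1))
  let D : G ⧸ N := ((G.d ^ 2 ^ (i + 1) : G) : G ⧸ N)
  let F : G ⧸ N := ((G.f ^ 2 ^ (i + 1) : G) : G ⧸ N)
  have hDF : Commute D F := by
    have h := hpow.commute_d_pow_f_pow.pow_pow 2 2
    rwa [← QuotientGroup.mk_pow, ← QuotientGroup.mk_pow, ← pow_mul, ← pow_mul, ← pow_succ] at h
  have hD : D ∈ Subgroup.closure {D, F} := Subgroup.subset_closure (Set.mem_insert _ _)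
  have hF : F ∈ Subgroup.closure {D, F} :=
    Subgroup.subset_closure (Set.mem_insert_of_mem _ (Set.mem_singleton F))
  have hle : dyadicCore (i + 2) ≤ (Subgroup.closure {D, F}).comap (QuotientGroup.mk' N) := by
    rw [dyadicCore_add_two]
    refine sup_le (squares_le.2 fun g hg => ?_) ?_
    · obtain ⟨x, y, hxy⟩ := hform.mk_sq_eq hlen hpow hg
      rw [Subgroup.mem_comap, QuotientGroup.mk'_apply, hxy]
      exact mul_mem (zpow_mem hD x) (zpow_mem hF y)
    · exact (QuotientGroup.ker_mk' N).symm.le.trans (MonoidHom.ker_le_comap _ _)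
  intro g hg
  obtain ⟨x, y, hxy⟩ := exists_zpow_mul_zpow_of_mem_closure_pair hDF (hle hg)
  refine ⟨x, y, ((G.d ^ 2 ^ (i + 1)) ^ x * (G.f ^ 2 ^ (i + 1)) ^ y)⁻¹ * g, ?_, by group⟩
  exact QuotientGroup.eq.1 hxy.symm

end NormalFormStep

theorem hasNormalForm_and_layersShort_and_powersCommute (i : ℕ) :
    HasNormalForm i ∧ TopLayersShort i ∧ StabilizerLayersShort i ∧ PowersCommute i := by
  induction i with
  | zero =>
    have hle : dyadicCore 0 ≤ dyadicCore (0 + 1) := by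
      rw [dyadicCore_zero, zero_add, dyadicCore_one]
    refine ⟨?_, fun j _ => (layer_le _ _ _).trans hle, (layer_le _ _ _).trans hle, ?_⟩
    · intro g hg
      rw [zero_add, dyadicCore_one] at hg
      obtain ⟨x, y, w⟩ := exists_coord hg
      obtain ⟨t, ht, rfl⟩ := w.exists_eq_mul
      exact ⟨x, y, t, by rwa [dyadicCore_zero], by simp⟩
    · intro x _ y _ h
      simpa [dyadicCore_one] using h
  | succ i ih =>
    obtain ⟨hform, htop, hstab, hpow⟩ := ih
    have hstab_succ := hform.stabilizerLayersShort_succ htop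
    exact ⟨hform.succ hstab hpow, hform.topLayersShort_succ htop, hstab_succ,
      hpow.succ hstab_succ⟩

theorem hasNormalForm (i : ℕ) : HasNormalForm i :=
  (hasNormalForm_and_layersShort_and_powersCommute i).1

theorem topLayersShort (i : ℕ) : TopLayersShort i :=
  (hasNormalForm_and_layersShort_and_powersCommute i).2.1

theorem dyadicCore_inf_prodSelf_le (i : ℕ) :
    dyadicCore (i + 1) ⊓ prodSelf (gamma G 3) ≤ prodSelf (dyadicCore i) := by
  rintro g ⟨hg, hprod⟩
  obtain ⟨x, y, t, ht, rfl⟩ := hasNormalForm i g hg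
  obtain ⟨hx, hy⟩ := (Coord.normalForm x y ht).unique (Coord.of_mem hprod)
  rw [mul_eq_zero_iff_left (by positivity)] at hx hy
  simpa [hx, hy] using ht

theorem commutatorElement_c_pow_a_pow_mem (i : ℕ) : ⁅G.c ^ 2 ^ i, G.a ^ 2 ^ i⁆ ∈ dyadicCore i := by
  induction i with
  | zero =>
    rw [dyadicCore_zero, pow_zero, pow_one, pow_one]
    exact commutatorElement_mem_symm _
      (commutatorElement_mem_gamma_three_of_mem_right c_mem_commutator _)
  | succ i ih =>
    rw [pow_succ, pow_mul, pow_mul]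
    refine commutatorElement_sq_sq_mem (raises_pow i (Subgroup.mem_top _) i)
      (raises_pow i (Subgroup.mem_top _) i) (topLayersShort i _ ?_) ih
    omega

theorem stabilizerLayersShort (i : ℕ) : StabilizerLayersShort i :=
  (hasNormalForm_and_layersShort_and_powersCommute i).2.2.1

theorem powersCommute (i : ℕ) : PowersCommute i :=
  (hasNormalForm_and_layersShort_and_powersCommute i).2.2.2

/-- `α`, `β`, `κ` satisfy the relations of the discrete Heisenberg group, with the commutator of
`α` and `β` equal to the central element `κ ^ n`. -/
structure IsHeisenberg {Γ : Type*} [Group Γ] (α β κ : Γ) (n : ℤ) : Prop where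
  commute_left : Commute κ α
  commute_right : Commute κ β
  inv_mul_mul : β⁻¹ * α * β = α * κ ^ n

namespace IsHeisenberg

variable {Γ : Type*} [Group Γ] {α β κ : Γ} {n : ℤ}

theorem zpow_mul_zpow (h : IsHeisenberg α β κ n) (x y : ℤ) :
    β ^ y * α ^ x = α ^ x * β ^ y * κ ^ (-(n * x * y)) := by
  have conj_left : SemiconjBy β (α * κ ^ n) α := by
    rw [← h.inv_mul_mul]
    simp [SemiconjBy, mul_assoc]
  have conj_right : SemiconjBy (α ^ x) β (β * κ ^ (n * x)) := by
    have hx := (conj_left.zpow_right x).eq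
    rw [(h.commute_left.symm.zpow_right n).mul_zpow, ← zpow_mul] at hx
    rw [SemiconjBy, ← hx, mul_assoc, (h.commute_left.zpow_zpow (n * x) x).eq]
  have hxy := (conj_right.zpow_right y).eq
  rw [(h.commute_right.symm.zpow_right _).mul_zpow, ← zpow_mul, mul_assoc,
    (h.commute_left.zpow_zpow _ x).eq, ← mul_assoc] at hxy
  rw [hxy, mul_assoc, ← zpow_add, add_neg_cancel, zpow_zero, mul_one]

theorem mul (h : IsHeisenberg α β κ n) (x y z x' y' z' : ℤ) :
    (α ^ x * β ^ y * κ ^ z) * (α ^ x' * β ^ y' * κ ^ z') =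
      α ^ (x + x') * β ^ (y + y') * κ ^ (z + z' - n * x' * y) := by
  have κ_mul_α := (h.commute_left.zpow_zpow z x').eq
  have κ_mul_β (w : ℤ) := (h.commute_right.zpow_zpow w y').eq
  calc (α ^ x * β ^ y * κ ^ z) * (α ^ x' * β ^ y' * κ ^ z')
      = α ^ x * β ^ y * (κ ^ z * α ^ x') * β ^ y' * κ ^ z' := by simp only [mul_assoc]
    _ = α ^ x * (β ^ y * α ^ x') * (κ ^ z * β ^ y') * κ ^ z' := by
        rw [κ_mul_α]; simp only [mul_assoc]
    _ = α ^ x * α ^ x' * β ^ y * (κ ^ (-(n * x' * y)) * β ^ y') * κ ^ z * κ ^ z' := by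
        rw [h.zpow_mul_zpow, κ_mul_β]; simp only [mul_assoc]
    _ = α ^ (x + x') * β ^ (y + y') * κ ^ (z + z' - n * x' * y) := by
        rw [κ_mul_β, zpow_add, zpow_add,
          show z + z' - n * x' * y = -(n * x' * y) + z + z' by ring, zpow_add, zpow_add]
        simp only [mul_assoc]

theorem inv (h : IsHeisenberg α β κ n) (x y z : ℤ) :
    (α ^ x * β ^ y * κ ^ z)⁻¹ = α ^ (-x) * β ^ (-y) * κ ^ (-z - n * x * y) := by
  rw [inv_eq_iff_mul_eq_one, h.mul, add_neg_cancel, add_neg_cancel,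
    show z + (-z - n * x * y) - n * -x * y = 0 by ring]
  simp only [zpow_zero, mul_one]

/-- The subgroup generated by the squares of the three generators of a Heisenberg group, written
out as the set of its normal forms. -/
def evenSubgroup (h : IsHeisenberg α β κ n) : Subgroup Γ where
  carrier := {g | ∃ x y z : ℤ, g = α ^ (2 * x) * β ^ (2 * y) * κ ^ (2 * z)}
  one_mem' := ⟨0, 0, 0, by simp⟩
  mul_mem' := by
    rintro _ _ ⟨x, y, z, rfl⟩ ⟨x', y', z', rfl⟩
    refine ⟨x + x', y + y', z + z' - n * (2 * x') * y, ?_⟩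
    rw [h.mul]
    congr 2 <;> ring_nf
  inv_mem' := by
    rintro _ ⟨x, y, z, rfl⟩
    refine ⟨-x, -y, -z - n * (2 * x) * y, ?_⟩
    rw [h.inv]
    congr 2 <;> ring_nf

theorem sq_mem_evenSubgroup (h : IsHeisenberg α β κ (2 * n)) {t : Γ} (htα : Commute t α)
    (htβ : Commute t β) (htκ : Commute t κ) (ht : t ^ 2 = 1) (x y z : ℤ) :
    (α ^ x * β ^ y * κ ^ z * t) ^ 2 ∈ h.evenSubgroup := by
  have ht_comm : Commute t (α ^ x * β ^ y * κ ^ z) :=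
    ((htα.zpow_right x).mul_right (htβ.zpow_right y)).mul_right (htκ.zpow_right z)
  refine ⟨x, y, z - n * x * y, ?_⟩
  rw [ht_comm.symm.mul_pow, ht, mul_one, pow_two, h.mul]
  congr 2 <;> ring_nf

end IsHeisenberg

theorem commutatorElement_pow_succ_mem {i : ℕ} {x : G} (hx : x ∈ dyadicCore i) (g : G) :
    ⁅x, g ^ 2 ^ (i + 1)⁆ ∈ dyadicCore (i + 1) :=
  topLayersShort i _ (by omega) (raises_pow i (Subgroup.mem_top g) (i + 1) 0 x hx)

theorem exists_eq_c_zpow_mul {g : G} (hg : g ∈ commutator G) :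
    ∃ z : ℤ, ∃ h ∈ gamma G 3, g = G.c ^ z * h := by
  have hnormal : (Subgroup.zpowers (G.c : Nil2)).Normal := by
    constructor
    rintro _ ⟨n, rfl⟩ q
    obtain ⟨g, rfl⟩ := QuotientGroup.mk_surjective q
    have hcomm := ((commute_mod_gamma_three c_mem_commutator g).zpow_left n).eq
    exact ⟨n, by change (G.c : Nil2) ^ n = _; rw [← hcomm, mul_inv_cancel_right]⟩
  have hc : G.c ∈ (Subgroup.zpowers (G.c : Nil2)).comap (QuotientGroup.mk' (gamma G 3)) :=
    Subgroup.mem_zpowers _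
  obtain ⟨z, hz⟩ := commutator_le_of_c_mem hc hg
  exact ⟨z, (G.c ^ z)⁻¹ * g, QuotientGroup.eq.1 hz, by group⟩

theorem exists_a_mul_c_pow_eq (i : ℕ) :
    ∃ h ∈ dyadicCore i, (G.a * G.c) ^ 2 ^ (i + 1) = G.a ^ 2 ^ (i + 1) * G.c ^ 2 ^ (i + 1) * h := by
  suffices hmk : (((G.a * G.c) ^ 2 ^ (i + 1) : G) : G ⧸ dyadicCore i) =
      ((G.a ^ 2 ^ (i + 1) * G.c ^ 2 ^ (i + 1) : G) :) from
    ⟨_, QuotientGroup.eq.1 hmk.symm, (mul_inv_cancel_left _ _).symm⟩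
  induction i with
  | zero =>
    exact (commute_mod_gamma_three c_mem_commutator G.a).symm.mul_pow _
  | succ i ih =>
    set h := (G.a ^ 2 ^ (i + 1) * G.c ^ 2 ^ (i + 1))⁻¹ * (G.a * G.c) ^ 2 ^ (i + 1) with h_def
    have hh : h ∈ dyadicCore i := QuotientGroup.eq.1 ih.symm
    have h_comm (g : G) : Commute (h : G ⧸ dyadicCore (i + 1)) ((g ^ 2 ^ (i + 1) : G) :) :=
      (commutatorElement_mem_iff_commute _ _ _).1 (commutatorElement_pow_succ_mem hh g)
    have hca : Commute ((G.c ^ 2 ^ (i + 1) : G) : G ⧸ dyadicCore (i + 1))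
        ((G.a ^ 2 ^ (i + 1) : G) :) :=
      (commutatorElement_mem_iff_commute _ _ _).1 (commutatorElement_c_pow_a_pow_mem (i + 1))
    have h_sq : (h : G ⧸ dyadicCore (i + 1)) ^ 2 = 1 :=
      (QuotientGroup.eq_one_iff (h ^ 2)).2 (sq_mem_dyadicCore hh)
    rw [pow_succ 2 (i + 1), pow_mul, pow_mul, pow_mul, ← mul_inv_cancel_left
      (G.a ^ 2 ^ (i + 1) * G.c ^ 2 ^ (i + 1)) ((G.a * G.c) ^ 2 ^ (i + 1)), ← h_def]
    have hac_comm := ((h_comm G.a).mul_right (h_comm G.c)).symm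
    refine (hac_comm.mul_pow 2).trans ?_
    rw [h_sq, mul_one]
    exact hca.symm.mul_pow 2

theorem inv_b_mul_a_mul_b : G.b⁻¹ * G.a * G.b = G.a * G.c := by
  simp [G.c, comm, mul_assoc]

theorem mul_comm_mul_mul_comm_mem_layer {i j : ℕ} {h : G} (hh : h ∈ layer ⊤ i j) (g k : G)
    (s : ℕ) :
    h * comm h (g ^ 2 ^ (i + 1)) * h * comm h (k ^ 2 ^ s) ∈ layer ⊤ i (j + 2 ^ s) := by
  have hcore : h ∈ dyadicCore i := layer_le _ _ _ hh
  have hg : comm h (g ^ 2 ^ (i + 1)) ∈ dyadicCore (i + 1) :=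
    (comm_mem_iff_commutatorElement_mem _ _ _).2 (commutatorElement_pow_succ_mem hcore g)
  have hk : ⁅h, k ^ 2 ^ s⁆ ∈ layer ⊤ i (j + 2 ^ s) := raises_pow i (Subgroup.mem_top k) s j h hh
  rw [show h * comm h (g ^ 2 ^ (i + 1)) * h = (h * comm h (g ^ 2 ^ (i + 1)) * h⁻¹) * h ^ 2 by
    rw [pow_two]; group]
  refine mul_mem (dyadicCore_le_layer _ _ _ (mul_mem ?_ (sq_mem_dyadicCore hcore)))
    ((comm_mem_iff_commutatorElement_mem _ _ _).2 hk)
  exact (dyadicCore_normal (i + 1)).conj_mem _ hg h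

theorem exists_inv_b_pow_mul_a_pow_mul_b_pow_eq (i s : ℕ) :
    ∃ h ∈ layer ⊤ i (2 ^ s - 1), (G.b ^ 2 ^ s)⁻¹ * G.a ^ 2 ^ (i + 1) * G.b ^ 2 ^ s =
      G.a ^ 2 ^ (i + 1) * (G.c ^ 2 ^ s) ^ 2 ^ (i + 1) * h := by
  induction s with
  | zero =>
    obtain ⟨h, hh, hpow⟩ := exists_a_mul_c_pow_eq i
    refine ⟨h, hh, ?_⟩
    have hconj := conj_pow (a := G.b⁻¹) (b := G.a) (i := 2 ^ (i + 1))
    rw [inv_inv, inv_b_mul_a_mul_b, hpow] at hconj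
    simpa only [pow_zero, pow_one] using hconj.symm
  | succ s ih =>
    obtain ⟨h, hh, hconj⟩ := ih
    have hlayer := mul_comm_mul_mul_comm_mem_layer hh (G.c ^ 2 ^ s) G.b s
    rw [show 2 ^ s - 1 + 2 ^ s = 2 ^ (s + 1) - 1 by
      have := Nat.one_le_two_pow (n := s); omega] at hlayer
    refine ⟨_, hlayer, ?_⟩
    have hcb : Commute ((G.c ^ 2 ^ s) ^ 2 ^ (i + 1)) (G.b ^ 2 ^ s) :=
      (commute_c_b.pow_pow _ _).pow_left _
    rw [pow_succ 2 s, pow_mul, pow_mul, pow_two (G.c ^ 2 ^ s), (Commute.refl _).mul_pow,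
      pow_two (G.b ^ 2 ^ s)]
    generalize (G.c ^ 2 ^ s) ^ 2 ^ (i + 1) = γ at hconj hcb ⊢
    generalize G.b ^ 2 ^ s = β at hconj hcb ⊢
    calc (β * β)⁻¹ * G.a ^ 2 ^ (i + 1) * (β * β)
        = β⁻¹ * (β⁻¹ * G.a ^ 2 ^ (i + 1) * β) * β := by group
      _ = β⁻¹ * (G.a ^ 2 ^ (i + 1) * γ * h) * β := by rw [hconj]
      _ = (β⁻¹ * G.a ^ 2 ^ (i + 1) * β) * (β⁻¹ * γ * β) * (β⁻¹ * h * β) := by group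
      _ = G.a ^ 2 ^ (i + 1) * (γ * γ) * (h * comm h γ * h * comm h β) := by
          rw [hconj, mul_assoc β⁻¹ γ, hcb.eq, inv_mul_cancel_left]
          simp only [comm]
          group

/-- A normal subgroup with the same index as the term of index `2 ^ i + 1` of the lower
`2`-central series, hence equal to it. -/
def dyadicTerm : ℕ → Subgroup G
  | 0 => twoCentral G 2
  | i + 1 => squares (dyadicTerm i) ⊔ dyadicCore (i + 1)

theorem dyadicTerm_zero : dyadicTerm 0 = twoCentral G 2 := rfl

theorem dyadicTerm_succ (i : ℕ) :
    dyadicTerm (i + 1) = squares (dyadicTerm i) ⊔ dyadicCore (i + 1) := rfl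

instance dyadicTerm_normal (i : ℕ) : (dyadicTerm i).Normal := by
  induction i with
  | zero => rw [dyadicTerm_zero]; infer_instance
  | succ i ih => rw [dyadicTerm_succ]; infer_instance

theorem dyadicCore_le_dyadicTerm (i : ℕ) : dyadicCore i ≤ dyadicTerm i := by
  cases i with
  | zero =>
    rw [dyadicCore_zero, dyadicTerm_zero]
    exact (gamma_antitone (by norm_num)).trans (gamma_le_twoCentral 2 (by norm_num))
  | succ i => exact le_sup_right

theorem squares_dyadicTerm_le (i : ℕ) : squares (dyadicTerm i) ≤ dyadicTerm (i + 1) := le_sup_left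

theorem dyadicTerm_succ_le (i : ℕ) : dyadicTerm (i + 1) ≤ dyadicTerm i :=
  sup_le (squares_le_self _) ((dyadicCore_succ_le i).trans (dyadicCore_le_dyadicTerm i))

theorem exists_ab_eq_sq_of_mem_twoCentral_two {g : G} (hg : g ∈ twoCentral G 2) :
    ∃ u : Ab, u ^ 2 = g := by
  suffices hle : twoCentral G 2 ≤
      (powMonoidHom 2 : Ab →* Ab).range.comap (QuotientGroup.mk' (commutator G)) from hle hg
  rw [twoCentral_succ 1 le_rfl, twoCentral_one]
  refine sup_le (fun g hg => ⟨1, ?_⟩) (squares_le.2 fun g _ => ⟨(g : Ab), rfl⟩)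
  rw [map_one]
  exact (ab_eq_one_iff.2 hg).symm

theorem exists_of_mem_twoCentral_two {g : G} (hg : g ∈ twoCentral G 2) :
    ∃ x y z : ℤ, ∃ h ∈ gamma G 3, g = G.a ^ (2 * x) * G.b ^ (2 * y) * G.c ^ z * h := by
  obtain ⟨u, hu⟩ := exists_ab_eq_sq_of_mem_twoCentral_two hg
  obtain ⟨k, rfl⟩ := QuotientGroup.mk_surjective u
  obtain ⟨x, y, hk⟩ := exists_ab_eq k
  have hg_ab : ((G.a ^ (2 * x) * G.b ^ (2 * y) : G) : Ab) = g := by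
    rw [← hu, hk, mul_pow, ← zpow_natCast, ← zpow_natCast, ← zpow_mul, ← zpow_mul, mul_comm x,
      mul_comm y]
    rfl
  obtain ⟨z, h, hh, hz⟩ := exists_eq_c_zpow_mul (QuotientGroup.eq.1 hg_ab)
  refine ⟨x, y, z, h, hh, ?_⟩
  rw [mul_assoc _ _ h, ← hz, mul_inv_cancel_left]

section DyadicTermNormalForm

variable (i : ℕ)

theorem isHeisenberg_mk :
    IsHeisenberg ((G.a ^ 2 ^ (i + 1) : G) : G ⧸ dyadicCore (i + 1)) ((G.b ^ 2 ^ (i + 1) : G) :)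
      ((G.c ^ 2 ^ i : G) :) (2 * 2 ^ (i + 1)) where
  commute_left := by
    have hca := powersCommute i G.c c_mem_levelStabilizer (G.a ^ 2) a_sq_mem_levelStabilizer
      (commutatorElement_mem_symm _
        (commutatorElement_mem_gamma_three_of_mem_right c_mem_commutator _))
    rwa [← pow_mul, ← pow_succ', commutatorElement_mem_iff_commute] at hca
  commute_right := (commute_c_b.pow_pow _ _).map (QuotientGroup.mk' (dyadicCore (i + 1)))
  inv_mul_mul := by
    obtain ⟨h, hh, hconj⟩ := exists_inv_b_pow_mul_a_pow_mul_b_pow_eq i (i + 1)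
    have h_eq_one : QuotientGroup.mk' (dyadicCore (i + 1)) h = 1 :=
      (QuotientGroup.eq_one_iff h).2 (topLayersShort i _ (by omega) hh)
    have hpow : (G.c ^ 2 ^ (i + 1)) ^ 2 ^ (i + 1) = (G.c ^ 2 ^ i) ^ (2 * 2 ^ (i + 1) : ℤ) := by
      norm_cast
      rw [← pow_mul, ← pow_mul]
      congr 1
      ring
    have hmk := congrArg (QuotientGroup.mk' (dyadicCore (i + 1))) hconj
    rw [hpow, map_mul _ _ h, h_eq_one, mul_one] at hmk
    exact hmk

theorem exists_of_mem_dyadicTerm : ∀ g ∈ dyadicTerm i, ∃ x y z : ℤ, ∃ h ∈ dyadicCore i,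
    g = (G.a ^ 2 ^ (i + 1)) ^ x * (G.b ^ 2 ^ (i + 1)) ^ y * (G.c ^ 2 ^ i) ^ z * h := by
  induction i with
  | zero =>
    intro g hg
    obtain ⟨x, y, z, h, hh, rfl⟩ := exists_of_mem_twoCentral_two hg
    refine ⟨x, y, z, h, by rwa [dyadicCore_zero], ?_⟩
    rw [zpow_mul, zpow_mul]
    simp
  | succ i ih =>
    have hle : dyadicTerm (i + 1) ≤
        (isHeisenberg_mk i).evenSubgroup.comap (QuotientGroup.mk' (dyadicCore (i + 1))) := by
      rw [dyadicTerm_succ]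
      refine sup_le (squares_le.2 fun g hg => ?_)
        ((QuotientGroup.ker_mk' _).symm.le.trans (MonoidHom.ker_le_comap _ _))
      obtain ⟨x, y, z, h, hh, rfl⟩ := ih g hg
      have h_comm (g : G) : Commute (h : G ⧸ dyadicCore (i + 1)) ((g ^ 2 ^ (i + 1) : G) :) :=
        (commutatorElement_mem_iff_commute _ _ _).1 (commutatorElement_pow_succ_mem hh g)
      have hc_comm : Commute (h : G ⧸ dyadicCore (i + 1)) ((G.c ^ 2 ^ i : G) :) :=
        (commutatorElement_mem_iff_commute _ _ _).1
          ((stabilizerLayersShort i).commutatorElement_pow_mem hh c_mem_levelStabilizer)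
      exact (isHeisenberg_mk i).sq_mem_evenSubgroup (h_comm G.a) (h_comm G.b) hc_comm
        ((QuotientGroup.eq_one_iff (h ^ 2)).2 (sq_mem_dyadicCore hh)) x y z
    intro g hg
    obtain ⟨x, y, z, hxyz⟩ := hle hg
    have pow_succ_zpow (u : G) (k : ℕ) (m : ℤ) : (u ^ 2 ^ (k + 1)) ^ m = (u ^ 2 ^ k) ^ (2 * m) := by
      rw [pow_succ, pow_mul, zpow_mul]
      norm_cast
    have hmk : (((G.a ^ 2 ^ (i + 1)) ^ (2 * x) * (G.b ^ 2 ^ (i + 1)) ^ (2 * y) *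
      (G.c ^ 2 ^ i) ^ (2 * z) : G) : G ⧸ dyadicCore (i + 1)) = g := hxyz.symm
    refine ⟨x, y, z, _, QuotientGroup.eq.1 hmk, ?_⟩
    rw [pow_succ_zpow G.a, pow_succ_zpow G.b, pow_succ_zpow G.c, mul_inv_cancel_left]

end DyadicTermNormalForm

theorem ab_of_mem_dyadicTerm {i : ℕ} {g : G} (hg : g ∈ dyadicTerm i) :
    ∃ x y : ℤ, (g : Ab) = (G.a : Ab) ^ (2 ^ (i + 1) * x) * (G.b : Ab) ^ (2 ^ (i + 1) * y) := by
  obtain ⟨x, y, z, h, hh, rfl⟩ := exists_of_mem_dyadicTerm i g hg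
  have h_eq_one : (h : Ab) = 1 :=
    ab_eq_one_iff.2 (gamma_three_le_commutator (dyadicCore_le_gamma_three i hh))
  refine ⟨x, y, ?_⟩
  simp only [QuotientGroup.mk_mul, QuotientGroup.mk_zpow, QuotientGroup.mk_pow, h_eq_one, ab_c,
    one_zpow, one_pow, mul_one, zpow_mul]
  norm_cast

theorem exists_of_mem_dyadicTerm_of_mem_commutator {i : ℕ} {g : G} (hg : g ∈ dyadicTerm i)
    (hg' : g ∈ commutator G) : ∃ z : ℤ, ∃ h ∈ dyadicCore i, g = G.c ^ (2 ^ i * z) * h := by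
  obtain ⟨x, y, z, h, hh, rfl⟩ := exists_of_mem_dyadicTerm i g hg
  have hc : (G.c ^ 2 ^ i) ^ z ∈ commutator G := zpow_mem (pow_mem c_mem_commutator _) z
  have hh' : h ∈ commutator G := gamma_three_le_commutator (dyadicCore_le_gamma_three i hh)
  have hab : (G.a ^ 2 ^ (i + 1)) ^ x * (G.b ^ 2 ^ (i + 1)) ^ y ∈ commutator G :=
    (Subgroup.mul_mem_cancel_right _ hc).1 ((Subgroup.mul_mem_cancel_right _ hh').1 hg')
  rw [← ab_eq_one_iff, ← zpow_natCast, ← zpow_natCast, ← zpow_mul, ← zpow_mul] at hab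
  obtain ⟨hx, hy⟩ := eq_zero_of_ab_eq_one hab
  rw [mul_eq_zero_iff_left (by positivity)] at hx hy
  refine ⟨z, h, hh, ?_⟩
  rw [hx, hy, zpow_zero, zpow_zero, one_mul, one_mul, zpow_mul]
  norm_cast

theorem dyadicTerm_inf_gamma_three_le (i : ℕ) : dyadicTerm i ⊓ gamma G 3 ≤ dyadicCore i := by
  rintro g ⟨hg, hγ⟩
  obtain ⟨z, h, hh, rfl⟩ :=
    exists_of_mem_dyadicTerm_of_mem_commutator hg (gamma_three_le_commutator hγ)
  have hc := (Subgroup.mul_mem_cancel_right _ (dyadicCore_le_gamma_three i hh)).1 hγ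
  rwa [eq_zero_of_c_zpow_mem_gamma_three hc, zpow_zero, one_mul]

/-- `M` contains some term of the lower `2`-central series. -/
def IsCofinal (M : Subgroup G) : Prop := ∃ N, 1 ≤ N ∧ twoCentral G N ≤ M

theorem IsCofinal.mono {M M' : Subgroup G} (h : IsCofinal M) (hM : M ≤ M') : IsCofinal M' :=
  h.imp fun _ hN => ⟨hN.1, hN.2.trans hM⟩

theorem IsCofinal.of_squares_le_of_commutator_le {M M' : Subgroup G} (h : IsCofinal M)
    (hs : squares M ≤ M') (hc : ⁅M, (⊤ : Subgroup G)⁆ ≤ M') : IsCofinal M' := by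
  obtain ⟨N, hN, hM⟩ := h
  refine ⟨(2 * N - 1) + 1, by omega, ?_⟩
  rw [twoCentral_succ _ (by omega), show (2 * N - 1 + 2) / 2 = N by omega]
  refine sup_le (le_trans (Subgroup.commutator_mono ?_ le_rfl) hc) ((squares_mono hM).trans hs)
  exact (twoCentral_antitone (by omega)).trans hM

theorem IsCofinal.commutator_sup_dyadicTerm {i : ℕ} {M : Subgroup G} [M.Normal]
    (hM : M ≤ dyadicTerm i) (h : IsCofinal (M ⊔ dyadicTerm (i + 1))) :
    IsCofinal (⁅M, (⊤ : Subgroup G)⁆ ⊔ dyadicTerm (i + 1)) := by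
  refine h.of_squares_le_of_commutator_le ?_ (commutator_sup_left_le le_sup_left
    ((Subgroup.commutator_le_left _ _).trans le_sup_right))
  exact (squares_mono (sup_le hM (dyadicTerm_succ_le i))).trans
    ((squares_dyadicTerm_le i).trans le_sup_right)

theorem commutator_commutator_dyadicTerm_le (i : ℕ) :
    ⁅⁅dyadicTerm i, (⊤ : Subgroup G)⁆, (⊤ : Subgroup G)⁆ ≤ dyadicCore i := by
  refine (le_inf ?_ ?_).trans (dyadicTerm_inf_gamma_three_le i)
  · exact (Subgroup.commutator_le_left _ _).trans (Subgroup.commutator_le_left _ _)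
  · rw [gamma_succ 2 (by norm_num), gamma_succ 1 le_rfl, gamma_one]
    exact Subgroup.commutator_mono (Subgroup.commutator_mono le_top le_rfl) le_rfl

theorem isCofinal_dyadicTerm (i : ℕ) : IsCofinal (dyadicTerm i) := by
  induction i with
  | zero => exact ⟨2, by norm_num, le_rfl⟩
  | succ i ih =>
    have hlayer (j : ℕ) : IsCofinal (layer ⊤ i j ⊔ dyadicTerm (i + 1)) := by
      induction j with
      | zero =>
        have hcomm : IsCofinal (⁅dyadicTerm i, ⊤⁆ ⊔ dyadicTerm (i + 1)) :=
          (ih.mono le_sup_left).commutator_sup_dyadicTerm le_rfl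
        exact (hcomm.commutator_sup_dyadicTerm (Subgroup.commutator_le_left _ _)).mono
          (sup_le_sup_right (commutator_commutator_dyadicTerm_le i) _)
      | succ j ihj =>
        exact (ihj.commutator_sup_dyadicTerm ((layer_le _ _ _).trans
          (dyadicCore_le_dyadicTerm i))).mono (sup_le_sup_right le_sup_left _)
    exact (hlayer (2 ^ (i + 1))).mono (sup_le ((topLayersShort i _ (by omega)).trans
      (dyadicCore_le_dyadicTerm (i + 1))) le_rfl)

section CommSqSeries

/-- The analogue of the lower `2`-central series that starts at the commutator subgroup. It
approximates the lower central series up to squares, and it doubles its index when it is moved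
into the left factor. -/
abbrev commSqSeries (n : ℕ) : Subgroup G := sqSeries (commutator G) n

theorem commSqSeries_le_commutator {n : ℕ} (hn : 1 ≤ n) : commSqSeries n ≤ commutator G := by
  rw [← sqSeries_one (commutator G)]
  exact sqSeries_antitone _ hn

theorem comm_mem_commSqSeries {n : ℕ} (hn : 1 ≤ n) {x : G} (hx : x ∈ commSqSeries n) (g : G) :
    comm x g ∈ commSqSeries (n + 1) :=
  (comm_mem_iff_commutatorElement_mem _ _ _).2 (commutatorElement_mem_sqSeries _ hn hx g)

theorem gamma_le_commSqSeries {n : ℕ} (hn : 1 ≤ n) : gamma G (n + 1) ≤ commSqSeries n :=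
  gamma_le_sqSeries n hn

theorem c_mem_commSqSeries_one : G.c ∈ commSqSeries 1 := by
  rw [commSqSeries, sqSeries_one]
  exact c_mem_commutator

theorem cLeft_mem_commSqSeries : G.cLeft ∈ commSqSeries 2 := by
  have hccd : G.c * G.c * G.d ∈ commSqSeries 2 := by
    refine mul_mem ?_ (gamma_le_commSqSeries (by norm_num) d_mem_gamma_three)
    rw [← pow_two]
    exact sq_mem_sqSeries _ le_rfl le_rfl c_mem_commSqSeries_one
  rw [G.cLeft]
  refine inv_mem ?_
  simpa only [inv_inv] using (sqSeries_normal (commutator G) 2).conj_mem _ hccd G.b⁻¹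

theorem commSqSeries_le_leftFactor {n : ℕ} (hn : 1 ≤ n) :
    commSqSeries n ≤ leftFactor (commSqSeries (2 * n)) := by
  refine sqSeries_le_of (F := fun n => leftFactor (commSqSeries (2 * n))) _ ?_ ?_ ?_ n hn
  · exact commutator_le_of_c_mem ⟨_, cLeft_mem_commSqSeries, IsPair.cLeft⟩
  · intro n hn
    apply commutator_top_le
    · rintro y ⟨w, hw, h⟩
      refine ⟨⁅comm w⁻¹ G.a, G.b⁆, ?_, ?_⟩
      · exact commutatorElement_mem_sqSeries _ (by omega)
          (comm_mem_commSqSeries (by omega) (inv_mem hw) _) _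
      · simpa using h.inv.comm_a.commutatorElement IsPair.b
    · rintro y ⟨w, hw, h⟩
      refine ⟨⁅w, G.a ^ 2⁆, ?_, by simpa using h.commutatorElement IsPair.a_sq⟩
      have hwa := commutatorElement_mem_sqSeries _ (by omega) hw G.a
      rw [commutatorElement_sq_right]
      exact mul_mem (sq_mem_sqSeries _ (by omega) (by omega) hwa)
        (commutatorElement_mem_sqSeries _ (by omega) (inv_mem hwa) _)
  · intro m n hn hm
    refine squares_le.2 ?_
    rintro y ⟨w, hw, h⟩
    exact ⟨w ^ 2, sq_mem_sqSeries _ (by omega) (by omega) hw, by simpa using h.pow 2⟩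

theorem prodSelf_gamma_three_le_commSqSeries : prodSelf (gamma G 3) ≤ commSqSeries 4 :=
  (prodSelf_mono (gamma_le_commSqSeries (by norm_num))).trans
    (prodSelf_le (commSqSeries_le_leftFactor (by norm_num)))

theorem exists_e_eq : ∃ t ∈ prodSelf (gamma G 3), G.e = G.d ^ (-2 : ℤ) * G.f * t := by
  simpa using Coord.e.exists_eq_mul

theorem d_zpow_neg_two_mem_commSqSeries : G.d ^ (-2 : ℤ) ∈ commSqSeries 4 := by
  rw [zpow_neg]
  exact inv_mem (sq_mem_sqSeries _ (by norm_num) le_rfl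
    (gamma_le_commSqSeries (by norm_num) d_mem_gamma_three))

theorem f_mem_commSqSeries : G.f ∈ commSqSeries 3 := by
  obtain ⟨t, ht, he⟩ := exists_e_eq
  have hf : G.f = (G.d ^ (-2 : ℤ))⁻¹ * G.e * t⁻¹ := by rw [he]; group
  have hle : commSqSeries 4 ≤ commSqSeries 3 := sqSeries_antitone _ (by norm_num)
  rw [hf]
  exact mul_mem (mul_mem (inv_mem (hle d_zpow_neg_two_mem_commSqSeries))
    (gamma_le_commSqSeries (by norm_num) e_mem_gamma_four))
    (inv_mem (hle (prodSelf_gamma_three_le_commSqSeries ht)))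

end CommSqSeries

section GammaGen

open Classical in
/-- The element `⟨x, 1⟩` of `G`, with the junk value `1` when it does not exist. -/
noncomputable def leftLift (x : G) : G := if h : ∃ g, IsPair g x 1 then h.choose else 1

theorem isPair_leftLift {x : G} (hx : x ∈ commutator G) : IsPair (leftLift x) x 1 := by
  obtain ⟨g, -, w⟩ := commutator_le_leftFactor hx
  have hexists : ∃ g, IsPair g x 1 := ⟨g, w⟩
  rw [leftLift, dif_pos hexists]
  exact hexists.choose_spec

theorem leftLift_mem_commSqSeries {n : ℕ} (hn : 1 ≤ n) {x : G} (hx : x ∈ commSqSeries n) :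
    leftLift x ∈ commSqSeries (2 * n) :=
  mem_of_mem_leftFactor (isPair_leftLift (commSqSeries_le_commutator hn hx))
    (commSqSeries_le_leftFactor hn hx)

/-- For `n ≥ 2`, an element `zₙ` generating `γₙ` modulo `commSqSeries n`, defined by `z₂ = c`,
`z₃ = d`, `z₄ = f` and, for `m ≥ 3`, `z₂ₘ₋₁ = ⟨zₘ, 1⟩` and `z₂ₘ = [z₂ₘ₋₁, a]`. -/
noncomputable def gammaGen (n : ℕ) : G :=
  if n ≤ 2 then G.c else if n = 3 then G.d else if n = 4 then G.f
  else if n % 2 = 1 then leftLift (gammaGen ((n + 1) / 2))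
  else comm (leftLift (gammaGen ((n + 1) / 2))) G.a
  termination_by n

theorem gammaGen_two : gammaGen 2 = G.c := by rw [gammaGen, if_pos le_rfl]

theorem gammaGen_three : gammaGen 3 = G.d := by rw [gammaGen]; simp

theorem gammaGen_four : gammaGen 4 = G.f := by rw [gammaGen]; simp

theorem gammaGen_odd {m : ℕ} (hm : 3 ≤ m) : gammaGen (2 * m - 1) = leftLift (gammaGen m) := by
  rw [gammaGen, if_neg (by omega), if_neg (by omega), if_neg (by omega), if_pos (by omega),
    show (2 * m - 1 + 1) / 2 = m by omega]

theorem gammaGen_even {m : ℕ} (hm : 3 ≤ m) :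
    gammaGen (2 * m) = comm (gammaGen (2 * m - 1)) G.a := by
  rw [gammaGen_odd hm, gammaGen, if_neg (by omega), if_neg (by omega), if_neg (by omega),
    if_neg (by omega), show (2 * m + 1) / 2 = m by omega]

theorem gammaGen_induction {P : ∀ n, 2 ≤ n → Prop} (two : P 2 (by omega)) (three : P 3 (by omega))
    (four : P 4 (by omega)) (odd : ∀ m (hm : 3 ≤ m), P m (by omega) → P (2 * m - 1) (by omega))
    (even : ∀ m (hm : 3 ≤ m), P m (by omega) → P (2 * m) (by omega)) (n : ℕ) (hn : 2 ≤ n) :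
    P n hn := by
  induction n using Nat.strong_induction_on with
  | _ n ih =>
    rcases Nat.lt_or_ge n 5 with h | h
    · interval_cases n
      exacts [two, three, four]
    · rcases Nat.even_or_odd' n with ⟨m, rfl | rfl⟩
      · exact even m (by omega) (ih m (by omega) (by omega))
      · simpa only [show 2 * (m + 1) - 1 = 2 * m + 1 by omega] using
          odd (m + 1) (by omega) (ih (m + 1) (by omega) (by omega))

theorem gammaGen_mem_commSqSeries (n : ℕ) (hn : 2 ≤ n) : gammaGen n ∈ commSqSeries (n - 1) := by
  induction n, hn using gammaGen_induction with
  | two => rw [gammaGen_two]; exact c_mem_commSqSeries_one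
  | three => rw [gammaGen_three]; exact gamma_le_commSqSeries (by norm_num) d_mem_gamma_three
  | four => rw [gammaGen_four]; exact f_mem_commSqSeries
  | odd m hm ih =>
    rw [gammaGen_odd hm, show 2 * m - 1 - 1 = 2 * (m - 1) by omega]
    exact leftLift_mem_commSqSeries (by omega) ih
  | even m hm ih =>
    rw [gammaGen_even hm, gammaGen_odd hm, show 2 * m - 1 = 2 * (m - 1) + 1 by omega]
    exact comm_mem_commSqSeries (by omega) (leftLift_mem_commSqSeries (by omega) ih) _

theorem isPair_gammaGen {m : ℕ} (hm : 3 ≤ m) : IsPair (gammaGen (2 * m - 1)) (gammaGen m) 1 := by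
  rw [gammaGen_odd hm]
  exact isPair_leftLift (commSqSeries_le_commutator (by omega)
    (gammaGen_mem_commSqSeries m (by omega)))

theorem gammaGen_mem_twoCentral {n : ℕ} (hn : 2 ≤ n) : gammaGen n ∈ twoCentral G n := by
  simpa only [Nat.sub_add_cancel (one_le_two.trans hn)] using
    sqSeries_commutator_le_twoCentral (n - 1) (by omega) (gammaGen_mem_commSqSeries n hn)

end GammaGen

section GammaCover

/-- The subgroup generated by `gammaGen n` and `commSqSeries n`, an upper bound for `γₙ`. -/
noncomputable def gammaCover (n : ℕ) : Subgroup G :=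
  Subgroup.zpowers (gammaGen n) ⊔ commSqSeries n

theorem gammaGen_mem_gammaCover (n : ℕ) : gammaGen n ∈ gammaCover n :=
  Subgroup.mem_sup_left (Subgroup.mem_zpowers _)

theorem commSqSeries_le_gammaCover (n : ℕ) : commSqSeries n ≤ gammaCover n := le_sup_right

instance gammaCover_normal (n : ℕ) : (gammaCover n).Normal := by
  rw [← Subgroup.commutator_top_right_le_iff]
  rcases Nat.lt_or_ge n 2 with hn | hn
  · have hcomm : commutator G ≤ gammaCover n := by
      rw [← sqSeries_one (commutator G)]
      exact (sqSeries_antitone _ (by omega)).trans (commSqSeries_le_gammaCover n)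
    exact (Subgroup.commutator_mono le_top le_rfl).trans hcomm
  · have hle : gammaCover n ≤ commSqSeries (n - 1) := by
      refine sup_le ?_ (sqSeries_antitone _ (n.sub_le 1))
      rw [Subgroup.zpowers_le]
      exact gammaGen_mem_commSqSeries n hn
    refine (Subgroup.commutator_mono hle le_rfl).trans ?_
    refine (commutator_sqSeries_le _ _ (by omega)).trans ?_
    rw [Nat.sub_add_cancel (by omega)]
    exact commSqSeries_le_gammaCover n

theorem gammaCover_succ_le_leftFactor {n : ℕ} (hn : 2 ≤ n) :
    gammaCover (n + 1) ≤ leftFactor (gammaCover (2 * n + 1)) := by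
  refine sup_le ?_ ((commSqSeries_le_leftFactor (by omega)).trans (leftFactor_mono ?_))
  · rw [Subgroup.zpowers_le]
    have hpair := isPair_gammaGen (m := n + 1) (by omega)
    rw [show 2 * (n + 1) - 1 = 2 * n + 1 by omega] at hpair
    exact ⟨_, gammaGen_mem_gammaCover _, hpair⟩
  · exact (sqSeries_antitone _ (by omega)).trans (commSqSeries_le_gammaCover _)

theorem comm_c_b_mem {M : Subgroup G} [M.Normal] : comm G.c G.b ∈ M := by
  rw [comm_mem_iff_commute]
  exact commute_c_b.map (QuotientGroup.mk' M)

theorem comm_d_a_mem_gammaCover : comm G.d G.a ∈ gammaCover 4 := by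
  obtain ⟨t, ht, he⟩ := exists_e_eq
  have hf : G.f ∈ gammaCover 4 := gammaGen_four ▸ gammaGen_mem_gammaCover 4
  rw [← G.e, he]
  exact mul_mem (mul_mem (commSqSeries_le_gammaCover _ d_zpow_neg_two_mem_commSqSeries) hf)
    (commSqSeries_le_gammaCover _ (prodSelf_gamma_three_le_commSqSeries ht))

theorem comm_d_b_mem_gammaCover : comm G.d G.b ∈ gammaCover 4 := by
  refine commSqSeries_le_gammaCover _ (prodSelf_gamma_three_le_commSqSeries ?_)
  rw [comm_mem_iff_commute]
  exact commute_b_mod_prodSelf d_mem_commutator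

theorem comm_f_a_mem_gammaCover : comm G.f G.a ∈ gammaCover 5 := by
  have hcomm : comm G.f G.a = (G.f ^ 2)⁻¹ := by
    rw [comm_eq_inv_mul_conj, inv_a_mul_f_mul_a, pow_two, mul_inv_rev]
  rw [hcomm]
  exact commSqSeries_le_gammaCover _
    (inv_mem (sq_mem_sqSeries _ (by norm_num) (by norm_num) f_mem_commSqSeries))

theorem comm_f_b_eq_gammaGen : comm G.f G.b = gammaGen 5 := by
  have hcomm : IsPair (comm G.f G.b) G.d 1 := by
    rw [G.d]
    exact IsPair.f.comm_b
  exact hcomm.eq (gammaGen_three ▸ isPair_gammaGen (m := 3) le_rfl)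

theorem comm_sq_right {Γ : Type*} [Group Γ] (w y : Γ) :
    comm w (y ^ 2) = comm w y ^ 2 * comm (comm w y) y := by
  simp only [comm, pow_two]
  group

theorem comm_gammaGen_odd_b_mem {m : ℕ} (hm : 3 ≤ m) :
    comm (gammaGen (2 * m - 1)) G.b ∈ gammaCover (2 * m) := by
  have hcomm := comm_mem_commSqSeries (by omega) (gammaGen_mem_commSqSeries m (by omega)) G.a
  rw [Nat.sub_add_cancel (by omega)] at hcomm
  exact commSqSeries_le_gammaCover _ (mem_of_mem_leftFactor (isPair_gammaGen hm).comm_b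
    (commSqSeries_le_leftFactor (by omega) hcomm))

/- As `a ^ 2 = ⟨b, b⟩`, the commutator with `a ^ 2` reduces to the left factor, and it is the
iterated commutator with `a` up to a square. -/
theorem comm_gammaGen_even_a_mem {m : ℕ} (hm : 3 ≤ m)
    (hb : comm (gammaGen m) G.b ∈ gammaCover (m + 1)) :
    comm (gammaGen (2 * m)) G.a ∈ gammaCover (2 * m + 1) := by
  have hpair : IsPair (comm (gammaGen (2 * m - 1)) (G.a ^ 2)) (comm (gammaGen m) G.b) 1 := by
    simpa [comm] using (isPair_gammaGen hm).comm IsPair.a_sq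
  have hcomm_a_sq : comm (gammaGen (2 * m - 1)) (G.a ^ 2) ∈ gammaCover (2 * m + 1) :=
    mem_of_mem_leftFactor hpair (gammaCover_succ_le_leftFactor (by omega) hb)
  have hcomm_sq : comm (gammaGen (2 * m - 1)) G.a ^ 2 ∈ commSqSeries (2 * m + 1) := by
    have hcomm := comm_mem_commSqSeries (by omega)
      (gammaGen_mem_commSqSeries (2 * m - 1) (by omega)) G.a
    exact sq_mem_sqSeries _ (by omega) (by omega) hcomm
  rwa [comm_sq_right, (gammaCover _).mul_mem_cancel_left (commSqSeries_le_gammaCover _ hcomm_sq),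
    ← gammaGen_even hm] at hcomm_a_sq

theorem comm_gammaGen_even_b_mem {m : ℕ} (hm : 3 ≤ m)
    (ha : comm (gammaGen m) G.a ∈ gammaCover (m + 1)) :
    comm (gammaGen (2 * m)) G.b ∈ gammaCover (2 * m + 1) := by
  have hcomm_inv : comm (gammaGen m)⁻¹ G.a ∈ gammaCover (m + 1) := by
    rw [comm_mem_iff_commute] at ha ⊢
    exact ha.inv_left
  have hpair : IsPair (comm (gammaGen (2 * m)) G.b) (comm (gammaGen m)⁻¹ G.a) 1 := by
    rw [gammaGen_even hm]
    simpa using (isPair_gammaGen hm).comm_a.comm_b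
  exact mem_of_mem_leftFactor hpair (gammaCover_succ_le_leftFactor (by omega) hcomm_inv)

theorem comm_gammaGen_mem_gammaCover (n : ℕ) (hn : 2 ≤ n) :
    comm (gammaGen n) G.a ∈ gammaCover (n + 1) ∧ comm (gammaGen n) G.b ∈ gammaCover (n + 1) := by
  induction n, hn using gammaGen_induction with
  | two =>
    rw [gammaGen_two, ← G.d, ← gammaGen_three]
    exact ⟨gammaGen_mem_gammaCover 3, comm_c_b_mem⟩
  | three => rw [gammaGen_three]; exact ⟨comm_d_a_mem_gammaCover, comm_d_b_mem_gammaCover⟩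
  | four =>
    rw [gammaGen_four, comm_f_b_eq_gammaGen]
    exact ⟨comm_f_a_mem_gammaCover, gammaGen_mem_gammaCover 5⟩
  | odd m hm _ =>
    rw [← gammaGen_even hm, Nat.sub_add_cancel (by omega)]
    exact ⟨gammaGen_mem_gammaCover _, comm_gammaGen_odd_b_mem hm⟩
  | even m hm ih => exact ⟨comm_gammaGen_even_a_mem hm ih.2, comm_gammaGen_even_b_mem hm ih.1⟩

theorem commutator_zpowers_gammaGen_le {n : ℕ} (hn : 2 ≤ n) :
    ⁅Subgroup.zpowers (gammaGen n), (⊤ : Subgroup G)⁆ ≤ gammaCover (n + 1) := by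
  obtain ⟨ha, hb⟩ := comm_gammaGen_mem_gammaCover n hn
  rw [comm_mem_iff_commute] at ha hb
  apply commutator_top_le
  · rintro _ ⟨k, rfl⟩
    rw [commutatorElement_mem_iff_commute]
    exact ha.zpow_left k
  · rintro _ ⟨k, rfl⟩
    rw [commutatorElement_mem_iff_commute]
    exact hb.zpow_left k

theorem gamma_le_gammaCover (n : ℕ) (hn : 2 ≤ n) : gamma G n ≤ gammaCover n := by
  induction n, hn using Nat.le_induction with
  | base =>
    rw [gamma_two]
    exact commutator_le_of_c_mem
      (gammaGen_two ▸ gammaGen_mem_gammaCover 2)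
  | succ n hn ih =>
    rw [gamma_succ _ (by omega)]
    refine (Subgroup.commutator_mono ih le_rfl).trans
      (commutator_sup_left_le (commutator_zpowers_gammaGen_le hn) ?_)
    exact (commutator_sqSeries_le _ _ (by omega)).trans (commSqSeries_le_gammaCover (n + 1))

theorem mixed_le_zpowers_sup {n : ℕ} (hn : 2 ≤ n) :
    mixed G n ≤ Subgroup.zpowers (gammaGen n) ⊔ twoCentral G (n + 1) := by
  refine sup_le ((gamma_le_gammaCover n hn).trans (sup_le_sup_left ?_ _)) le_sup_right
  exact sqSeries_commutator_le_twoCentral _ (by omega)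

end GammaCover

theorem dyadicCore_eq_gamma_three {i : ℕ} (hi : i < 2) : dyadicCore i = gamma G 3 := by
  interval_cases i
  exacts [dyadicCore_zero, dyadicCore_one]

theorem gammaGen_odd_mem_dyadicCore {m : ℕ} (hm : 3 ≤ m)
    (ih : ∀ i, 2 ^ i < m → gammaGen m ∈ dyadicCore i) {i : ℕ} (hi : 2 ^ i < 2 * m) :
    gammaGen (2 * m - 1) ∈ dyadicCore i := by
  have hprod (j : ℕ) (hj : 2 ^ j < m) : gammaGen (2 * m - 1) ∈ prodSelf (dyadicCore j) :=
    (mem_prodSelf_iff (isPair_gammaGen hm)).2 ⟨ih j hj, one_mem _⟩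
  cases i with
  | zero =>
    have hprod_zero := hprod 0 (by omega)
    rw [dyadicCore_zero] at hprod_zero ⊢
    exact prodSelf_gamma_three_le hprod_zero
  | succ i => exact prodSelf_dyadicCore_le i (hprod i (by rw [pow_succ] at hi; omega))

theorem gammaGen_mem_dyadicCore (n : ℕ) (hn : 2 ≤ n) :
    ∀ i, 3 ≤ n → 2 ^ i < n → gammaGen n ∈ dyadicCore i := by
  have lt_two {i n : ℕ} (hn : n ≤ 4) (hi : 2 ^ i < n) : i < 2 :=
    (Nat.pow_lt_pow_iff_right one_lt_two).1 (hi.trans_le hn)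
  induction n, hn using gammaGen_induction with
  | two => intro i h; omega
  | three =>
    intro i _ hi
    rw [gammaGen_three, dyadicCore_eq_gamma_three (lt_two (by norm_num) hi)]
    exact d_mem_gamma_three
  | four =>
    intro i _ hi
    rw [gammaGen_four, dyadicCore_eq_gamma_three (lt_two le_rfl hi)]
    exact f_mem_gamma_three
  | odd m hm ih =>
    intro i _ hi
    exact gammaGen_odd_mem_dyadicCore hm (fun j => ih j hm) (by omega)
  | even m hm ih =>
    intro i _ hi
    rw [gammaGen_even hm]
    exact comm_mem_of_mem_left (gammaGen_odd_mem_dyadicCore hm (fun j => ih j hm) hi) _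

theorem twoCentral_le_dyadicTerm (i : ℕ) : twoCentral G (2 ^ i + 1) ≤ dyadicTerm i := by
  induction i with
  | zero => rw [dyadicTerm_zero, pow_zero]
  | succ i ih =>
    have hpos := Nat.one_le_two_pow (n := i)
    have le_sup_succ (n : ℕ) (hn : 2 ^ (i + 1) + 1 ≤ n) :
        twoCentral G n ≤ dyadicTerm (i + 1) ⊔ twoCentral G (n + 1) := by
      rw [pow_succ] at hn
      refine (twoCentral_le_mixed_sup_squares n (by omega)).trans (sup_le ?_ ?_)
      · refine (mixed_le_zpowers_sup (by omega)).trans (sup_le_sup_right ?_ _)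
        rw [Subgroup.zpowers_le]
        exact dyadicCore_le_dyadicTerm _
          (gammaGen_mem_dyadicCore n (by omega) _ (by omega) (by rw [pow_succ]; omega))
      · refine (squares_mono ?_).trans ((squares_dyadicTerm_le i).trans le_sup_left)
        exact (twoCentral_antitone (by omega)).trans ih
    have le_sup_add (k : ℕ) : twoCentral G (2 ^ (i + 1) + 1) ≤
        dyadicTerm (i + 1) ⊔ twoCentral G (2 ^ (i + 1) + 1 + k) := by
      induction k with
      | zero => exact le_sup_right
      | succ k ihk => exact ihk.trans (sup_le le_sup_left (le_sup_succ _ (by omega)))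
    obtain ⟨N, -, hN⟩ := isCofinal_dyadicTerm (i + 1)
    exact (le_sup_add N).trans (sup_le le_rfl ((twoCentral_antitone (by omega)).trans hN))

section Index

variable {Γ : Type*} [Group Γ]

theorem relIndex_eq_card_map (M X : Subgroup Γ) [M.Normal] :
    M.relIndex X = Nat.card (X.map (QuotientGroup.mk' M)) := by
  rw [← Subgroup.relIndex_ker, QuotientGroup.ker_mk']

theorem relIndex_zpowers_sup_dvd_two (M : Subgroup Γ) [M.Normal] {z : Γ} (hz : z ^ 2 ∈ M) :
    M.relIndex (Subgroup.zpowers z ⊔ M) ∣ 2 := by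
  rw [Subgroup.relIndex_sup_right, relIndex_eq_card_map, MonoidHom.map_zpowers, Nat.card_zpowers]
  exact orderOf_dvd_of_pow_eq_one ((QuotientGroup.eq_one_iff (z ^ 2)).2 hz)

theorem relIndex_dvd_two_of_le_zpowers_sup {M X : Subgroup Γ} [M.Normal] {z : Γ} (hz : z ^ 2 ∈ M)
    (h : X ≤ Subgroup.zpowers z ⊔ M) (hM : M ≤ X) : M.relIndex X ∣ 2 :=
  (Dvd.intro _ (Subgroup.relIndex_mul_relIndex M X _ hM h)).trans
    (relIndex_zpowers_sup_dvd_two M hz)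

/- Squaring induces a homomorphism from `X / N` onto a group containing `Z / M`. -/
theorem relIndex_dvd_of_le_sup_squares {X Z M N : Subgroup Γ} [M.Normal] (hX : ⁅X, X⁆ ≤ M)
    (hN : squares N ≤ M) (h : Z ≤ M ⊔ squares X) (hM : M ≤ Z) :
    M.relIndex Z ∣ N.relIndex X := by
  let sq : X →* Γ ⧸ M :=
    { toFun := fun x => (x : Γ) ^ 2
      map_one' := by simp
      map_mul' := fun x y => by
        have hxy : Commute ((x : Γ) : Γ ⧸ M) ((y : Γ) : Γ ⧸ M) :=
          (commutatorElement_mem_iff_commute _ _ _).1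
            (hX (Subgroup.commutator_mem_commutator x.2 y.2))
        rw [Subgroup.coe_mul, QuotientGroup.mk_mul, hxy.mul_pow] }
  have hrange : (squares X).map (QuotientGroup.mk' M) ≤ sq.range :=
    Subgroup.map_le_iff_le_comap.2 (squares_le.2 fun x hx => ⟨⟨x, hx⟩, rfl⟩)
  have hker : N.subgroupOf X ≤ sq.ker := fun x hx =>
    (QuotientGroup.eq_one_iff ((x : Γ) ^ 2)).2 (hN (sq_mem_squares hx))
  calc M.relIndex Z ∣ M.relIndex (M ⊔ squares X) :=
        Dvd.intro _ (Subgroup.relIndex_mul_relIndex M Z _ hM h)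
    _ = Nat.card ((squares X).map (QuotientGroup.mk' M)) := by
        rw [sup_comm, Subgroup.relIndex_sup_right, relIndex_eq_card_map]
    _ ∣ Nat.card sq.range := Subgroup.card_dvd_of_le hrange
    _ = sq.ker.index := (Subgroup.index_ker sq).symm
    _ ∣ N.relIndex X := Subgroup.index_dvd_of_le hker

theorem card_le_relIndex {ι : Type*} {M X : Subgroup Γ} (hM : M.relIndex X ≠ 0) {f : ι → Γ}
    (hf : ∀ i, f i ∈ X) (hinj : ∀ i j, (f i)⁻¹ * f j ∈ M → i = j) :
    Nat.card ι ≤ M.relIndex X := by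
  have : Finite (X ⧸ M.subgroupOf X) := Nat.finite_of_card_ne_zero hM
  exact Nat.card_le_card_of_injective (fun i => (QuotientGroup.mk ⟨f i, hf i⟩ : X ⧸ M.subgroupOf X))
    fun i j hij => hinj i j ((QuotientGroup.eq (s := M.subgroupOf X)).1 hij)

theorem fin_eq_of_dvd_sub {N : ℕ} {x y : Fin N} (h : (N : ℤ) ∣ (y : ℤ) - (x : ℤ)) : x = y :=
  Fin.ext (Nat.ModEq.eq_of_lt_of_lt (Nat.modEq_iff_dvd.2 h) x.2 y.2)

theorem le_relIndex_of_dvd {M X : Subgroup Γ} (hM : M.relIndex X ≠ 0) {N : ℕ} {u : Γ} (hu : u ∈ X)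
    (h : ∀ x : ℤ, u ^ x ∈ M → (N : ℤ) ∣ x) : N ≤ M.relIndex X := by
  rw [← Nat.card_fin N]
  refine card_le_relIndex hM (f := fun x : Fin N => u ^ (x : ℤ)) (fun _ => zpow_mem hu _) ?_
  intro x y hxy
  rw [← zpow_neg, ← zpow_add, neg_add_eq_sub] at hxy
  exact fin_eq_of_dvd_sub (h _ hxy)

theorem sq_le_relIndex_of_dvd {M X : Subgroup Γ} [M.Normal] (hM : M.relIndex X ≠ 0) {N : ℕ}
    {u v : Γ} (hu : u ∈ X) (hv : v ∈ X) (huv : ⁅u, v⁆ ∈ M)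
    (h : ∀ x y : ℤ, u ^ x * v ^ y ∈ M → (N : ℤ) ∣ x ∧ (N : ℤ) ∣ y) : N ^ 2 ≤ M.relIndex X := by
  have hcard : Nat.card (Fin N × Fin N) = N ^ 2 := by rw [Nat.card_prod, Nat.card_fin, pow_two]
  rw [← hcard]
  refine card_le_relIndex hM (f := fun z : Fin N × Fin N => u ^ (z.1 : ℤ) * v ^ (z.2 : ℤ))
    (fun _ => mul_mem (zpow_mem hu _) (zpow_mem hv _)) ?_
  rintro ⟨x, y⟩ ⟨x', y'⟩ hmem
  have hcomm : Commute (u : Γ ⧸ M) (v : Γ ⧸ M) := (commutatorElement_mem_iff_commute M u v).1 huv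
  have hmk : ((u ^ ((x' : ℤ) - x) * v ^ ((y' : ℤ) - y) : Γ) : Γ ⧸ M) = 1 := by
    rw [← (QuotientGroup.eq_one_iff _).2 hmem]
    change (u : Γ ⧸ M) ^ ((x' : ℤ) - x) * (v : Γ ⧸ M) ^ ((y' : ℤ) - y) =
      ((u : Γ ⧸ M) ^ (x : ℤ) * (v : Γ ⧸ M) ^ (y : ℤ))⁻¹ *
        ((u : Γ ⧸ M) ^ (x' : ℤ) * (v : Γ ⧸ M) ^ (y' : ℤ))
    rw [(hcomm.zpow_zpow _ _).eq, mul_inv_rev, ← zpow_neg, ← zpow_neg, mul_assoc,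
      ← mul_assoc _ _ ((v : Γ ⧸ M) ^ (y' : ℤ)), ← zpow_add, neg_add_eq_sub,
      (hcomm.zpow_zpow _ _).eq, ← mul_assoc, ← zpow_add, neg_add_eq_sub]
  obtain ⟨hx, hy⟩ := h _ _ ((QuotientGroup.eq_one_iff _).1 hmk)
  rw [fin_eq_of_dvd_sub hx, fin_eq_of_dvd_sub hy]

end Index

section Rank

/-- The rank of the factor `Γₙ / Γₙ₊₁` of the lower `2`-central series, in recursive form. -/
def rank (n : ℕ) : ℕ :=
  if n ≤ 1 then 2 else if n % 2 = 0 then rank (n / 2) + 1 else 1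
  termination_by n

theorem rank_one : rank 1 = 2 := by rw [rank, if_pos le_rfl]

theorem rank_even {m : ℕ} (hm : 1 ≤ m) : rank (2 * m) = rank m + 1 := by
  rw [rank, if_neg (by omega), if_pos (by omega), show 2 * m / 2 = m by omega]

theorem rank_odd {m : ℕ} (hm : 1 ≤ m) : rank (2 * m + 1) = 1 := by
  rw [rank, if_neg (by omega), if_neg (by omega)]

theorem rank_two_pow (i : ℕ) : rank (2 ^ i) = i + 2 := by
  induction i with
  | zero => exact rank_one
  | succ i ih => rw [pow_succ', rank_even Nat.one_le_two_pow, ih]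

theorem sum_rank_two_mul (m : ℕ) : ∑ n ∈ Finset.range (2 * (m + 1)), rank (n + 1) =
    ∑ n ∈ Finset.range (m + 1), rank (n + 1) + 2 * (m + 1) + 1 := by
  induction m with
  | zero =>
    have rank_two : rank 2 = 3 := by simpa only [mul_one, rank_one] using rank_even (m := 1) le_rfl
    simp [Finset.sum_range_succ, rank_one, rank_two]
  | succ m ih =>
    rw [show 2 * (m + 1 + 1) = 2 * (m + 1) + 1 + 1 by ring, Finset.sum_range_succ,
      Finset.sum_range_succ, ih, Finset.sum_range_succ _ (m + 1), rank_odd (by omega),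
      show 2 * (m + 1) + 1 + 1 = 2 * (m + 1 + 1) by ring, rank_even (by omega)]
    ring

theorem sum_rank_two_pow (i : ℕ) :
    ∑ n ∈ Finset.range (2 ^ i), rank (n + 1) = 2 ^ (i + 1) + i := by
  induction i with
  | zero => simp [rank_one]
  | succ i ih =>
    have hdouble := sum_rank_two_mul (2 ^ i - 1)
    rw [Nat.sub_add_cancel Nat.one_le_two_pow, ih] at hdouble
    rw [pow_succ' 2 i, hdouble]
    ring

theorem isGreatest_rank (n : ℕ) (hn : 1 ≤ n) (h : ∀ i, n ≠ 2 ^ i) :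
    IsGreatest {m : ℕ | ∃ i : ℕ, m = i + 1 ∧ 2 ^ i ∣ n} (rank n) := by
  induction n using Nat.strong_induction_on with
  | _ n ih =>
    rcases Nat.even_or_odd' n with ⟨m, rfl | rfl⟩
    · have hm : ∀ i, m ≠ 2 ^ i := fun i hi => h (i + 1) (by rw [hi, pow_succ'])
      obtain ⟨⟨j, hj, hdvd⟩, hub⟩ := ih m (by omega) (by omega) hm
      rw [rank_even (by omega)]
      refine ⟨⟨j + 1, by rw [hj], by rw [pow_succ']; exact Nat.mul_dvd_mul_left 2 hdvd⟩, ?_⟩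
      rintro _ ⟨i, rfl, hi⟩
      cases i with
      | zero => omega
      | succ i =>
        rw [pow_succ'] at hi
        have hle := hub ⟨i, rfl, Nat.dvd_of_mul_dvd_mul_left (by norm_num) hi⟩
        omega
    · have hm : m ≠ 0 := fun hm => h 0 (by rw [hm]; rfl)
      rw [rank_odd (by omega)]
      refine ⟨⟨0, rfl, one_dvd _⟩, ?_⟩
      rintro _ ⟨i, rfl, hi⟩
      cases i with
      | zero => exact le_rfl
      | succ i =>
        rw [pow_succ'] at hi
        have htwo := dvd_of_mul_right_dvd hi
        omega

end Rank

section UpperBound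

theorem relIndex_mixed_dvd_two {n : ℕ} (hn : 2 ≤ n) :
    (twoCentral G (n + 1)).relIndex (mixed G n) ∣ 2 :=
  relIndex_dvd_two_of_le_zpowers_sup
    (sq_mem_twoCentral (by omega) (by omega) (gammaGen_mem_twoCentral hn))
    (mixed_le_zpowers_sup hn) (le_mixed le_rfl)

theorem relIndex_twoCentral_one_dvd_four : (twoCentral G 2).relIndex (twoCentral G 1) ∣ 4 := by
  have hsq (g : G) : g ^ 2 ∈ twoCentral G 2 :=
    sq_mem_twoCentral (n := 1) le_rfl le_rfl (by rw [twoCentral_one]; trivial)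
  have hcomm : commutator G ≤ twoCentral G 2 := by
    rw [← gamma_two]
    exact gamma_le_twoCentral 2 (by norm_num)
  let X : Subgroup G := Subgroup.zpowers G.b ⊔ twoCentral G 2
  have hX : X.Normal := Subgroup.Normal.of_commutator_le _ (hcomm.trans le_sup_right)
  have hX_dvd : (twoCentral G 2).relIndex X ∣ 2 := relIndex_zpowers_sup_dvd_two _ (hsq _)
  have htop_dvd : X.relIndex ⊤ ∣ 2 := by
    refine relIndex_dvd_two_of_le_zpowers_sup (z := G.a) (Subgroup.mem_sup_right (hsq _)) ?_ le_top
    rw [← closure_a_b, Subgroup.closure_le]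
    rintro _ (rfl | rfl)
    · exact Subgroup.mem_sup_left (Subgroup.mem_zpowers _)
    · exact Subgroup.mem_sup_right (Subgroup.mem_sup_left (Subgroup.mem_zpowers _))
  rw [twoCentral_one, ← Subgroup.relIndex_mul_relIndex _ X _ le_sup_right le_top]
  exact mul_dvd_mul hX_dvd htop_dvd

theorem relIndex_twoCentral_even_dvd {m : ℕ} (hm : 1 ≤ m) :
    (twoCentral G (2 * m + 1)).relIndex (twoCentral G (2 * m)) ∣
      2 * (twoCentral G (m + 1)).relIndex (twoCentral G m) := by
  have hsq := twoCentral_le_mixed_sup_squares (Γ := G) (2 * m) (by omega)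
  rw [show (2 * m + 1) / 2 = m by omega] at hsq
  rw [← Subgroup.relIndex_mul_relIndex _ (mixed G (2 * m)) _ (le_mixed le_rfl)
    (mixed_le _ (by omega))]
  refine mul_dvd_mul (relIndex_mixed_dvd_two (by omega))
    (relIndex_dvd_of_le_sup_squares ?_ ?_ hsq (mixed_le _ (by omega)))
  · rw [two_mul]
    exact commutator_twoCentral_le_mixed m m (by omega) (by omega)
  · exact squares_le.2 fun x hx =>
      le_mixed (m := 2 * m + 1) le_rfl (sq_mem_twoCentral (by omega) (by omega) hx)

theorem relIndex_twoCentral_odd_dvd {m : ℕ} (hm : 1 ≤ m) :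
    (twoCentral G (2 * m + 1 + 1)).relIndex (twoCentral G (2 * m + 1)) ∣ 2 := by
  have hle : twoCentral G (2 * m + 1) ≤ mixed G (2 * m + 1) := by
    refine (twoCentral_le_mixed_sup_squares (Γ := G) _ (by omega)).trans
      (sup_le le_rfl (squares_le.2 fun x hx => ?_))
    exact le_mixed (m := 2 * m + 1 + 1) le_rfl (sq_mem_twoCentral (by omega) (by omega) hx)
  rw [← le_antisymm (mixed_le _ (by omega)) hle]
  exact relIndex_mixed_dvd_two (by omega)

theorem relIndex_twoCentral_dvd (n : ℕ) (hn : 1 ≤ n) :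
    (twoCentral G (n + 1)).relIndex (twoCentral G n) ∣ 2 ^ rank n := by
  induction n using Nat.strong_induction_on with
  | _ n ih =>
    rcases hn.eq_or_lt with rfl | hn
    · rw [rank_one]
      exact relIndex_twoCentral_one_dvd_four
    · rcases Nat.even_or_odd' n with ⟨m, rfl | rfl⟩
      · rw [rank_even (by omega), pow_succ']
        exact (relIndex_twoCentral_even_dvd (by omega)).trans
          (mul_dvd_mul_left 2 (ih m (by omega) (by omega)))
      · rw [rank_odd (by omega), pow_one]
        exact relIndex_twoCentral_odd_dvd (by omega)

theorem index_twoCentral_succ (n : ℕ) : (twoCentral G (n + 1)).index =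
    ∏ k ∈ Finset.range n, (twoCentral G (k + 1 + 1)).relIndex (twoCentral G (k + 1)) := by
  induction n with
  | zero => simp [twoCentral_one]
  | succ n ih =>
    rw [Finset.prod_range_succ, ← ih, mul_comm]
    exact (Subgroup.relIndex_mul_index (twoCentral_antitone (by omega))).symm

theorem index_twoCentral_two_pow_dvd (i : ℕ) :
    (twoCentral G (2 ^ i + 1)).index ∣ 2 ^ (2 ^ (i + 1) + i) := by
  rw [index_twoCentral_succ, ← sum_rank_two_pow, ← Finset.prod_pow_eq_pow_sum]
  exact Finset.prod_dvd_prod_of_dvd _ _ fun k _ => relIndex_twoCentral_dvd (k + 1) (by omega)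

end UpperBound

section LowerBound

theorem index_dyadicTerm_ne_zero (i : ℕ) : (dyadicTerm i).index ≠ 0 :=
  ne_zero_of_dvd_ne_zero (by positivity)
    ((Subgroup.index_dvd_of_le (twoCentral_le_dyadicTerm i)).trans (index_twoCentral_two_pow_dvd i))

theorem relIndex_dyadicTerm_ne_zero (i : ℕ) (X : Subgroup G) : (dyadicTerm i).relIndex X ≠ 0 :=
  ne_zero_of_dvd_ne_zero (index_dyadicTerm_ne_zero i)
    (Subgroup.relIndex_dvd_index_of_normal _ X)

theorem relIndex_dyadicCore_dvd (i : ℕ) :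
    (dyadicCore i).relIndex (gamma G 3) ∣ (dyadicTerm i).relIndex (gamma G 3) := by
  rw [← Subgroup.inf_relIndex_right (dyadicTerm i)]
  exact Subgroup.relIndex_dvd_of_le_left _ (dyadicTerm_inf_gamma_three_le i)

theorem relIndex_dyadicCore_ne_zero (i : ℕ) : (dyadicCore i).relIndex (gamma G 3) ≠ 0 :=
  ne_zero_of_dvd_ne_zero (relIndex_dyadicTerm_ne_zero i _) (relIndex_dyadicCore_dvd i)

theorem sq_relIndex_le_relIndex_prodSelf {H K : Subgroup G} (hK : K ≤ commutator G)
    (hne : (prodSelf H).relIndex (prodSelf K) ≠ 0) :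
    H.relIndex K ^ 2 ≤ (prodSelf H).relIndex (prodSelf K) := by
  let Q := K ⧸ H.subgroupOf K
  have hpair (p q : K) : ∃ g, IsPair g (p : G) (q : G) :=
    (exists_isPair (hK p.2) (hK q.2)).imp fun _ h => h.2
  choose P hP using hpair
  have hcard : Nat.card (Q × Q) = H.relIndex K ^ 2 := by rw [Nat.card_prod, pow_two]; rfl
  rw [← hcard]
  refine card_le_relIndex hne (f := fun z : Q × Q => P z.1.out z.2.out)
    (fun z => (mem_prodSelf_iff (hP _ _)).2 ⟨z.1.out.2, z.2.out.2⟩) ?_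
  rintro ⟨p, q⟩ ⟨p', q'⟩ hmem
  obtain ⟨hp, hq⟩ := (mem_prodSelf_iff ((hP _ _).inv.mul (hP _ _))).1 hmem
  rw [← p.out_eq, ← p'.out_eq, ← q.out_eq, ← q'.out_eq]
  exact Prod.ext (QuotientGroup.eq.2 hp) (QuotientGroup.eq.2 hq)

theorem sq_le_relIndex_dyadicCore_sup_prodSelf (i : ℕ) :
    (2 ^ i) ^ 2 ≤ (dyadicCore (i + 1) ⊔ prodSelf (gamma G 3)).relIndex (gamma G 3) := by
  refine sq_le_relIndex_of_dvd ?_ d_mem_gamma_three f_mem_gamma_three ?_ ?_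
  · exact ne_zero_of_dvd_ne_zero (relIndex_dyadicCore_ne_zero (i + 1))
      (Subgroup.relIndex_dvd_of_le_left _ le_sup_left)
  · exact Subgroup.mem_sup_right ((commutatorElement_mem_iff_commute _ _ _).2 commute_d_f)
  · intro x y hxy
    obtain ⟨g, hg, t, ht, heq⟩ := Subgroup.mem_sup_of_normal_right.1 hxy
    obtain ⟨m, n, hgcoord⟩ := (hasNormalForm i).coord hg
    have hcoord := heq ▸ hgcoord.mul (Coord.of_mem ht)
    obtain ⟨hx, hy⟩ := (Coord.zpow_mul_zpow x y).unique hcoord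
    push_cast
    exact ⟨⟨m, by rw [hx, add_zero]⟩, ⟨n, by rw [hy, add_zero]⟩⟩

theorem two_pow_mul_sq_le_relIndex_dyadicCore_succ (i : ℕ) :
    (2 ^ i) ^ 2 * (dyadicCore i).relIndex (gamma G 3) ^ 2 ≤
      (dyadicCore (i + 1)).relIndex (gamma G 3) := by
  let P := prodSelf (gamma G 3)
  have hprod : (dyadicCore (i + 1)).relIndex P * (dyadicCore (i + 1) ⊔ P).relIndex (gamma G 3) =
      (dyadicCore (i + 1)).relIndex (gamma G 3) := by
    rw [← Subgroup.relIndex_sup_right, sup_comm]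
    exact Subgroup.relIndex_mul_relIndex _ _ _ le_sup_left
      (sup_le (dyadicCore_le_gamma_three _) prodSelf_gamma_three_le)
  have hdvd : (prodSelf (dyadicCore i)).relIndex P ∣ (dyadicCore (i + 1)).relIndex P := by
    rw [← Subgroup.inf_relIndex_right (dyadicCore (i + 1))]
    exact Subgroup.relIndex_dvd_of_le_left _ (dyadicCore_inf_prodSelf_le i)
  have hne : (dyadicCore (i + 1)).relIndex P ≠ 0 :=
    left_ne_zero_of_mul (hprod ▸ relIndex_dyadicCore_ne_zero (i + 1))
  have hle : (dyadicCore i).relIndex (gamma G 3) ^ 2 ≤ (dyadicCore (i + 1)).relIndex P :=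
    (sq_relIndex_le_relIndex_prodSelf gamma_three_le_commutator
      (ne_zero_of_dvd_ne_zero hne hdvd)).trans (Nat.le_of_dvd (Nat.pos_of_ne_zero hne) hdvd)
  rw [← hprod, mul_comm]
  exact Nat.mul_le_mul hle (sq_le_relIndex_dyadicCore_sup_prodSelf i)

theorem le_relIndex_dyadicCore (i : ℕ) :
    2 ^ 2 ^ (i + 1) ≤ 2 ^ (2 * i + 2) * (dyadicCore i).relIndex (gamma G 3) := by
  induction i with
  | zero =>
    have hpos := Nat.pos_of_ne_zero (relIndex_dyadicCore_ne_zero 0)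
    norm_num
    omega
  | succ i ih =>
    calc 2 ^ 2 ^ (i + 1 + 1) = (2 ^ 2 ^ (i + 1)) ^ 2 := by rw [← pow_mul, ← pow_succ]
      _ ≤ (2 ^ (2 * i + 2) * (dyadicCore i).relIndex (gamma G 3)) ^ 2 := Nat.pow_le_pow_left ih 2
      _ = 2 ^ (2 * (i + 1) + 2) * ((2 ^ i) ^ 2 * (dyadicCore i).relIndex (gamma G 3) ^ 2) := by ring
      _ ≤ _ := Nat.mul_le_mul_left _ (two_pow_mul_sq_le_relIndex_dyadicCore_succ i)

theorem sq_le_index_dyadicTerm_sup_commutator (i : ℕ) :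
    (2 ^ (i + 1)) ^ 2 ≤ (dyadicTerm i ⊔ commutator G).index := by
  rw [← Subgroup.relIndex_top_right]
  refine sq_le_relIndex_of_dvd (u := G.a) (v := G.b) ?_ (Subgroup.mem_top _) (Subgroup.mem_top _)
    (Subgroup.mem_sup_right ?_) ?_
  · exact ne_zero_of_dvd_ne_zero (relIndex_dyadicTerm_ne_zero i ⊤)
      (Subgroup.relIndex_dvd_of_le_left _ le_sup_left)
  · exact Subgroup.commutator_mem_commutator (Subgroup.mem_top _) (Subgroup.mem_top _)
  · intro x y hxy
    obtain ⟨g, hg, s, hs, heq⟩ := Subgroup.mem_sup_of_normal_right.1 hxy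
    obtain ⟨m, n, hab⟩ := ab_of_mem_dyadicTerm hg
    have hg_eq : (G.a : Ab) ^ x * (G.b : Ab) ^ y = (g : Ab) := by
      have hmk := congrArg (fun z : G => (z : Ab)) heq
      simpa [ab_eq_one_iff.2 hs] using hmk.symm
    have hone : (G.a : Ab) ^ (x - 2 ^ (i + 1) * m) * (G.b : Ab) ^ (y - 2 ^ (i + 1) * n) = 1 := by
      rw [zpow_sub, zpow_sub, mul_mul_mul_comm, ← mul_inv, hg_eq, hab, mul_inv_cancel]
    obtain ⟨hx, hy⟩ := eq_zero_of_ab_eq_one hone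
    push_cast
    exact ⟨⟨m, sub_eq_zero.1 hx⟩, ⟨n, sub_eq_zero.1 hy⟩⟩

theorem le_relIndex_dyadicTerm_sup_gamma_three (i : ℕ) :
    2 ^ i ≤ (dyadicTerm i ⊔ gamma G 3).relIndex (commutator G) := by
  refine le_relIndex_of_dvd ?_ c_mem_commutator ?_
  · exact ne_zero_of_dvd_ne_zero (relIndex_dyadicTerm_ne_zero i _)
      (Subgroup.relIndex_dvd_of_le_left _ le_sup_left)
  · intro z hz
    obtain ⟨g, hg, s, hs, heq⟩ := Subgroup.mem_sup_of_normal_right.1 hz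
    have hg_comm : g ∈ commutator G := by
      rw [← Subgroup.mul_mem_cancel_right _ (gamma_three_le_commutator hs), heq]
      exact zpow_mem c_mem_commutator z
    obtain ⟨t, h, hh, rfl⟩ := exists_of_mem_dyadicTerm_of_mem_commutator hg hg_comm
    have hmem : G.c ^ (z - 2 ^ i * t) ∈ gamma G 3 := by
      rw [zpow_sub, ← heq, mul_assoc _ h s]
      exact (gamma_normal G 3).conj_mem _ (mul_mem (dyadicCore_le_gamma_three i hh) hs) _
    push_cast
    exact ⟨t, sub_eq_zero.1 (eq_zero_of_c_zpow_mem_gamma_three hmem)⟩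

theorem index_dyadicTerm (i : ℕ) : (dyadicTerm i).index =
    (dyadicTerm i).relIndex (gamma G 3) * (dyadicTerm i ⊔ gamma G 3).relIndex (commutator G) *
      (dyadicTerm i ⊔ commutator G).index := by
  have hsup : dyadicTerm i ⊔ commutator G = commutator G ⊔ (dyadicTerm i ⊔ gamma G 3) := by
    rw [sup_comm, sup_left_comm, sup_eq_left.2 gamma_three_le_commutator, sup_comm]
  have hle : dyadicTerm i ⊔ gamma G 3 ≤ dyadicTerm i ⊔ commutator G :=
    sup_le_sup_left gamma_three_le_commutator _
  rw [← Subgroup.relIndex_mul_index (le_sup_left : dyadicTerm i ≤ dyadicTerm i ⊔ gamma G 3),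
    ← Subgroup.relIndex_mul_index hle, ← mul_assoc, sup_comm (dyadicTerm i) (gamma G 3),
    Subgroup.relIndex_sup_right, sup_comm (gamma G 3), hsup, Subgroup.relIndex_sup_right]

theorem le_index_dyadicTerm (i : ℕ) : 2 ^ (2 ^ (i + 1) + i) ≤ (dyadicTerm i).index := by
  have hcore : (dyadicCore i).relIndex (gamma G 3) ≤ (dyadicTerm i).relIndex (gamma G 3) :=
    Nat.le_of_dvd (Nat.pos_of_ne_zero (relIndex_dyadicTerm_ne_zero i _)) (relIndex_dyadicCore_dvd i)
  calc 2 ^ (2 ^ (i + 1) + i) = 2 ^ 2 ^ (i + 1) * 2 ^ i := pow_add _ _ _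
    _ ≤ 2 ^ (2 * i + 2) * (dyadicCore i).relIndex (gamma G 3) * 2 ^ i :=
      Nat.mul_le_mul_right _ (le_relIndex_dyadicCore i)
    _ = (dyadicCore i).relIndex (gamma G 3) * 2 ^ i * (2 ^ (i + 1)) ^ 2 := by ring
    _ ≤ (dyadicTerm i).index := by
      rw [index_dyadicTerm]
      exact Nat.mul_le_mul (Nat.mul_le_mul hcore (le_relIndex_dyadicTerm_sup_gamma_three i))
        (sq_le_index_dyadicTerm_sup_commutator i)

end LowerBound

/- The upper bounds for the factors multiply up to the lower bound for the index of
`Γ_{2 ^ i + 1}`, hence none of them is strict. -/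
theorem relIndex_twoCentral (n : ℕ) (hn : 1 ≤ n) :
    (twoCentral G (n + 1)).relIndex (twoCentral G n) = 2 ^ rank n := by
  have hle (k : ℕ) : (twoCentral G (k + 1 + 1)).relIndex (twoCentral G (k + 1)) ≤
      2 ^ rank (k + 1) := Nat.le_of_dvd (by positivity) (relIndex_twoCentral_dvd _ (by omega))
  have hpos (k : ℕ) : 0 < (twoCentral G (k + 1 + 1)).relIndex (twoCentral G (k + 1)) :=
    Nat.pos_of_dvd_of_pos (relIndex_twoCentral_dvd _ (by omega)) (by positivity)
  obtain ⟨m, rfl⟩ := Nat.exists_eq_add_of_le' hn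
  by_contra hne
  have hlt : (twoCentral G (2 ^ (m + 1) + 1)).index < 2 ^ (2 ^ (m + 1 + 1) + (m + 1)) := by
    rw [index_twoCentral_succ, ← sum_rank_two_pow, ← Finset.prod_pow_eq_pow_sum]
    refine Finset.prod_lt_prod (fun k _ => hpos k) (fun k _ => hle k)
      ⟨m, Finset.mem_range.2 (m.lt_succ_self.trans Nat.lt_two_pow_self), (hle m).lt_of_ne hne⟩
  have hindex_pos := Nat.pos_of_dvd_of_pos (index_twoCentral_two_pow_dvd (m + 1)) (by positivity)
  have hindex_le := Nat.le_of_dvd hindex_pos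
    (Subgroup.index_dvd_of_le (twoCentral_le_dyadicTerm (m + 1)))
  exact absurd ((le_index_dyadicTerm (m + 1)).trans hindex_le) (not_le.2 hlt)

section CyclicFactors

variable {Γ : Type*} [Group Γ] {X M : Subgroup Γ} [M.Normal]

theorem nonempty_factor_mulEquiv_int_prod {u v : Γ} (hu : u ∈ X) (hv : v ∈ X) (huv : ⁅u, v⁆ ∈ M)
    (hind : ∀ m n : ℤ, u ^ m * v ^ n ∈ M → m = 0 ∧ n = 0)
    (hgen : ∀ g ∈ X, ∃ m n : ℤ, (u ^ m * v ^ n)⁻¹ * g ∈ M) :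
    Nonempty (Factor X M ≃* Multiplicative (ℤ × ℤ)) := by
  let power (w : X) : Multiplicative ℤ →* Factor X M := zpowersHom _ (w : Factor X M)
  have hcomm (m n : Multiplicative ℤ) : Commute (power ⟨u, hu⟩ m) (power ⟨v, hv⟩ n) :=
    ((commutatorElement_mem_iff_commute (M.subgroupOf X) ⟨u, hu⟩ ⟨v, hv⟩).1 huv).zpow_zpow _ _
  let φ := ((power ⟨u, hu⟩).noncommCoprod (power ⟨v, hv⟩) hcomm).comp
    (MulEquiv.prodMultiplicative ℤ ℤ).toMonoidHom
  have hφ (z : Multiplicative (ℤ × ℤ)) :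
      φ z = ((⟨u, hu⟩ ^ z.toAdd.1 * ⟨v, hv⟩ ^ z.toAdd.2 : X) : Factor X M) := rfl
  refine ⟨(MulEquiv.ofBijective φ ⟨(injective_iff_map_eq_one φ).2 fun z hz => ?_, ?_⟩).symm⟩
  · rw [hφ, QuotientGroup.eq_one_iff] at hz
    obtain ⟨hm, hn⟩ := hind _ _ hz
    exact Multiplicative.toAdd.injective (Prod.ext hm hn)
  · intro q
    obtain ⟨⟨g, hg⟩, rfl⟩ := QuotientGroup.mk_surjective q
    obtain ⟨m, n, hmn⟩ := hgen g hg
    exact ⟨Multiplicative.ofAdd (m, n), QuotientGroup.eq.2 hmn⟩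

theorem nonempty_factor_mulEquiv_zmod {u : Γ} {N : ℕ} (hu : u ∈ X)
    (hker : ∀ n : ℤ, u ^ n ∈ M ↔ (N : ℤ) ∣ n) (hgen : ∀ g ∈ X, ∃ n : ℤ, (u ^ n)⁻¹ * g ∈ M) :
    Nonempty (Factor X M ≃* Multiplicative (ZMod N)) := by
  let w : X := ⟨u, hu⟩
  let q : Factor X M := w
  have hq_gen (r : Factor X M) : r ∈ Subgroup.zpowers q := by
    obtain ⟨⟨g, hg⟩, rfl⟩ := QuotientGroup.mk_surjective r
    obtain ⟨n, hn⟩ := hgen g hg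
    have hn : (w ^ n)⁻¹ * ⟨g, hg⟩ ∈ M.subgroupOf X := hn
    exact ⟨n, QuotientGroup.eq.2 hn⟩
  have hq_pow (n : ℤ) : q ^ n = 1 ↔ (N : ℤ) ∣ n :=
    (QuotientGroup.eq_one_iff (N := M.subgroupOf X) (w ^ n)).trans (hker n)
  have hq_order : orderOf q = N := by
    refine Nat.dvd_antisymm (orderOf_dvd_of_pow_eq_one ?_) ?_
    · exact_mod_cast (hq_pow N).2 dvd_rfl
    · exact_mod_cast (hq_pow (orderOf q)).1 (by exact_mod_cast pow_orderOf_eq_one q)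
  exact ⟨(zmodMulEquivOfGenerator hq_gen
    ((orderOf_eq_card_of_forall_mem_zpowers hq_gen).symm.trans hq_order)).symm⟩

end CyclicFactors

theorem nonempty_mulEquiv_of_sq_eq_one {Q : Type*} [Group Q] {r : ℕ} (hsq : ∀ q : Q, q ^ 2 = 1)
    (hcard : Nat.card Q = 2 ^ r) : Nonempty (Q ≃* Multiplicative (Fin r → ZMod 2)) := by
  let _ : CommGroup Q :=
    { (inferInstance : Group Q) with
      mul_comm := Commute.of_orderOf_dvd_two fun q => orderOf_dvd_of_pow_eq_one (hsq q) }
  let _ : Module (ZMod 2) (Additive Q) := AddCommGroup.zmodModule fun q => hsq q.toMul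
  have : Finite (Additive Q) := Nat.finite_of_card_ne_zero (α := Q) (by rw [hcard]; positivity)
  have hrank : Module.finrank (ZMod 2) (Additive Q) = r := by
    have hpow := Module.natCard_eq_pow_finrank (K := ZMod 2) (V := Additive Q)
    rw [Nat.card_zmod, show Nat.card (Additive Q) = 2 ^ r from hcard] at hpow
    exact (Nat.pow_right_injective le_rfl hpow).symm
  have e := LinearEquiv.ofFinrankEq (Additive Q) (Fin r → ZMod 2)
    (by rw [hrank, Module.finrank_fin_fun])
  exact ⟨AddEquiv.toMultiplicativeRight e.toAddEquiv⟩

theorem nonempty_factor_twoCentral {n : ℕ} (hn : 1 ≤ n) :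
    Nonempty (Factor (twoCentral G n) (twoCentral G (n + 1)) ≃*
      Multiplicative (Fin (rank n) → ZMod 2)) := by
  refine nonempty_mulEquiv_of_sq_eq_one (fun q => ?_) (relIndex_twoCentral n hn)
  obtain ⟨⟨g, hg⟩, rfl⟩ := QuotientGroup.mk_surjective q
  exact (QuotientGroup.eq_one_iff _).2 (sq_mem_twoCentral hn (by omega) hg)

theorem nonempty_factor_gamma_one :
    Nonempty (Factor (gamma G 1) (gamma G 2) ≃* Multiplicative (ℤ × ℤ)) :=
  nonempty_factor_mulEquiv_int_prod (u := G.a) (v := G.b) trivial trivial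
    (Subgroup.commutator_mem_commutator trivial trivial)
    (fun _ _ h => eq_zero_of_ab_eq_one (ab_eq_one_iff.2 h))
    (fun g _ => (exists_ab_eq g).imp fun _ => Exists.imp fun _ h => QuotientGroup.eq.1 h.symm)

theorem nonempty_factor_gamma_two :
    Nonempty (Factor (gamma G 2) (gamma G 3) ≃* Multiplicative ℤ) := by
  refine nonempty_factor_mulEquiv_zmod (N := 0) c_mem_commutator (fun n => ?_) (fun g hg => ?_)
  · rw [Nat.cast_zero, zero_dvd_iff]
    exact ⟨eq_zero_of_c_zpow_mem_gamma_three, fun hn => hn ▸ one_mem _⟩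
  · obtain ⟨n, h, hh, rfl⟩ := exists_eq_c_zpow_mul hg
    exact ⟨n, by rwa [inv_mul_cancel_left]⟩

section GammaFour

theorem exists_eq_mul_d_zpow_mul_e_zpow {g : G} (hg : g ∈ gamma G 3) :
    ∃ x y : ℤ, ∃ t ∈ prodSelf (gamma G 3), g = t * (G.d ^ x * G.e ^ y) := by
  obtain ⟨x, y, w⟩ := exists_coord hg
  refine ⟨x + 2 * y, y, g * (G.d ^ (x + 2 * y) * G.e ^ y)⁻¹, Coord.mem_prodSelf ?_, by group⟩
  convert w.mul ((Coord.d.zpow (x + 2 * y)).mul (Coord.e.zpow y)).inv using 1 <;> ring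

/-- The elements of `⟨d, f⟩ G''` whose coordinates satisfy `4 ∣ x + 2 y`; it serves to bound `γ₄`
from above. -/
def gammaFourCover : Subgroup G where
  carrier := {g | ∃ x y : ℤ, Coord g x y ∧ 4 ∣ x + 2 * y}
  one_mem' := ⟨0, 0, Coord.of_mem (one_mem _), by simp⟩
  mul_mem' := by
    rintro _ _ ⟨x, y, w, hdvd⟩ ⟨x', y', w', hdvd'⟩
    exact ⟨_, _, w.mul w', by omega⟩
  inv_mem' := by
    rintro _ ⟨x, y, w, hdvd⟩
    exact ⟨_, _, w.inv, by omega⟩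

instance gammaFourCover_normal : gammaFourCover.Normal := by
  apply normal_of_conj <;> rintro _ ⟨x, y, w, hdvd⟩
  · exact ⟨_, _, w.inv_a_mul_mul_a, by omega⟩
  · exact ⟨_, _, w.a_mul_mul_inv_a, by omega⟩
  · exact ⟨_, _, w.inv_b_mul_mul_b, hdvd⟩
  · exact ⟨_, _, w.b_mul_mul_inv_b, hdvd⟩

theorem gamma_four_le_gammaFourCover : gamma G 4 ≤ gammaFourCover := by
  rw [gamma_succ 3 (by norm_num)]
  apply commutator_top_le <;> intro g hg <;> obtain ⟨x, y, w⟩ := exists_coord hg <;>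
    rw [← comm_mem_iff_commutatorElement_mem]
  · exact ⟨_, _, w.comm_a, by omega⟩
  · exact ⟨_, _, w.comm_b, by omega⟩

theorem f_sq_mem_gamma_four : G.f ^ 2 ∈ gamma G 4 := by
  have hcomm : comm G.f G.a = (G.f ^ 2)⁻¹ := by
    rw [comm_eq_inv_mul_conj, inv_a_mul_f_mul_a, pow_two, mul_inv_rev]
  rw [← inv_mem_iff, ← hcomm, comm_mem_iff_commutatorElement_mem, gamma_succ 3 (by norm_num)]
  exact Subgroup.commutator_mem_commutator f_mem_gamma_three trivial

theorem d_pow_four_mem_gamma_four : G.d ^ 4 ∈ gamma G 4 := by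
  have hcoord : Coord (G.d ^ (4 : ℤ) * G.e ^ (2 : ℤ) * (G.f ^ (2 : ℤ))⁻¹) 0 0 :=
    ((Coord.d.zpow 4).mul (Coord.e.zpow 2)).mul (Coord.f.zpow 2).inv
  have hmem : G.d ^ 4 * G.e ^ 2 * (G.f ^ 2)⁻¹ ∈ prodSelf (gamma G 3) :=
    mod_cast hcoord.mem_prodSelf
  have he := pow_mem e_mem_gamma_four 2
  exact (mul_mem_cancel_right he).1 ((mul_mem_cancel_right (inv_mem f_sq_mem_gamma_four)).1
    (prodSelf_gamma_three_le_gamma_four hmem))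

theorem d_zpow_mem_gamma_four {n : ℤ} : G.d ^ n ∈ gamma G 4 ↔ 4 ∣ n := by
  constructor
  · intro hn
    obtain ⟨x, y, w, hdvd⟩ := gamma_four_le_gammaFourCover hn
    obtain ⟨hx, hy⟩ := w.unique (Coord.d.zpow n)
    omega
  · rintro ⟨k, rfl⟩
    rw [zpow_mul]
    exact zpow_mem (mod_cast d_pow_four_mem_gamma_four) k

theorem nonempty_factor_gamma_three :
    Nonempty (Factor (gamma G 3) (gamma G 4) ≃* Multiplicative (ZMod 4)) := by
  refine nonempty_factor_mulEquiv_zmod d_mem_gamma_three (fun _ => d_zpow_mem_gamma_four) ?_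
  intro g hg
  obtain ⟨x, y, t, ht, rfl⟩ := exists_eq_mul_d_zpow_mul_e_zpow hg
  refine ⟨x, ?_⟩
  rw [← mul_assoc, ← mul_assoc]
  refine mul_mem ?_ (zpow_mem e_mem_gamma_four y)
  simpa using (gamma_normal G 4).conj_mem t (prodSelf_gamma_three_le_gamma_four ht) (G.d ^ x)⁻¹

end GammaFour

section FiniteFactors

theorem finite_iSup_of_commute {Q ι : Type*} [Group Q] [Finite ι] {H : ι → Subgroup Q}
    (hfin : ∀ i, Finite (H i))
    (hcomm : Pairwise fun i j => ∀ x y : Q, x ∈ H i → y ∈ H j → Commute x y) :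
    Finite (⨆ i, H i : Subgroup Q) := by
  have := Fintype.ofFinite ι
  rw [← Subgroup.noncommPiCoprod_range (hcomm := hcomm)]
  exact Finite.of_surjective _ (MonoidHom.rangeRestrict_surjective _)

variable {Γ : Type*} [Group Γ] {n : ℕ}

theorem commutator_gamma_succ_top_le (n : ℕ) : ⁅gamma Γ (n + 1), ⊤⁆ ≤ gamma Γ (n + 2) :=
  (gamma_succ (n + 1) (by omega)).ge

theorem commutatorElement_mem_gamma_succ (hn : 1 ≤ n) {x : Γ} (hx : x ∈ gamma Γ n) (s : Γ) :
    ⁅x, s⁆ ∈ gamma Γ (n + 1) := by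
  rw [gamma_succ n hn]
  exact Subgroup.commutator_mem_commutator hx (Subgroup.mem_top s)

/-- The homomorphism from `γₙ` to the quotient by `γₙ₊₂` given by commutation with `s`. -/
def commutatorHom (hn : 1 ≤ n) (s : Γ) : gamma Γ n →* Γ ⧸ gamma Γ (n + 2) where
  toFun x := (⁅(x : Γ), s⁆ : Γ)
  map_one' := by simp
  map_mul' x y := by
    have hcentral (g : Γ) : Commute ((⁅(y : Γ), s⁆ : Γ) : Γ ⧸ gamma Γ (n + 2)) g :=
      commute_mod_of_commutator_le (commutator_gamma_succ_top_le n)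
        (commutatorElement_mem_gamma_succ hn y.2 s) g
    rw [Subgroup.coe_mul, commutatorElement_mul_left_eq_conj_mul, QuotientGroup.mk_mul,
      QuotientGroup.mk_mul, QuotientGroup.mk_mul, QuotientGroup.mk_inv, ← (hcentral x).eq,
      mul_inv_cancel_right, (hcentral _).eq]

theorem range_commutatorHom_le_center (hn : 1 ≤ n) (s : Γ) :
    (commutatorHom hn s).range ≤ Subgroup.center (Γ ⧸ gamma Γ (n + 2)) := by
  rintro _ ⟨x, rfl⟩
  refine Subgroup.mem_center_iff.2 fun q => ?_
  obtain ⟨g, rfl⟩ := QuotientGroup.mk_surjective q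
  exact (commute_mod_of_commutator_le (commutator_gamma_succ_top_le n)
    (commutatorElement_mem_gamma_succ hn x.2 s) g).symm

theorem finite_range_commutatorHom (hn : 1 ≤ n)
    (hfin : Finite (Factor (gamma Γ n) (gamma Γ (n + 1)))) (s : Γ) :
    Finite (commutatorHom hn s).range := by
  have hker : (gamma Γ (n + 1)).subgroupOf (gamma Γ n) ≤ (commutatorHom hn s).ker := fun x hx =>
    (QuotientGroup.eq_one_iff ⁅(x : Γ), s⁆).2
      (commutatorElement_mem_gamma_succ (Nat.le_add_left 1 n) hx s)
  refine Nat.finite_of_card_ne_zero ?_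
  rw [← Subgroup.index_ker]
  exact ne_zero_of_dvd_ne_zero Nat.card_pos.ne' (Subgroup.index_dvd_of_le hker)

theorem finite_factor_gamma_succ [Group.FG Γ] (hn : 1 ≤ n)
    (hfin : Finite (Factor (gamma Γ n) (gamma Γ (n + 1)))) :
    Finite (Factor (gamma Γ (n + 1)) (gamma Γ (n + 2))) := by
  obtain ⟨S, hS, hS_fin⟩ := Group.fg_iff.1 ‹Group.FG Γ›
  have : Finite S := hS_fin
  let R : Subgroup (Γ ⧸ gamma Γ (n + 2)) := ⨆ s : S, (commutatorHom hn (s : Γ)).range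
  have hcenter (s : S) := range_commutatorHom_le_center hn (s : Γ)
  have hR : Finite R := finite_iSup_of_commute (fun s => finite_range_commutatorHom hn hfin s)
    fun s _ _ _ y hx _ => (Subgroup.mem_center_iff.1 (hcenter s hx) y).symm
  have hR_normal : R.Normal := ⟨fun q hq r => by
    rwa [Subgroup.mem_center_iff.1 (iSup_le hcenter hq) r, mul_inv_cancel_right]⟩
  have hle : (gamma Γ (n + 1)).map (QuotientGroup.mk' (gamma Γ (n + 2))) ≤ R := by
    rw [Subgroup.map_le_iff_le_comap, gamma_succ n hn, ← hS]
    refine commutator_closure_right_le fun x hx s hs => ?_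
    exact Subgroup.mem_iSup_of_mem (⟨s, hs⟩ : S) ⟨⟨x, hx⟩, rfl⟩
  refine Nat.finite_of_card_ne_zero ?_
  change (gamma Γ (n + 2)).relIndex (gamma Γ (n + 1)) ≠ 0
  rw [relIndex_eq_card_map]
  have := Finite.of_injective _ (Subgroup.inclusion_injective hle)
  exact Nat.card_pos.ne'

instance fg_G : Group.FG G :=
  Group.fg_iff.2 ⟨{G.a, G.b}, closure_a_b, Set.toFinite _⟩

theorem finite_factor_gamma {n : ℕ} (hn : 3 ≤ n) :
    Finite (Factor (gamma G n) (gamma G (n + 1))) := by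
  induction n, hn using Nat.le_induction with
  | base =>
    obtain ⟨e⟩ := nonempty_factor_gamma_three
    exact Finite.of_equiv (ZMod 4) (Multiplicative.ofAdd.trans e.symm.toEquiv)
  | succ n hn ih => exact finite_factor_gamma_succ (by omega) ih

end FiniteFactors

section SubgroupsOfAut

theorem map_prodSelf {H : Subgroup G} (hH : H ≤ commutator G) :
    (prodSelf H).map G.subtype = prodSubgroup (H.map G.subtype) (H.map G.subtype) := by
  ext g
  constructor
  · rintro ⟨g, ⟨x, hx, y, hy, w⟩, rfl⟩
    exact ⟨(x, y), ⟨⟨x, hx, rfl⟩, ⟨y, hy, rfl⟩⟩, w.symm⟩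
  · rintro ⟨⟨_, _⟩, ⟨⟨x, hx, rfl⟩, ⟨y, hy, rfl⟩⟩, rfl⟩
    obtain ⟨g, -, w⟩ := exists_isPair (hH hx) (hH hy)
    exact ⟨g, ⟨x, hx, y, hy, w⟩, w⟩

theorem map_derivedSeries_two :
    (derivedSeries G 2).map G.subtype =
      prodSubgroup ((gamma G 3).map G.subtype) ((gamma G 3).map G.subtype) := by
  rw [← map_prodSelf gamma_three_le_commutator, ← commutator_commutator_eq_prodSelf,
    derivedSeries_succ, derivedSeries_one]

theorem gamma_three_eq_prodSelf_mul_closure :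
    (gamma G 3 : Set G) = prodSelf (gamma G 3) * (Subgroup.closure {G.d, G.e} : Set G) := by
  apply Set.Subset.antisymm
  · intro g hg
    obtain ⟨x, y, t, ht, rfl⟩ := exists_eq_mul_d_zpow_mul_e_zpow hg
    exact Set.mul_mem_mul ht (mul_mem (zpow_mem (Subgroup.subset_closure (by simp)) x)
      (zpow_mem (Subgroup.subset_closure (by simp)) y))
  · have hclosure : Subgroup.closure {G.d, G.e} ≤ gamma G 3 := by
      rw [Subgroup.closure_le, Set.pair_subset_iff]
      exact ⟨d_mem_gamma_three, gamma_antitone (by norm_num) e_mem_gamma_four⟩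
    rintro _ ⟨t, ht, w, hw, rfl⟩
    exact mul_mem (prodSelf_gamma_three_le ht) (hclosure hw)

theorem coe_map_gamma_three :
    (((gamma G 3).map G.subtype : Subgroup RAut) : Set RAut) =
      (prodSubgroup ((gamma G 3).map G.subtype) ((gamma G 3).map G.subtype) : Set RAut) *
        (Subgroup.closure {d, e} : Set RAut) := by
  have hclosure : (Subgroup.closure {G.d, G.e}).map G.subtype = Subgroup.closure {d, e} := by
    rw [MonoidHom.map_closure, Set.image_pair]
    change Subgroup.closure {(G.d : RAut), (G.e : RAut)} = _
    rw [coe_d, coe_e]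
  rw [← map_prodSelf gamma_three_le_commutator, ← hclosure, Subgroup.coe_map, Subgroup.coe_map,
    Subgroup.coe_map, gamma_three_eq_prodSelf_mul_closure, Set.image_mul]

end SubgroupsOfAut

end Basilica

theorem mainTheorem7 :
    ((derivedSeries Basilica.G 2).map Basilica.G.subtype =
        Basilica.prodSubgroup
          ((Basilica.gamma Basilica.G 3).map Basilica.G.subtype)
          ((Basilica.gamma Basilica.G 3).map Basilica.G.subtype)) ∧
    ((((Basilica.gamma Basilica.G 3).map Basilica.G.subtype : Subgroup Basilica.RAut) :
          Set Basilica.RAut) =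
        (Basilica.prodSubgroup
          ((Basilica.gamma Basilica.G 3).map Basilica.G.subtype)
          ((Basilica.gamma Basilica.G 3).map Basilica.G.subtype) : Set Basilica.RAut) *
        (Subgroup.closure {Basilica.d, Basilica.e} : Set Basilica.RAut)) ∧
    Nonempty (Basilica.Factor (Basilica.gamma Basilica.G 1) (Basilica.gamma Basilica.G 2) ≃*
      Multiplicative (ℤ × ℤ)) ∧
    Nonempty (Basilica.Factor (Basilica.gamma Basilica.G 2) (Basilica.gamma Basilica.G 3) ≃*
      Multiplicative ℤ) ∧
    Nonempty (Basilica.Factor (Basilica.gamma Basilica.G 3) (Basilica.gamma Basilica.G 4) ≃*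
      Multiplicative (ZMod 4)) ∧
    (∀ n : ℕ, 3 ≤ n → Finite
      (Basilica.Factor (Basilica.gamma Basilica.G n) (Basilica.gamma Basilica.G (n + 1)))) ∧
    (∀ i : ℕ, Nonempty
      (Basilica.Factor (Basilica.twoCentral Basilica.G (2 ^ i))
          (Basilica.twoCentral Basilica.G (2 ^ i + 1)) ≃*
        Multiplicative (Fin (i + 2) → ZMod 2))) ∧
    (∀ n : ℕ, 1 ≤ n → (∀ i : ℕ, n ≠ 2 ^ i) →
      ∃ r : ℕ, IsGreatest {m : ℕ | ∃ i : ℕ, m = i + 1 ∧ 2 ^ i ∣ n} r ∧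
        Nonempty
          (Basilica.Factor (Basilica.twoCentral Basilica.G n)
              (Basilica.twoCentral Basilica.G (n + 1)) ≃*
            Multiplicative (Fin r → ZMod 2))) := by
  refine ⟨Basilica.map_derivedSeries_two, Basilica.coe_map_gamma_three,
    Basilica.nonempty_factor_gamma_one, Basilica.nonempty_factor_gamma_two,
    Basilica.nonempty_factor_gamma_three, fun _ hn => Basilica.finite_factor_gamma hn, fun i => ?_,
    fun n hn h => ⟨_, Basilica.isGreatest_rank n hn h, Basilica.nonempty_factor_twoCentral hn⟩⟩
  rw [← Basilica.rank_two_pow i]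
  exact Basilica.nonempty_factor_twoCentral Nat.one_le_two_pow
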